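/- **Calculi.** Let $T$ be Gödel's system $T$ (simply typed $\lambda$-calculus with $\mathtt{Nat},\mathtt{Bool}$, products, conditional and primitive recursion in all types; $=$ is provable equality). A *predicate* is a closed normal term $P:\mathtt{Nat}^{k+1}\to\mathtt{Bool}$ of $T$; an *atom* is a triple $\langle P,\vec n,m\rangle$ of a predicate and numerals with $P\vec n m=\mathsf{True}$; a *state* is a finite set of atoms which contains no two atoms $\langle P,\vec n,m\rangle,\langle P,\vec n,m'\rangle$ with $m\neq m'$. The *consistent union* $s_1\Cup s_2$ is $s_1\cup s_2$ minus the atoms of $s_2$ that are inconsistent with some atom of $s_1$. $T_{\mathrm{Class}}$ is $T$ plus an atomic type $\mathtt{State}$, a constant for each state, the constant $\Cup$, and constants $X_P:\mathtt{Nat}^k\to\mathtt{Bool}$, $\Phi_P:\mathtt{Nat}^k\to\mathtt{Nat}$, $\mathsf{Add}_P:\mathtt{Nat}^{k+1}\to\mathtt{State}$. $T_{\mathrm{Learn}}$ has instead constants $\chi_P,\varphi_P,\mathsf{add}_P$ with an additional first argument of type $\mathtt{State}$ and the rules: $\chi_Ps\vec n=\mathsf{True}$ and $\varphi_Ps\vec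 n=m$ if $\langle P,\vec n,m\rangle\in s$; $\chi_Ps\vec n=\mathsf{False}$ and $\varphi_Ps\vec n=0$ if there is no such $m$; $\mathsf{add}_Ps\vec nm=\varnothing$ if $\langle P,\vec n,l\rangle\in s$ for some $l$ or $P\vec nm=\mathsf{False}$, and $\mathsf{add}_Ps\vec nm=\{\langle P,\vec n,m\rangle\}$ otherwise; $\Cup$ computes consistent union. For $t$ in $T_{\mathrm{Class}}$, $t[s]$ is the term of $T_{\mathrm{Learn}}$ obtained by replacing $X_P,\Phi_P,\mathsf{Add}_P$ with $\chi_Ps,\varphi_Ps,\mathsf{add}_Ps$. $\mathrm{PCF}_{\mathrm{Class}}$ and $\mathrm{PCF}_{\mathrm{Learn}}$ are obtained by adding fixed point constants $Y_U:(U\to U)\to U$ with $Y_Uu=u(Y_Uu)$. A closed term $t$ of $\mathrm{PCF}_{\mathrm{Class}}$ *converges* if for every weakly increasing sequence $(s_i)$ of states there is a normal form $v$ with $t[s_j]=v$ for all large $j$; it is *stable* of atomic type if it converges, of type $U\times V$ if $\pi_0t$ and $\pi_1t$ are stable, and of type $U\to V$ if $tu$ is stable for every stable $u:U$. **Realizability.**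 Formulas are built by $\wedge,\vee,\to,\forall,\exists$ from atomic formulas $Qt_1\dots t_n$, where $Q:\mathtt{Nat}^n\to\mathtt{Bool}$ is a closed term of $T$ and the $t_i:\mathtt{Nat}$ are terms of $T$ with free variables of type $\mathtt{Nat}$ only. Put $[A]=\mathtt{State}$ for atomic $A$, $[A\wedge B]=[A]\times[B]$, $[A\vee B]=\mathtt{Bool}\times([A]\times[B])$, $[A\to B]=[A]\to[B]$, $[\forall xA]=\mathtt{Nat}\to[A]$, $[\exists xA]=\mathtt{Nat}\times[A]$; $p_0,p_1,p_2$ are the three projections of a triple. For a closed formula $A$ and a closed term $t:[A]$ of $T_{\mathrm{Class}}$, or a stable closed term $t:[A]$ of $\mathrm{PCF}_{\mathrm{Class}}$, in which no state constant except $\varnothing$ occurs, define $t\Vdash_sA$ by: $t\Vdash_sA$ for $A$ atomic iff $t[s]=\varnothing$ implies $A=\mathsf{True}$; $t\Vdash_sA\wedge B$ iff $\pi_0t\Vdash_sA$ and $\pi_1t\Vdash_sB$; $t\Vdash_sA\vee B$ iff $p_0t[s]=\mathsf{True}$ and $p_1t\Vdash_sA$, or $p_0t[s]=\mathsf{False}$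 and $p_2t\Vdash_sB$; $t\Vdash_sA\to B$ iff $tu\Vdash_sB$ for all $u\Vdash_sA$; $t\Vdash_s\forall xA$ iff $tn\Vdash_sA(n)$ for all numerals $n$; $t\Vdash_s\exists xA$ iff $\pi_0t[s]=n$ and $\pi_1t\Vdash_sA(n)$ for some numeral $n$. Finally, $t\Vdash A$ iff $t\Vdash_sA$ for all states $s$. **Games.** A game is $(V,E_1,E_2,W)$ with $E_1,E_2\subseteq V\times V$, $\mathrm{Dom}(E_1)\cap\mathrm{Dom}(E_2)=\emptyset$, and $W$ a set of complete plays. Plays are finite or infinite walks in $(V,E_1\cup E_2)$; a play is complete if it is infinite or ends outside $\mathrm{Dom}(E_1\cup E_2)$. Let $f$ map finite plays to positions. A play $v_1::v_2::\cdots$ is $f$-correct if $f(v_1::\cdots::v_i)=v_{i+1}$ whenever $(v_i,v_{i+1})\in E_1$. $f$ is a strategy for player one if $v_1::\cdots::v_n::f(v_1::\cdots::v_n)$ is a play for every play $v_1::\cdots::v_n$ with $v_n\in\mathrm{Dom}(E_1)$, and a *winning strategy from $v$* if moreover every complete $f$-correct play starting from $v$ is in $W$. It is *recursive* if it is computable on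 the (coded) finite plays. For a closed implication- and negation-free formula $A$, the Tarski game $T_A$ has the subformula occurrences of $A$ (with numerals substituted for the quantified variables) as positions; in $E_1$ (Eloise) one moves from $\exists xB$ to some $B(n)$ and from $B\vee C$ to $B$ or to $C$, in $E_2$ (Abelard) from $\forall xB$ to some $B(n)$ and from $B\wedge C$ to $B$ or to $C$; $W$ is the set of finite complete plays that end in a true atom. The game $1\mathrm{Back}(G)$ has the finite plays of $G$ as positions; $E_2'$ consists of the pairs $(p::a,\ p::a::b)$ with $(a,b)\in E_2$, and $E_1'$ of the pairs $(p::a,\ p::a::b)$ with $(a,b)\in E_1$ and of the backtracking moves $(p::a::q,\ p::a)$ such that $a\in\mathrm{Dom}(E_1)$ or $q$ is empty, the last element of $p::a::q$ is not in $\mathrm{Dom}(E_2)$, and $p::a::q\notin W$; $W'$ consists of the finite complete plays whose last position is in $W$. **The strategy.** Let $u\Vdash A$, where $A$ is closed and implication- and negation-free. For a play $p$ of $T_A$ starting with $A$ define $\rho(p)$ by $\rho(A)=u$ and, if $\rho(q::B)=t$: $\rho(q::B::C(n))=\pi_1t$ if $B=\exists xC$, and $=tn$ if $B=\forall xC$;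 $\rho(q::B::B_i)=\pi_it$ if $B=B_0\wedge B_1$; $\rho(q::B::B_i)=p_it$ if $B=B_1\vee B_2$. For a play $P$ of $1\mathrm{Back}(T_A)$ starting with $A$ define the state $\Sigma(P)$ by $\Sigma(A)=\varnothing$; $\Sigma(Q,p,p')=\Sigma(Q,p)$ if $p'$ extends $p$ by one move; and, if $p'$ is an initial segment of $p$, with $s=\Sigma(Q,p)$ and $t=\rho(p)$: $\Sigma(Q,p,p')=s\Cup t[s]$ if $t:\mathtt{State}$, and $=s$ otherwise. For a play $(P,p)$ starting with $A$, with $t=\rho(p)$ and $s=\Sigma(P,p)$, define $\omega(P,p)$ as follows. If $p$ ends in $\exists xB$, then $\omega(P,p)=p::B(n)$ with $n=\pi_0t[s]$. If $p$ ends in $B\vee C$, then $\omega(P,p)=p::B$ if $p_0t[s]=\mathsf{True}$, and $=p::C$ otherwise. If $p=A_1::\cdots::A_n$ with $A_n$ atomic and false, then $\omega(P,p)=A_1::\cdots::A_i$, where $i$ is the smallest $j<n$ such that, with $w=\rho(A_1::\cdots::A_j)$ and $s'=s\Cup t[s]$, either $A_j=\exists xC$, $A_{j+1}=C(n)$ and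 $\pi_0w[s']\neq n$; or $A_j=B_1\vee B_2$, $A_{j+1}=B_1$ and $p_0w[s']=\mathsf{False}$; or $A_j=B_1\vee B_2$, $A_{j+1}=B_2$ and $p_0w[s']=\mathsf{True}$; and $i=n$ if there is no such $j$. In all other cases, and on plays not starting with $A$, $\omega(P,p)=p$. **Theorem (Soundness).** Let $A$ be a closed implication- and negation-free formula, and let $u$ be a term of $T_{\mathrm{Class}}$, or a term of $\mathrm{PCF}_{\mathrm{Class}}$, with $u\Vdash A$. Then $\omega$ is a recursive winning strategy from $A$ for player one (Eloise) in $1\mathrm{Back}(T_A)$. In particular, every $\omega$-correct play starting from $A$ is finite, and every complete one ends in a position $B_1::\cdots::B_k$ such that $B_k$ is a true atom. -/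

import Mathlib

namespace LBR

open Stream' (Seq)

/-! ### Types and raw terms -/

/-- Simple types over numbers, booleans and states of knowledge. -/
inductive Ty : Type
  | nat : Ty
  | bool : Ty
  | state : Ty
  | prod : Ty → Ty → Ty
  | arr : Ty → Ty → Ty

/-- The types of Gödel's system `T`: those in which the atomic type of states does not occur. -/
def Ty.Pure : Ty → Prop
  | .nat => True
  | .bool => True
  | .state => False
  | .prod U V => U.Pure ∧ V.Pure
  | .arr U V => U.Pure ∧ V.Pure

/-- `natArrow k T` is `Nat^k → T`, that is `Nat → ⋯ → Nat → T`. -/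
def Ty.natArrow : ℕ → Ty → Ty
  | 0, T => T
  | k + 1, T => .arr .nat (Ty.natArrow k T)

/-- Terms of Gödel's system `T` (Church style, de Bruijn indices) over a set `C` of additional
constants. `cond T` and `prec T` are the conditional and the primitive recursion constant. -/
inductive Tm (C : Type) : Type
  | var : ℕ → Tm C
  | zero : Tm C
  | succ : Tm C → Tm C
  | tt : Tm C
  | ff : Tm C
  | cond : Ty → Tm C
  | prec : Ty → Tm C
  | app : Tm C → Tm C → Tm C
  | pair : Tm C → Tm C → Tm C
  | fst : Tm C → Tm C
  | snd : Tm C → Tm C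
  | lam : Ty → Tm C → Tm C
  | const : C → Tm C

namespace Tm

variable {C : Type}

def num : ℕ → Tm C
  | 0 => zero
  | n + 1 => succ (num n)

/-- `appList t [t₁, …, tₙ] = t t₁ … tₙ`. -/
def appList (t : Tm C) : List (Tm C) → Tm C
  | [] => t
  | u :: us => appList (app t u) us

/-- `appNums t [n₁, …, nₖ]` is `t` applied to the numerals of `n₁, …, nₖ`. -/
def appNums (t : Tm C) (ns : List ℕ) : Tm C :=
  appList t (ns.map num)

/-- Renaming under one more binder. -/
def upr (f : ℕ → ℕ) : ℕ → ℕ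
  | 0 => 0
  | i + 1 => f i + 1

def rename (f : ℕ → ℕ) : Tm C → Tm C
  | var i => var (f i)
  | zero => zero
  | succ t => succ (rename f t)
  | tt => tt
  | ff => ff
  | cond T => cond T
  | prec T => prec T
  | app t u => app (rename f t) (rename f u)
  | pair t u => pair (rename f t) (rename f u)
  | fst t => fst (rename f t)
  | snd t => snd (rename f t)
  | lam T t => lam T (rename (upr f) t)
  | const c => const c

/-- A substitution under one more binder. -/
def up (σ : ℕ → Tm C) : ℕ → Tm C
  | 0 => var 0
  | i + 1 => rename Nat.succ (σ i)

/-- Simultaneous capture-avoiding substitution. -/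
def subst (σ : ℕ → Tm C) : Tm C → Tm C
  | var i => σ i
  | zero => zero
  | succ t => succ (subst σ t)
  | tt => tt
  | ff => ff
  | cond T => cond T
  | prec T => prec T
  | app t u => app (subst σ t) (subst σ u)
  | pair t u => pair (subst σ t) (subst σ u)
  | fst t => fst (subst σ t)
  | snd t => snd (subst σ t)
  | lam T t => lam T (subst (up σ) t)
  | const c => const c

/-- The substitution that replaces variable `0` by `u` and lowers the other variables. -/
def single (u : Tm C) : ℕ → Tm C
  | 0 => u
  | i + 1 => var i

/-- Every type annotation occurring in the term is a type of system `T`. -/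
def Pure : Tm C → Prop
  | var _ => True
  | zero => True
  | succ t => t.Pure
  | tt => True
  | ff => True
  | cond T => T.Pure
  | prec T => T.Pure
  | app t u => t.Pure ∧ u.Pure
  | pair t u => t.Pure ∧ u.Pure
  | fst t => t.Pure
  | snd t => t.Pure
  | lam T t => T.Pure ∧ t.Pure
  | const _ => True

/-- Every additional constant occurring in the term satisfies `p`. -/
def AllConst (p : C → Prop) : Tm C → Prop
  | var _ => True
  | zero => True
  | succ t => AllConst p t
  | tt => True
  | ff => True
  | cond _ => True
  | prec _ => True
  | app t u => AllConst p t ∧ AllConst p u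
  | pair t u => AllConst p t ∧ AllConst p u
  | fst t => AllConst p t
  | snd t => AllConst p t
  | lam _ t => AllConst p t
  | const c => p c

/-- Replace every additional constant `c` by the closed term `f c`. -/
def replaceConst {D : Type} (f : C → Tm D) : Tm C → Tm D
  | var i => var i
  | zero => zero
  | succ t => succ (replaceConst f t)
  | tt => tt
  | ff => ff
  | cond T => cond T
  | prec T => prec T
  | app t u => app (replaceConst f t) (replaceConst f u)
  | pair t u => pair (replaceConst f t) (replaceConst f u)
  | fst t => fst (replaceConst f t)
  | snd t => snd (replaceConst f t)
  | lam T t => lam T (replaceConst f t)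
  | const c => f c

end Tm

/-- Typing judgement; `ct` assigns types to the additional constants, and the list is the context
(variable `i` has the type at place `i`). -/
inductive HasType {C : Type} (ct : C → Ty) : List Ty → Tm C → Ty → Prop
  | var {Γ i T} : Γ[i]? = some T → HasType ct Γ (.var i) T
  | zero {Γ} : HasType ct Γ .zero .nat
  | succ {Γ t} : HasType ct Γ t .nat → HasType ct Γ (.succ t) .nat
  | tt {Γ} : HasType ct Γ .tt .bool
  | ff {Γ} : HasType ct Γ .ff .bool
  | cond {Γ} (T) : HasType ct Γ (.cond T) (.arr .bool (.arr T (.arr T T)))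
  | prec {Γ} (T) :
      HasType ct Γ (.prec T) (.arr T (.arr (.arr .nat (.arr T T)) (.arr .nat T)))
  | app {Γ t u U V} : HasType ct Γ t (.arr U V) → HasType ct Γ u U → HasType ct Γ (.app t u) V
  | pair {Γ t u U V} :
      HasType ct Γ t U → HasType ct Γ u V → HasType ct Γ (.pair t u) (.prod U V)
  | fst {Γ t U V} : HasType ct Γ t (.prod U V) → HasType ct Γ (.fst t) U
  | snd {Γ t U V} : HasType ct Γ t (.prod U V) → HasType ct Γ (.snd t) V
  | lam {Γ t V} (U) : HasType ct (U :: Γ) t V → HasType ct Γ (.lam U t) (.arr U V)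
  | const {Γ} (c) : HasType ct Γ (.const c) (ct c)

/-- One step reduction: the rules of system `T`, closed under all term constructors, together with
a set `δ` of reduction rules for the additional constants. -/
inductive Red {C : Type} (δ : Tm C → Tm C → Prop) : Tm C → Tm C → Prop
  | beta (T t u) : Red δ (.app (.lam T t) u) (t.subst (Tm.single u))
  | fst_pair (t u) : Red δ (.fst (.pair t u)) t
  | snd_pair (t u) : Red δ (.snd (.pair t u)) u
  | prec_zero (T u v) : Red δ (.app (.app (.app (.prec T) u) v) .zero) u
  | prec_succ (T u v t) :
      Red δ (.app (.app (.app (.prec T) u) v) (.succ t))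
        (.app (.app v t) (.app (.app (.app (.prec T) u) v) t))
  | cond_tt (T u v) : Red δ (.app (.app (.app (.cond T) .tt) u) v) u
  | cond_ff (T u v) : Red δ (.app (.app (.app (.cond T) .ff) u) v) v
  | rule {t t'} : δ t t' → Red δ t t'
  | succ {t t'} : Red δ t t' → Red δ (.succ t) (.succ t')
  | app_left {t t'} (u) : Red δ t t' → Red δ (.app t u) (.app t' u)
  | app_right (t) {u u'} : Red δ u u' → Red δ (.app t u) (.app t u')
  | pair_left {t t'} (u) : Red δ t t' → Red δ (.pair t u) (.pair t' u)
  | pair_right (t) {u u'} : Red δ u u' → Red δ (.pair t u) (.pair t u')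
  | fst {t t'} : Red δ t t' → Red δ (.fst t) (.fst t')
  | snd {t t'} : Red δ t t' → Red δ (.snd t) (.snd t')
  | lam (T) {t t'} : Red δ t t' → Red δ (.lam T t) (.lam T t')

/-- Provable equality: the least congruence containing the reduction rules. -/
def Conv {C : Type} (δ : Tm C → Tm C → Prop) : Tm C → Tm C → Prop :=
  Relation.EqvGen (Red δ)

/-- The term is in normal form. -/
def Normal {C : Type} (δ : Tm C → Tm C → Prop) (t : Tm C) : Prop :=
  ∀ t', ¬ Red δ t t'

/-! ### System `T` -/

/-- Raw terms of system `T`: no additional constants. -/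
abbrev TTm : Type := Tm Empty

/-- `t` is a term of system `T` of type `U` in the context `Γ`. -/
def TTm.Typed (Γ : List Ty) (t : TTm) (U : Ty) : Prop :=
  t.Pure ∧ HasType (fun c : Empty => c.elim) Γ t U

/-- One step reduction of system `T`. -/
def TRed : TTm → TTm → Prop := Red (fun _ _ => False)

/-- Provable equality in system `T`. -/
def TConv : TTm → TTm → Prop := Conv (fun _ _ => False)

/-! ### States of knowledge -/

/-- An `(arity + 1)`-ary predicate of system `T`: a closed normal term of type
`Nat^(arity + 1) → Bool`. -/
structure Predicate where
  arity : ℕ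
  term : TTm
  typed : TTm.Typed [] term (Ty.natArrow (arity + 1) .bool)
  normal : ∀ t', ¬ TRed term t'

/-- An atom `⟨P, n⃗, m⟩`, with `P n⃗ m = True` in system `T`. -/
structure Atom where
  pred : Predicate
  args : List ℕ
  wit : ℕ
  length_args : args.length = pred.arity
  holds : TConv (pred.term.appNums (args ++ [wit])) .tt

def Atom.Consistent (a b : Atom) : Prop :=
  a.pred = b.pred → a.args = b.args → a.wit = b.wit

/-- A state of knowledge: a finite set of pairwise consistent atoms. -/
structure State where
  carrier : Set Atom
  finite : carrier.Finite
  consistent : ∀ a ∈ carrier, ∀ b ∈ carrier, a.Consistent b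

namespace State

/-- The empty state. -/
def empty : State where
  carrier := ∅
  finite := Set.finite_empty
  consistent := by simp

instance : Nonempty State := ⟨empty⟩

/-- The state `{a}`. -/
def singleton (a : Atom) : State where
  carrier := {a}
  finite := Set.finite_singleton a
  consistent := by
    rintro b rfl c rfl
    exact fun _ _ => rfl

/-- Consistent union: the union of `s₁` and `s₂`, minus all atoms of `s₂` that are inconsistent
with some atom of `s₁`. -/
def cunion (s₁ s₂ : State) : State where
  carrier := s₁.carrier ∪ {b | b ∈ s₂.carrier ∧ ∀ a ∈ s₁.carrier, a.Consistent b}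
  finite := s₁.finite.union (s₂.finite.subset fun _ hb => hb.1)
  consistent := by
    rintro a (ha | ha) b (hb | hb)
    · exact s₁.consistent a ha b hb
    · exact hb.2 a ha
    · exact fun h h' => (ha.2 b hb h.symm h'.symm).symm
    · exact s₂.consistent a ha.1 b hb.1

/-- `s` contains an atom `⟨P, n⃗, l⟩` for some `l`. -/
def Knows (s : State) (P : Predicate) (ns : List ℕ) : Prop :=
  ∃ a ∈ s.carrier, a.pred = P ∧ a.args = ns

end State

/-! ### The calculi `T_Class`, `T_Learn`, `PCF_Class`, `PCF_Learn` -/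

/-- The two base calculi: Gödel's system `T`, and its extension with fixed point combinators. -/
inductive Calculus : Type
  | T : Calculus
  | PCF : Calculus

/-- Constants of `T_Class` and `PCF_Class`: state constants, consistent union, the oracles `X_P`,
the Skolem maps `Φ_P`, the maps `Add_P`, and for `PCF_Class` also the fixed point combinators
`Y_U`. -/
inductive ClassConst (K : Calculus) : Type
  | st : State → ClassConst K
  | cup : ClassConst K
  | oracle : Predicate → ClassConst K
  | skolem : Predicate → ClassConst K
  | adder : Predicate → ClassConst K
  | fix : K = Calculus.PCF → Ty → ClassConst K

/-- Constants of `T_Learn` and `PCF_Learn`: state constants, consistent union, the approximations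
`χ_P`, `φ_P`, `add_P`, and for `PCF_Learn` also the fixed point combinators `Y_U`. -/
inductive LearnConst (K : Calculus) : Type
  | st : State → LearnConst K
  | cup : LearnConst K
  | chi : Predicate → LearnConst K
  | phi : Predicate → LearnConst K
  | learn : Predicate → LearnConst K
  | fix : K = Calculus.PCF → Ty → LearnConst K

def ClassConst.type {K : Calculus} : ClassConst K → Ty
  | .st _ => .state
  | .cup => .arr .state (.arr .state .state)
  | .oracle P => Ty.natArrow P.arity .bool
  | .skolem P => Ty.natArrow P.arity .nat
  | .adder P => Ty.natArrow (P.arity + 1) .state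
  | .fix _ U => .arr (.arr U U) U

/-- Terms of `T_Class` (`K = .T`) and of `PCF_Class` (`K = .PCF`). -/
abbrev ClassTm (K : Calculus) : Type := Tm (ClassConst K)

/-- Terms of `T_Learn` (`K = .T`) and of `PCF_Learn` (`K = .PCF`). -/
abbrev LearnTm (K : Calculus) : Type := Tm (LearnConst K)

/-- The state constant denoting `s`. -/
def stc {K : Calculus} (s : State) : LearnTm K := .const (.st s)

/-- The reduction rules for the constants of `T_Learn` and `PCF_Learn`. -/
inductive LearnRule (K : Calculus) : LearnTm K → LearnTm K → Prop
  | chi_true (s : State) (P : Predicate) (ns : List ℕ) :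
      ns.length = P.arity → s.Knows P ns →
      LearnRule K (Tm.appNums (.app (.const (.chi P)) (stc s)) ns) .tt
  | chi_false (s : State) (P : Predicate) (ns : List ℕ) :
      ns.length = P.arity → ¬ s.Knows P ns →
      LearnRule K (Tm.appNums (.app (.const (.chi P)) (stc s)) ns) .ff
  | phi_wit (s : State) (a : Atom) : a ∈ s.carrier →
      LearnRule K (Tm.appNums (.app (.const (.phi a.pred)) (stc s)) a.args) (Tm.num a.wit)
  | phi_zero (s : State) (P : Predicate) (ns : List ℕ) :
      ns.length = P.arity → ¬ s.Knows P ns →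
      LearnRule K (Tm.appNums (.app (.const (.phi P)) (stc s)) ns) (Tm.num 0)
  | learn_old (s : State) (P : Predicate) (ns : List ℕ) (m : ℕ) :
      ns.length = P.arity → s.Knows P ns ∨ TConv (P.term.appNums (ns ++ [m])) .ff →
      LearnRule K (Tm.appNums (.app (.const (.learn P)) (stc s)) (ns ++ [m])) (stc State.empty)
  | learn_new (s : State) (a : Atom) : ¬ s.Knows a.pred a.args →
      LearnRule K (Tm.appNums (.app (.const (.learn a.pred)) (stc s)) (a.args ++ [a.wit]))
        (stc (State.singleton a))
  | cup (s₁ s₂ : State) :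
      LearnRule K (.app (.app (.const .cup) (stc s₁)) (stc s₂)) (stc (s₁.cunion s₂))
  | fix (h : K = Calculus.PCF) (U : Ty) (u : LearnTm K) :
      LearnRule K (.app (.const (.fix h U)) u) (.app u (.app (.const (.fix h U)) u))

/-- Provable equality in `T_Learn` and `PCF_Learn`. -/
def LConv {K : Calculus} : LearnTm K → LearnTm K → Prop := Conv (LearnRule K)

/-- The approximation `t[s]` of `t` at the state `s`. -/
def approx {K : Calculus} (s : State) (t : ClassTm K) : LearnTm K :=
  t.replaceConst fun
    | .st s' => stc s'
    | .cup => .const .cup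
    | .oracle P => .app (.const (.chi P)) (stc s)
    | .skolem P => .app (.const (.phi P)) (stc s)
    | .adder P => .app (.const (.learn P)) (stc s)
    | .fix h U => .const (.fix h U)

/-- `t` is a closed term of type `U`. -/
def ClosedOfType {K : Calculus} (t : ClassTm K) (U : Ty) : Prop :=
  HasType ClassConst.type [] t U

/-- `t` has state `∅`: no state constant other than `∅` occurs in it. -/
def HasEmptyState {K : Calculus} (t : ClassTm K) : Prop :=
  t.AllConst fun c => ∀ s, c = .st s → s = State.empty

/-- `t` converges: along every weakly increasing sequence of states, its approximations are
eventually equal to one and the same normal form. -/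
def Converges {K : Calculus} (t : ClassTm K) : Prop :=
  ∀ s : ℕ → State, (∀ i, (s i).carrier ⊆ (s (i + 1)).carrier) →
    ∃ v : LearnTm K, Normal (LearnRule K) v ∧ ∃ i, ∀ j, i ≤ j → LConv (approx (s j) t) v

/-- Stable closed terms of a given type. -/
def Stable {K : Calculus} : Ty → ClassTm K → Prop
  | .nat, t => ClosedOfType t .nat ∧ Converges t
  | .bool, t => ClosedOfType t .bool ∧ Converges t
  | .state, t => ClosedOfType t .state ∧ Converges t
  | .prod U V, t => ClosedOfType t (.prod U V) ∧ Stable U (.fst t) ∧ Stable V (.snd t)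
  | .arr U V, t => ClosedOfType t (.arr U V) ∧ ∀ u, Stable U u → Stable V (.app t u)

/-! ### The language of arithmetic -/

/-- Formulas (de Bruijn indices); `atom Q [t₁, …, tₙ]` is `Q t₁ … tₙ`. -/
inductive Formula : Type
  | atom : TTm → List TTm → Formula
  | and : Formula → Formula → Formula
  | or : Formula → Formula → Formula
  | imp : Formula → Formula → Formula
  | all : Formula → Formula
  | ex : Formula → Formula

namespace Formula

/-- `A` is a formula of the language whose free variables are among the first `k` ones: in every
atom `Q t₁ … tₙ`, `Q : Natⁿ → Bool` is a closed term of system `T`, and `t₁, …, tₙ` are terms of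
system `T` of type `Nat` all of whose free variables have type `Nat`. -/
def WF : ℕ → Formula → Prop
  | k, atom Q ts => TTm.Typed [] Q (Ty.natArrow ts.length .bool) ∧
      ∀ t ∈ ts, TTm.Typed (List.replicate k .nat) t .nat
  | k, and A B => A.WF k ∧ B.WF k
  | k, or A B => A.WF k ∧ B.WF k
  | k, imp A B => A.WF k ∧ B.WF k
  | k, all A => A.WF (k + 1)
  | k, ex A => A.WF (k + 1)

/-- `A` is a closed formula of the language. -/
def Closed (A : Formula) : Prop := A.WF 0

/-- `A` contains no implication (and hence no negation, which is implication of falsity). -/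
def ImpFree : Formula → Prop
  | atom _ _ => True
  | and A B => A.ImpFree ∧ B.ImpFree
  | or A B => A.ImpFree ∧ B.ImpFree
  | imp _ _ => False
  | all A => A.ImpFree
  | ex A => A.ImpFree

def subst (σ : ℕ → TTm) : Formula → Formula
  | atom Q ts => atom Q (ts.map (Tm.subst σ))
  | and A B => and (A.subst σ) (B.subst σ)
  | or A B => or (A.subst σ) (B.subst σ)
  | imp A B => imp (A.subst σ) (B.subst σ)
  | all A => all (A.subst (Tm.up σ))
  | ex A => ex (A.subst (Tm.up σ))

/-- For `A = A(x)` the body of a quantifier, `A.inst n` is `A(n)`. -/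
def inst (A : Formula) (n : ℕ) : Formula := A.subst (Tm.single (Tm.num n))

def size : Formula → ℕ
  | atom _ _ => 0
  | and A B => A.size + B.size + 1
  | or A B => A.size + B.size + 1
  | imp A B => A.size + B.size + 1
  | all A => A.size + 1
  | ex A => A.size + 1

theorem size_subst (A : Formula) (σ : ℕ → TTm) : (A.subst σ).size = A.size := by
  induction A generalizing σ <;> simp_all [subst, size]

theorem size_inst (A : Formula) (n : ℕ) : (A.inst n).size = A.size :=
  A.size_subst _

/-- The type `[A]` of the realizers of `A`. -/
def type : Formula → Ty
  | atom _ _ => .state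
  | and A B => .prod A.type B.type
  | or A B => .prod .bool (.prod A.type B.type)
  | imp A B => .arr A.type B.type
  | all A => .arr .nat A.type
  | ex A => .prod .nat A.type

end Formula

/-! ### Learning based realizability -/

/-- The terms that may realize `A`: closed terms of type `[A]` and of state `∅` which, in the case
of `PCF_Class`, are stable. -/
def Admissible {K : Calculus} (t : ClassTm K) (A : Formula) : Prop :=
  ClosedOfType t A.type ∧ HasEmptyState t ∧ (K = Calculus.PCF → Stable A.type t)

/-- `t` realizes `A` at the state `s`. The ternary projections `p₀ t`, `p₁ t`, `p₂ t` are written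
out as `π₀ t`, `π₀ (π₁ t)`, `π₁ (π₁ t)`. -/
def RealizesAt {K : Calculus} (s : State) : Formula → ClassTm K → Prop
  | .atom Q ts, t => LConv (approx s t) (stc State.empty) → TConv (Q.appList ts) .tt
  | .and A B, t => RealizesAt s A (.fst t) ∧ RealizesAt s B (.snd t)
  | .or A B, t =>
      (LConv (approx s (.fst t)) .tt ∧ RealizesAt s A (.fst (.snd t))) ∨
      (LConv (approx s (.fst t)) .ff ∧ RealizesAt s B (.snd (.snd t)))
  | .imp A B, t => ∀ u, Admissible u A → RealizesAt s A u → RealizesAt s B (.app t u)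
  | .all A, t => ∀ n, RealizesAt s (A.inst n) (.app t (Tm.num n))
  | .ex A, t => ∃ n, LConv (approx s (.fst t)) (Tm.num n) ∧ RealizesAt s (A.inst n) (.snd t)
termination_by A => A.size
decreasing_by all_goals simp only [Formula.size, Formula.size_inst]; omega

/-- `t` realizes `A`. -/
def Realizes {K : Calculus} (t : ClassTm K) (A : Formula) : Prop :=
  Admissible t A ∧ ∀ s, RealizesAt s A t

/-! ### Games -/

/-- The domain of a binary relation. -/
def Dom {α : Type} (E : Set (α × α)) : Set α := {a | ∃ b, (a, b) ∈ E}

/-- `p` is a possibly empty, possibly infinite walk in the graph `(V, E)`. -/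
def IsWalk {α : Type} (V : Set α) (E : Set (α × α)) (p : Seq α) : Prop :=
  (∀ i v, p.get? i = some v → v ∈ V) ∧
  ∀ i v w, p.get? i = some v → p.get? (i + 1) = some w → (v, w) ∈ E

/-- `p` is a walk that is infinite or ends outside the domain of `E`. -/
def IsCompleteWalk {α : Type} (V : Set α) (E : Set (α × α)) (p : Seq α) : Prop :=
  IsWalk V E p ∧ (¬ p.Terminates ∨ ∃ (l : List α) (v : α), p = ↑(l ++ [v]) ∧ v ∉ Dom E)

/-- A game `(V, E₁, E₂, W)` between two players, with positions among the elements of `α`. -/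
structure Game (α : Type) where
  V : Set α
  E₁ : Set (α × α)
  E₂ : Set (α × α)
  W : Set (Seq α)
  E₁_sub : E₁ ⊆ V ×ˢ V
  E₂_sub : E₂ ⊆ V ×ˢ V
  disjoint : Disjoint (Dom E₁) (Dom E₂)
  W_sub : ∀ p ∈ W, IsCompleteWalk V (E₁ ∪ E₂) p

namespace Game

variable {α : Type} (G : Game α)

def IsPlay (p : Seq α) : Prop := IsWalk G.V (G.E₁ ∪ G.E₂) p

def IsComplete (p : Seq α) : Prop := IsCompleteWalk G.V (G.E₁ ∪ G.E₂) p

/-- The set of finite plays. -/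
def finPlays : Set (List α) := {p | G.IsPlay ↑p}

/-- The sequence `p` starts from `v`. -/
def StartsFrom (v : α) (p : Seq α) : Prop := p.get? 0 = some v

/-- `f`-correctness of a play: player one always moves according to `f`. -/
def Correct (f : List α → α) (p : Seq α) : Prop :=
  ∀ i v w, p.get? i = some v → p.get? (i + 1) = some w → (v, w) ∈ G.E₁ → f (p.take (i + 1)) = w

/-- `f` is a strategy for player one (only its values on finite plays matter). -/
def IsStrategy (f : List α → α) : Prop :=
  (∀ p ∈ G.finPlays, f p ∈ G.V) ∧
  ∀ (p : List α) (v : α), p ++ [v] ∈ G.finPlays → v ∈ Dom G.E₁ →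
    (p ++ [v]) ++ [f (p ++ [v])] ∈ G.finPlays

/-- `f` is a winning strategy from `v` for player one. -/
def IsWinningStrategyFrom (v : α) (f : List α → α) : Prop :=
  G.IsStrategy f ∧
  ∀ p, G.IsComplete p → StartsFrom v p → G.Correct f p → p ∈ G.W

/-- `f` is recursive as a function on the finite plays. -/
def IsRecursive [Primcodable α] (f : List α → α) : Prop :=
  ∃ g : List α → α, Computable g ∧ ∀ p ∈ G.finPlays, g p = f p

end Game

/-! ### 1-Backtracking games -/

section OneBack

variable {α : Type} (G : Game α)

/-- The moves of `1Back(G)` which extend the current play of `G` by a move in `E`. -/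
def forwardMoves (E : Set (α × α)) : Set (List α × List α) :=
  {e | ∃ (p : List α) (a b : α), p ++ [a] ∈ G.finPlays ∧ (a, b) ∈ E ∧
    e = (p ++ [a], p ++ [a, b])}

/-- The backtracking moves `(p::a::q, p::a)` of player one. The play `p::a::q` must not be won by
player one, player two must not be on the move in it, and either player one was on the move at `a`,
or `q` is empty (the move then is a dummy move). -/
def backMoves : Set (List α × List α) :=
  {e | ∃ (p : List α) (a : α) (q : List α), p ++ a :: q ∈ G.finPlays ∧
    (a ∈ Dom G.E₁ ∨ q = []) ∧ (∀ d, (a :: q).getLast? = some d → d ∉ Dom G.E₂) ∧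
    (↑(p ++ a :: q) : Seq α) ∉ G.W ∧ e = (p ++ a :: q, p ++ [a])}

theorem Game.mem_finPlays {p : List α} : p ∈ G.finPlays ↔
    (∀ (i : ℕ) (v : α), p[i]? = some v → v ∈ G.V) ∧
      ∀ (i : ℕ) (v w : α), p[i]? = some v → p[i + 1]? = some w → (v, w) ∈ G.E₁ ∪ G.E₂ := by
  simp only [Game.finPlays, Game.IsPlay, IsWalk, Set.mem_ofPred_eq, Seq.ofList_get?]

theorem Game.mem_finPlays_of_append {p q : List α} (h : p ++ q ∈ G.finPlays) :
    p ∈ G.finPlays := by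
  rw [Game.mem_finPlays] at h ⊢
  have key : ∀ (i : ℕ) (v : α), p[i]? = some v → (p ++ q)[i]? = some v := by
    intro i v hv
    rw [List.getElem?_append_left (List.getElem?_eq_some_iff.1 hv).1, hv]
  exact ⟨fun i v hv => h.1 i v (key i v hv),
    fun i v w hv hw => h.2 i v w (key i v hv) (key (i + 1) w hw)⟩

theorem Game.mem_finPlays_concat {p : List α} {a b : α} (h : p ++ [a] ∈ G.finPlays)
    (hab : (a, b) ∈ G.E₁ ∪ G.E₂) : p ++ [a, b] ∈ G.finPlays := by
  have hb : b ∈ G.V := by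
    rcases hab with hab | hab
    · exact (G.E₁_sub hab).2
    · exact (G.E₂_sub hab).2
  have e : p ++ [a, b] = (p ++ [a]) ++ [b] := by simp
  rw [e]
  rw [Game.mem_finPlays] at h ⊢
  have key : ∀ (i : ℕ) (v : α), ((p ++ [a]) ++ [b])[i]? = some v →
      (p ++ [a])[i]? = some v ∨ (i = p.length + 1 ∧ v = b) := by
    intro i v hv
    rcases Nat.lt_or_ge i (p ++ [a]).length with hi | hi
    · rw [List.getElem?_append_left hi] at hv
      exact Or.inl hv
    · right
      have hlt := (List.getElem?_eq_some_iff.1 hv).1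
      simp only [List.length_append, List.length_cons, List.length_nil] at hlt hi
      have hi' : i = p.length + 1 := by omega
      subst hi'
      refine ⟨rfl, ?_⟩
      rw [List.getElem?_append_right (by simp)] at hv
      simpa using hv.symm
  refine ⟨fun i v hv => ?_, fun i v w hv hw => ?_⟩
  · rcases key i v hv with h' | ⟨-, rfl⟩
    · exact h.1 i v h'
    · exact hb
  · rcases key (i + 1) w hw with hw' | ⟨hi, rfl⟩
    · rcases key i v hv with hv' | ⟨hi, -⟩
      · exact h.2 i v w hv' hw'
      · have := (List.getElem?_eq_some_iff.1 hw').1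
        simp at this
        omega
    · have hi' : i = p.length := by omega
      subst hi'
      have : v = a := by
        rcases key p.length v hv with hv' | ⟨hi, -⟩
        · simpa using hv'.symm
        · omega
      rw [this]
      exact hab

theorem forwardMoves_sub {E : Set (α × α)} (hE : E ⊆ G.E₁ ∪ G.E₂) :
    forwardMoves G E ⊆ G.finPlays ×ˢ G.finPlays := by
  rintro _ ⟨p, a, b, hp, hab, rfl⟩
  exact ⟨hp, G.mem_finPlays_concat hp (hE hab)⟩

theorem backMoves_sub : backMoves G ⊆ G.finPlays ×ˢ G.finPlays := by
  rintro _ ⟨p, a, q, hp, -, -, -, rfl⟩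
  refine ⟨hp, G.mem_finPlays_of_append (q := q) ?_⟩
  simpa using hp

/-- The game `1Back(G)`, whose positions are the finite plays of `G`. -/
def oneBack : Game (List α) where
  V := G.finPlays
  E₁ := forwardMoves G G.E₁ ∪ backMoves G
  E₂ := forwardMoves G G.E₂
  W := {P | IsCompleteWalk G.finPlays
      ((forwardMoves G G.E₁ ∪ backMoves G) ∪ forwardMoves G G.E₂) P ∧
    ∃ (Q : List (List α)) (p : List α), P = ↑(Q ++ [p]) ∧ (↑p : Seq α) ∈ G.W}
  E₁_sub := Set.union_subset (forwardMoves_sub G Set.subset_union_left) (backMoves_sub G)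
  E₂_sub := forwardMoves_sub G Set.subset_union_right
  disjoint := by
    rw [Set.disjoint_left]
    rintro r ⟨r', hr | hr⟩ ⟨r'', p₂, a₂, b₂, -, h₂, e₂⟩
    · obtain ⟨p, a, b, -, h₁, e₁⟩ := hr
      have e : p ++ [a] = p₂ ++ [a₂] := (Prod.ext_iff.1 e₁).1.symm.trans (Prod.ext_iff.1 e₂).1
      obtain rfl : a = a₂ := by simpa using (List.append_inj' e rfl).2
      exact Set.disjoint_left.1 G.disjoint ⟨b, h₁⟩ ⟨b₂, h₂⟩
    · obtain ⟨p, a, q, -, -, hd, -, e₁⟩ := hr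
      have e : p ++ a :: q = p₂ ++ [a₂] :=
        (Prod.ext_iff.1 e₁).1.symm.trans (Prod.ext_iff.1 e₂).1
      refine hd a₂ ?_ ⟨b₂, h₂⟩
      have := congrArg List.getLast? e
      rw [List.getLast?_append_of_ne_nil _ (by simp)] at this
      simpa using this
  W_sub := fun _ hP => hP.1

end OneBack

/-! ### Tarski games

A subformula occurrence of `A` is represented by its address: the list of choices that lead to it
from the root, where the choice at a quantifier is the instance `n`, and the choice at a
conjunction or disjunction is `0` for the left and `1` for the right component. -/

/-- The formula that occurs in `A` at a given address. -/
def subAt : Formula → List ℕ → Option Formula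
  | A, [] => some A
  | .and A B, i :: l => if i = 0 then subAt A l else if i = 1 then subAt B l else none
  | .or A B, i :: l => if i = 0 then subAt A l else if i = 1 then subAt B l else none
  | .all A, n :: l => subAt (A.inst n) l
  | .ex A, n :: l => subAt (A.inst n) l
  | .imp _ _, _ :: _ => none
  | .atom _ _, _ :: _ => none
termination_by structural _ l => l

/-- The set of subformula occurrences of `A`. -/
def occurrences (A : Formula) : Set (List ℕ) := {a | ∃ B, subAt A a = some B}

/-- The game formula at `a` is existential or a disjunction. -/
def IsEloise (A : Formula) (a : List ℕ) : Prop :=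
  (∃ B, subAt A a = some (.ex B)) ∨ ∃ B C, subAt A a = some (.or B C)

/-- The game formula at `a` is universal or a conjunction. -/
def IsAbelard (A : Formula) (a : List ℕ) : Prop :=
  (∃ B, subAt A a = some (.all B)) ∨ ∃ B C, subAt A a = some (.and B C)

/-- The game formula at `a` is a true atom. -/
def IsTrueAtom (A : Formula) (a : List ℕ) : Prop :=
  ∃ Q ts, subAt A a = some (.atom Q ts) ∧ TConv (Q.appList ts) .tt

/-- Moves from an occurrence satisfying `own` to one of its immediate subformula occurrences. -/
def tarskiMoves (A : Formula) (own : List ℕ → Prop) : Set (List ℕ × List ℕ) :=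
  {e | ∃ a i, own a ∧ a ∈ occurrences A ∧ a ++ [i] ∈ occurrences A ∧ e = (a, a ++ [i])}

/-- The Tarski game `T_A` of an implication free closed formula `A`; player one is Eloise. -/
def tarski (A : Formula) : Game (List ℕ) where
  V := occurrences A
  E₁ := tarskiMoves A (IsEloise A)
  E₂ := tarskiMoves A (IsAbelard A)
  W := {p | IsCompleteWalk (occurrences A)
      (tarskiMoves A (IsEloise A) ∪ tarskiMoves A (IsAbelard A)) p ∧
    ∃ (l : List (List ℕ)) (a : List ℕ), p = ↑(l ++ [a]) ∧ IsTrueAtom A a}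
  E₁_sub := by
    rintro _ ⟨a, i, -, h, h', rfl⟩
    exact ⟨h, h'⟩
  E₂_sub := by
    rintro _ ⟨a, i, -, h, h', rfl⟩
    exact ⟨h, h'⟩
  disjoint := by
    rw [Set.disjoint_left]
    rintro a ⟨b, a₁, i, h₁, -, -, e₁⟩ ⟨c, a₂, j, h₂, -, -, e₂⟩
    obtain rfl : a = a₁ := (Prod.ext_iff.1 e₁).1
    obtain rfl : a = a₂ := (Prod.ext_iff.1 e₂).1
    rcases h₁ with ⟨B, h₁⟩ | ⟨B, C, h₁⟩ <;> rcases h₂ with ⟨B', h₂⟩ | ⟨B', C', h₂⟩ <;>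
      rw [h₁] at h₂ <;> simp at h₂
  W_sub := fun _ hp => hp.1

/-- The position `A` of `T_A`: the occurrence of `A` in itself. -/
def rootOcc : List ℕ := []

/-- The position `A` of `1Back(T_A)`: the play of `T_A` that consists of `A` only. -/
def rootPlay : List (List ℕ) := [rootOcc]

/-! ### The strategy of a realizer -/

section Strategy

variable {K : Calculus}

/-- The realizer associated to the occurrence in `A` at a given address, when `u` is associated
to `A` itself. -/
def occRealizer : Formula → ClassTm K → List ℕ → ClassTm K
  | _, t, [] => t
  | .ex B, t, n :: l => occRealizer (B.inst n) (.snd t) l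
  | .all B, t, n :: l => occRealizer (B.inst n) (.app t (Tm.num n)) l
  | .and B C, t, i :: l => if i = 0 then occRealizer B (.fst t) l else occRealizer C (.snd t) l
  | .or B C, t, i :: l =>
      if i = 0 then occRealizer B (.fst (.snd t)) l else occRealizer C (.snd (.snd t)) l
  | .imp _ _, t, _ :: _ => t
  | .atom _ _, t, _ :: _ => t
termination_by structural _ _ l => l

/-- The last position of a play of `T_A`. -/
def lastOcc (p : List (List ℕ)) : List ℕ := p.getLast?.getD rootOcc

/-- `ρ(p)`: the realizer associated to a play `p` of `T_A` starting with `A`. The addresses in `p`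
grow by one choice at each move, so that the last one determines `p`. -/
def rho (A : Formula) (u : ClassTm K) (p : List (List ℕ)) : ClassTm K :=
  occRealizer A u (lastOcc p)

/-- The numeral to which `t[s]` is equal. -/
noncomputable def numValue (s : State) (t : ClassTm K) : ℕ :=
  Classical.epsilon fun n => LConv (approx s t) (Tm.num n)

/-- The state constant to which `t[s]` is equal. -/
noncomputable def stateValue (s : State) (t : ClassTm K) : State :=
  Classical.epsilon fun s' => LConv (approx s t) (stc s')

/-- The state `s ⋓ t[s]`. -/
noncomputable def update (s : State) (t : ClassTm K) : State := s.cunion (stateValue s t)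

open Classical in
/-- The state associated to a play of `1Back(T_A)` that ends in `p, p'`, if `s` is the state
associated to the play up to `p`: it changes only if the last move is a backtracking move from a
position whose associated realizer has type `State`. -/
noncomputable def nextState (A : Formula) (u : ClassTm K) (s : State)
    (p p' : List (List ℕ)) : State :=
  if p' <+: p ∧ ClosedOfType (rho A u p) .state then update s (rho A u p) else s

/-- The state reached from `s` along the moves of a play of `1Back(T_A)`. -/
noncomputable def stateFrom (A : Formula) (u : ClassTm K) :
    State → List (List (List ℕ)) → State
  | s, p :: p' :: P => stateFrom A u (nextState A u s p p') (p' :: P)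
  | s, _ => s

/-- `Σ(P)`: the state associated to a play `P` of `1Back(T_A)` starting with `A`. -/
noncomputable def playState (A : Formula) (u : ClassTm K) (P : List (List (List ℕ))) : State :=
  stateFrom A u State.empty P

/-- In the play `p = A₁ :: ⋯ :: Aₙ` of `T_A`, `1 ≤ j < n`, player one is on the move at `Aⱼ`, and
the move `Aⱼ₊₁` is not the one indicated by `ρ(A₁ :: ⋯ :: Aⱼ)` at the state `s`. -/
def Revised (A : Formula) (u : ClassTm K) (s : State) (p : List (List ℕ)) (j : ℕ) : Prop :=
  1 ≤ j ∧ ∃ (a : List ℕ) (i : ℕ), p[j - 1]? = some a ∧ p[j]? = some (a ++ [i]) ∧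
    (((∃ B, subAt A a = some (.ex B)) ∧
        ¬ LConv (approx s (.fst (rho A u (p.take j)))) (Tm.num i)) ∨
      ((∃ B C, subAt A a = some (.or B C)) ∧
        ((i = 0 ∧ LConv (approx s (.fst (rho A u (p.take j)))) .ff) ∨
          (i = 1 ∧ LConv (approx s (.fst (rho A u (p.take j)))) .tt))))

open Classical in
/-- The position to which player one backtracks from `p` when the new state is `s`: the initial
segment of `p` that ends in the first move to be revised, or `p` if there is no such move. -/
noncomputable def backtrack (A : Formula) (u : ClassTm K) (s : State)
    (p : List (List ℕ)) : List (List ℕ) :=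
  if h : ∃ j, Revised A u s p j then p.take (Nat.find h) else p

open Classical in
/-- The move of player one at the position `p`, when the associated state is `s`. -/
noncomputable def move (A : Formula) (u : ClassTm K) (s : State)
    (p : List (List ℕ)) : List (List ℕ) :=
  match subAt A (lastOcc p) with
  | some (.ex _) => p ++ [lastOcc p ++ [numValue s (.fst (rho A u p))]]
  | some (.or _ _) =>
      p ++ [lastOcc p ++ [if LConv (approx s (.fst (rho A u p))) .tt then 0 else 1]]
  | some (.atom Q ts) =>
      if TConv (Q.appList ts) .ff then backtrack A u (update s (rho A u p)) p else p
  | _ => p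

/-- The strategy `ω` for player one in `1Back(T_A)` that is built from `u`. On plays that do not
start from `A` it makes dummy moves only. -/
noncomputable def omega (A : Formula) (u : ClassTm K) (P : List (List (List ℕ))) :
    List (List ℕ) :=
  if P.head? = some rootPlay then move A u (playState A u P) (P.getLast?.getD [])
  else P.getLast?.getD []

end Strategy

end LBR

open LBR

/-! Along an `omega`-correct play the associated states only grow, since they change by consistent
union alone. Suppose such a play were infinite. A realizer of atomic type, evaluated along the
increasing states, eventually keeps one value: for `PCF_Class` this is part of admissibility, and
for `T_Class` it is proved by a logical relation on families of terms (`ClosedOfType.rel`,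
`ClosedOfType.stable`).

By induction on k, the positions eventually share an initial segment of length k + 1
(`exists_eventually_prefix`); since plays of `T_A` have length at most `A.size + 1`, this is absurd.
In the induction step, once the realizer at the end q of the common segment has settled, a move
chosen at q is never revised. If q ends in a false atom with realizer t, then at the new state s' =
s ⋓ t[s] no move of q is revised, for otherwise the play would drop below q. Hence the realizers
along q are correct at s' (`RootPlay.realizesAt`), so t[s'] is not empty. But t[s'] = t[s] was just
put into s', whereas a term of state ∅ produces only atoms about which the current state knows
nothing (`HasEmptyState.fresh`). So t[s'] = ∅, a contradiction. A finite complete play must be won,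
because at a lost final position player one still has the dummy move.

Both freshness and the evaluation of stable terms need actual reductions in place of equations.
Confluence (`Reds.confluent`, by parallel reduction and complete developments) turns convergence
into reduction to a normal form; subject reduction and `HasType.canonical` identify that normal form
as a numeral, a boolean or a state.

Recursiveness is shown semantically. Raw terms denote sets of natural numbers in a graph model which
is invariant under conversion (`sem_conv`, `sem_learnRule`) and separates values. The denotation of
t[s] is recursively enumerable uniformly in a list of codes of the atoms of s
(`REFamily.sem_classSet`). The values used by `omega` can be read off from tokens, so the graph of
`omega` is recursively enumerable (`omegaCode_iff`), and a total function with such a graph is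
computable (`Sigma1.computable`). -/

namespace LBR

open Stream' (Seq)

/-! ### Substitution -/

namespace Tm

variable {C D : Type}

theorem upr_comp (f g : ℕ → ℕ) : upr f ∘ upr g = upr (f ∘ g) := by
  funext i; cases i <;> rfl

theorem rename_rename (t : Tm C) (f g : ℕ → ℕ) :
    rename f (rename g t) = rename (f ∘ g) t := by
  induction t generalizing f g <;> simp_all [rename, upr_comp]

theorem up_comp_upr (σ : ℕ → Tm C) (f : ℕ → ℕ) : up σ ∘ upr f = up (σ ∘ f) := by
  funext i; cases i <;> rfl

theorem subst_rename (t : Tm C) (σ : ℕ → Tm C) (f : ℕ → ℕ) :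
    subst σ (rename f t) = subst (σ ∘ f) t := by
  induction t generalizing f σ <;> simp_all [rename, subst, up_comp_upr]

theorem rename_comp_up (σ : ℕ → Tm C) (f : ℕ → ℕ) :
    rename (upr f) ∘ up σ = up (rename f ∘ σ) := by
  funext i
  cases i with
  | zero => rfl
  | succ i => simp only [Function.comp, up, rename_rename]; rfl

theorem rename_subst (t : Tm C) (σ : ℕ → Tm C) (f : ℕ → ℕ) :
    rename f (subst σ t) = subst (rename f ∘ σ) t := by
  induction t generalizing f σ <;> simp_all [rename, subst, rename_comp_up]

theorem subst_comp_up (σ τ : ℕ → Tm C) : subst (up τ) ∘ up σ = up (subst τ ∘ σ) := by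
  funext i
  cases i with
  | zero => rfl
  | succ i => simp only [Function.comp, up, subst_rename, rename_subst]; rfl

theorem subst_subst (t : Tm C) (σ τ : ℕ → Tm C) :
    subst τ (subst σ t) = subst (subst τ ∘ σ) t := by
  induction t generalizing σ τ <;> simp_all [subst, subst_comp_up]

theorem up_var : up (var : ℕ → Tm C) = var := by
  funext i; cases i <;> rfl

theorem subst_var (t : Tm C) : subst var t = t := by
  induction t <;> simp_all [subst, up_var]

/-- The substitution that replaces variable `0` by `u` and variable `i + 1` by `σ i`. -/
def scons (u : Tm C) (σ : ℕ → Tm C) : ℕ → Tm C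
  | 0 => u
  | i + 1 => σ i

theorem subst_single_comp_up (u : Tm C) (σ : ℕ → Tm C) :
    subst (single u) ∘ up σ = scons u σ := by
  funext i
  cases i with
  | zero => rfl
  | succ i =>
    simp only [Function.comp, up, scons, subst_rename]
    exact subst_var _

/-- Under a closing substitution a β-redex contracts to its body under an extended substitution; the
abstraction case of `HasType.rel` needs this form. -/
theorem subst_up_single (t u : Tm C) (σ : ℕ → Tm C) :
    (t.subst (up σ)).subst (single u) = t.subst (scons u σ) := by
  rw [subst_subst, subst_single_comp_up]

theorem subst_single_subst (t u : Tm C) (σ : ℕ → Tm C) :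
    (t.subst (single u)).subst σ = (t.subst (up σ)).subst (single (u.subst σ)) := by
  rw [subst_up_single, subst_subst]
  congr 1
  funext i
  cases i <;> rfl

@[simp] theorem rename_num (f : ℕ → ℕ) (n : ℕ) : rename f (num n : Tm C) = num n := by
  induction n <;> simp_all [num, rename]

@[simp] theorem subst_num (σ : ℕ → Tm C) (n : ℕ) : subst σ (num n : Tm C) = num n := by
  induction n <;> simp_all [num, subst]

@[simp] theorem replaceConst_num (f : C → Tm D) (n : ℕ) :
    replaceConst f (num n : Tm C) = num n := by
  induction n <;> simp_all [num, replaceConst]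

theorem replaceConst_const (t : Tm C) : replaceConst const t = t := by
  induction t <;> simp_all [replaceConst]

theorem appList_append (t : Tm C) (us vs : List (Tm C)) :
    appList t (us ++ vs) = appList (appList t us) vs := by
  induction us generalizing t with
  | nil => rfl
  | cons u us ih => exact ih _

theorem appList_concat (t : Tm C) (us : List (Tm C)) (u : Tm C) :
    appList t (us ++ [u]) = app (appList t us) u := by
  rw [appList_append]; rfl

theorem appNums_cons (t : Tm C) (n : ℕ) (ns : List ℕ) :
    appNums t (n :: ns) = appNums (app t (num n)) ns := rfl

theorem appNums_concat (t : Tm C) (ns : List ℕ) (n : ℕ) :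
    appNums t (ns ++ [n]) = app (appNums t ns) (num n) := by
  simp [appNums, appList_concat]

theorem subst_appList (σ : ℕ → Tm C) (t : Tm C) (us : List (Tm C)) :
    subst σ (appList t us) = appList (subst σ t) (us.map (subst σ)) := by
  induction us generalizing t with
  | nil => rfl
  | cons u us ih => simp [appList, ih, subst]

end Tm

/-! ### Conversion -/

section Conv

variable {C : Type} {δ : Tm C → Tm C → Prop}

theorem Conv.refl (t : Tm C) : Conv δ t t := Relation.EqvGen.refl t

theorem Conv.symm {t u : Tm C} (h : Conv δ t u) : Conv δ u t := Relation.EqvGen.symm _ _ h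

theorem Conv.trans {t u v : Tm C} (h : Conv δ t u) (h' : Conv δ u v) : Conv δ t v :=
  Relation.EqvGen.trans _ _ _ h h'

theorem Conv.of_red {t u : Tm C} (h : Red δ t u) : Conv δ t u := Relation.EqvGen.rel _ _ h

theorem Conv.map {f : Tm C → Tm C} (hf : ∀ t u, Red δ t u → Red δ (f t) (f u)) {t u : Tm C}
    (h : Conv δ t u) : Conv δ (f t) (f u) := by
  induction h with
  | rel _ _ h => exact .of_red (hf _ _ h)
  | refl => exact .refl _
  | symm _ _ _ ih => exact ih.symm
  | trans _ _ _ _ _ ih ih' => exact ih.trans ih'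

theorem Conv.app {t t' u u' : Tm C} (h : Conv δ t t') (h' : Conv δ u u') :
    Conv δ (.app t u) (.app t' u') :=
  (h.map fun _ _ => Red.app_left u).trans (h'.map fun _ _ => Red.app_right t')

theorem Conv.succ {t t' : Tm C} (h : Conv δ t t') : Conv δ (.succ t) (.succ t') :=
  h.map fun _ _ => Red.succ

theorem Conv.fst {t t' : Tm C} (h : Conv δ t t') : Conv δ (.fst t) (.fst t') :=
  h.map fun _ _ => Red.fst

theorem Conv.snd {t t' : Tm C} (h : Conv δ t t') : Conv δ (.snd t) (.snd t') :=
  h.map fun _ _ => Red.snd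

end Conv

/-! ### Typing -/

section Typing

variable {C D : Type} {ct : C → Ty} {dt : D → Ty}

theorem HasType.renaming {Γ : List Ty} {t : Tm C} {T : Ty} (h : HasType ct Γ t T) :
    ∀ {Δ : List Ty} {f : ℕ → ℕ}, (∀ i U, Γ[i]? = some U → Δ[f i]? = some U) →
      HasType ct Δ (t.rename f) T := by
  induction h with
  | var h => exact fun hf => .var (hf _ _ h)
  | zero => exact fun _ => .zero
  | succ _ ih => exact fun hf => .succ (ih hf)
  | tt => exact fun _ => .tt
  | ff => exact fun _ => .ff
  | cond T => exact fun _ => .cond T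
  | prec T => exact fun _ => .prec T
  | app _ _ ih ih' => exact fun hf => .app (ih hf) (ih' hf)
  | pair _ _ ih ih' => exact fun hf => .pair (ih hf) (ih' hf)
  | fst _ ih => exact fun hf => .fst (ih hf)
  | snd _ ih => exact fun hf => .snd (ih hf)
  | lam U _ ih =>
    intro Δ f hf
    refine .lam U (ih ?_)
    rintro (_ | i) V hV
    · simpa [Tm.upr] using hV
    · exact hf i V hV
  | const c => exact fun _ => .const c

theorem HasType.subst {Γ : List Ty} {t : Tm C} {T : Ty} (h : HasType ct Γ t T) :
    ∀ {Δ : List Ty} {σ : ℕ → Tm C}, (∀ i U, Γ[i]? = some U → HasType ct Δ (σ i) U) →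
      HasType ct Δ (t.subst σ) T := by
  induction h with
  | var h => exact fun hf => hf _ _ h
  | zero => exact fun _ => .zero
  | succ _ ih => exact fun hf => .succ (ih hf)
  | tt => exact fun _ => .tt
  | ff => exact fun _ => .ff
  | cond T => exact fun _ => .cond T
  | prec T => exact fun _ => .prec T
  | app _ _ ih ih' => exact fun hf => .app (ih hf) (ih' hf)
  | pair _ _ ih ih' => exact fun hf => .pair (ih hf) (ih' hf)
  | fst _ ih => exact fun hf => .fst (ih hf)
  | snd _ ih => exact fun hf => .snd (ih hf)
  | lam U _ ih =>
    intro Δ σ hf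
    refine .lam U (ih ?_)
    rintro (_ | i) V hV
    · exact .var (by simpa using hV)
    · exact (hf i V hV).renaming fun j W hW => hW
  | const c => exact fun _ => .const c

theorem HasType.subst_single {Γ : List Ty} {t u : Tm C} {T U : Ty}
    (h : HasType ct (U :: Γ) t T) (hu : HasType ct Γ u U) :
    HasType ct Γ (t.subst (Tm.single u)) T := by
  refine h.subst ?_
  rintro (_ | i) V hV
  · obtain rfl : U = V := by simpa using hV
    exact hu
  · exact .var hV

theorem HasType.num (Γ : List Ty) (n : ℕ) : HasType ct Γ (Tm.num n) .nat := by
  induction n with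
  | zero => exact .zero
  | succ n ih => exact .succ ih

theorem HasType.replaceConst {f : C → Tm D} {Γ : List Ty} {t : Tm C} {T : Ty}
    (h : HasType ct Γ t T) (hf : ∀ c Γ, HasType dt Γ (f c) (ct c)) :
    HasType dt Γ (t.replaceConst f) T := by
  induction h with
  | var h => exact .var h
  | zero => exact .zero
  | succ _ ih => exact .succ ih
  | tt => exact .tt
  | ff => exact .ff
  | cond T => exact .cond T
  | prec T => exact .prec T
  | app _ _ ih ih' => exact .app ih ih'
  | pair _ _ ih ih' => exact .pair ih ih'
  | fst _ ih => exact .fst ih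
  | snd _ ih => exact .snd ih
  | lam U _ ih => exact .lam U ih
  | const c => exact hf c _

/-- A term has at most one type in a given context. -/
theorem HasType.unique {Γ : List Ty} {t : Tm C} {T : Ty} (h : HasType ct Γ t T) :
    ∀ {T' : Ty}, HasType ct Γ t T' → T = T' := by
  induction h with
  | var h => rintro _ ⟨h'⟩; simpa [h] using h'
  | zero => rintro _ ⟨⟩; rfl
  | succ _ ih => rintro _ ⟨⟩; rfl
  | tt => rintro _ ⟨⟩; rfl
  | ff => rintro _ ⟨⟩; rfl
  | cond T => rintro _ ⟨⟩; rfl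
  | prec T => rintro _ ⟨⟩; rfl
  | app _ _ ih ih' =>
    intro T' h
    cases h with
    | app h h' => cases ih h; rfl
  | pair _ _ ih ih' =>
    intro T' h
    cases h with
    | pair h h' => rw [ih h, ih' h']
  | fst _ ih =>
    intro T' h
    cases h with
    | fst h => cases ih h; rfl
  | snd _ ih =>
    intro T' h
    cases h with
    | snd h => cases ih h; rfl
  | lam U _ ih =>
    intro T' h
    cases h with
    | lam _ h => rw [ih h]
  | const c => rintro _ ⟨⟩; rfl

theorem HasType.appNums {Γ : List Ty} {T : Ty} : ∀ {ns : List ℕ} {t : Tm C},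
    HasType ct Γ t (Ty.natArrow ns.length T) → HasType ct Γ (t.appNums ns) T
  | [], _, h => h
  | n :: ns, t, h => HasType.appNums (ns := ns) (t := t.app (Tm.num n)) (.app h (.num Γ n))

theorem HasType.appList {Γ : List Ty} {T : Ty} : ∀ {us : List (Tm C)} {t : Tm C},
    HasType ct Γ t (Ty.natArrow us.length T) → (∀ u ∈ us, HasType ct Γ u .nat) →
      HasType ct Γ (t.appList us) T
  | [], _, h, _ => h
  | u :: us, t, h, h' =>
    HasType.appList (us := us) (t := t.app u) (.app h (h' u (by simp)))
      fun v hv => h' v (by simp [hv])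

end Typing

/-! ### Eventually evaluating families of terms -/

section Rel

open Filter

variable {C D S ι : Type} {δ : Tm D → Tm D → Prop} {sv : S → Tm D} {l : Filter ι}

/-- Logical relation on families of terms: at the atomic types, the terms of the family are
eventually equal to one and the same value. -/
def Rel (δ : Tm D → Tm D → Prop) (sv : S → Tm D) (l : Filter ι) : Ty → (ι → Tm D) → Prop
  | .nat, f => ∃ n, ∀ᶠ i in l, Conv δ (f i) (Tm.num n)
  | .bool, f => (∀ᶠ i in l, Conv δ (f i) .tt) ∨ ∀ᶠ i in l, Conv δ (f i) .ff
  | .state, f => ∃ s, ∀ᶠ i in l, Conv δ (f i) (sv s)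
  | .prod U V, f => Rel δ sv l U (fun i => .fst (f i)) ∧ Rel δ sv l V (fun i => .snd (f i))
  | .arr U V, f => ∀ g, Rel δ sv l U g → Rel δ sv l V (fun i => .app (f i) (g i))

/-- Only eventual conversion is tested at atomic types, and projections and application respect
conversion, so no reduction strategy enters. -/
theorem Rel.of_conv {T : Ty} {f g : ι → Tm D} (hf : Rel δ sv l T f)
    (h : ∀ᶠ i in l, Conv δ (g i) (f i)) : Rel δ sv l T g := by
  induction T generalizing f g with
  | nat =>
    obtain ⟨n, hn⟩ := hf
    exact ⟨n, by filter_upwards [h, hn] with i h h' using h.trans h'⟩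
  | bool =>
    refine hf.imp (fun hf => ?_) fun hf => ?_ <;>
    filter_upwards [h, hf] with i h h' using h.trans h'
  | state =>
    obtain ⟨n, hn⟩ := hf
    exact ⟨n, by filter_upwards [h, hn] with i h h' using h.trans h'⟩
  | prod U V ihU ihV =>
    exact ⟨ihU hf.1 (h.mono fun i h => h.fst), ihV hf.2 (h.mono fun i h => h.snd)⟩
  | arr U V _ ihV => exact fun g hg => ihV (hf g hg) (h.mono fun i h => h.app (.refl _))

theorem Rel.num (n : ℕ) : Rel δ sv l .nat fun _ => Tm.num n :=
  ⟨n, .of_forall fun _ => .refl _⟩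

theorem Rel.cond (T : Ty) :
    Rel δ sv l (.arr .bool (.arr T (.arr T T))) fun _ => .cond T := by
  intro b hb u hu v hv
  rcases hb with hb | hb
  · exact hu.of_conv (hb.mono fun i h =>
      (((Conv.refl _).app h).app (.refl _)).app (.refl _) |>.trans (.of_red (.cond_tt _ _ _)))
  · exact hv.of_conv (hb.mono fun i h =>
      (((Conv.refl _).app h).app (.refl _)).app (.refl _) |>.trans (.of_red (.cond_ff _ _ _)))

theorem Rel.prec (T : Ty) :
    Rel δ sv l (.arr T (.arr (.arr .nat (.arr T T)) (.arr .nat T))) fun _ => .prec T := by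
  rintro u hu v hv w ⟨n, hw⟩
  -- The number argument is eventually one fixed numeral, which makes induction on its value
  -- possible.
  suffices h : Rel δ sv l T fun i => .app (.app (.app (.prec T) (u i)) (v i)) (Tm.num n) from
    h.of_conv (hw.mono fun i h => (Conv.refl _).app h)
  clear hw
  induction n with
  | zero => exact hu.of_conv (.of_forall fun i => .of_red (.prec_zero _ _ _))
  | succ n ih =>
    exact (hv _ (.num n) _ ih).of_conv (.of_forall fun i => .of_red (.prec_succ _ _ _ _))

/-- The fundamental lemma of the logical relation. -/
theorem HasType.rel {ct : C → Ty} {k : ι → C → Tm D}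
    (hk : ∀ c, Rel δ sv l (ct c) fun i => k i c)
    (hc : ∀ i c σ, (k i c).subst σ = k i c) {Γ : List Ty} {t : Tm C} {T : Ty}
    (h : HasType ct Γ t T) : ∀ {σ : ι → ℕ → Tm D},
      (∀ j U, Γ[j]? = some U → Rel δ sv l U fun i => σ i j) →
        Rel δ sv l T fun i => (t.replaceConst (k i)).subst (σ i) := by
  induction h with
  | var h => exact fun hσ => hσ _ _ h
  | zero => exact fun _ => .num 0
  | succ _ ih =>
    intro σ hσ
    obtain ⟨n, hn⟩ := ih hσ
    exact ⟨n + 1, hn.mono fun i h => h.succ⟩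
  | tt => exact fun _ => .inl (.of_forall fun _ => .refl _)
  | ff => exact fun _ => .inr (.of_forall fun _ => .refl _)
  | cond T => exact fun _ => .cond T
  | prec T => exact fun _ => .prec T
  | app _ _ ih ih' => exact fun hσ => ih hσ _ (ih' hσ)
  | pair _ _ ih ih' =>
    exact fun hσ => ⟨(ih hσ).of_conv (.of_forall fun i => .of_red (.fst_pair _ _)),
      (ih' hσ).of_conv (.of_forall fun i => .of_red (.snd_pair _ _))⟩
  | fst _ ih => exact fun hσ => (ih hσ).1
  | snd _ ih => exact fun hσ => (ih hσ).2
  | lam U _ ih =>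
    intro σ hσ g hg
    refine Rel.of_conv (ih (σ := fun i => Tm.scons (g i) (σ i)) ?_) (.of_forall fun i => ?_)
    · rintro (_ | j) V hV
      · obtain rfl : U = V := by simpa using hV
        exact hg
      · exact hσ j V hV
    · rw [← Tm.subst_up_single]
      exact .of_red (.beta _ _ _)
  | const c =>
    intro σ hσ
    simpa only [Tm.replaceConst, hc] using hk c

/-- To be related at a type `Nat^k → T` is to be related for all numerals as arguments. -/
theorem Rel.of_appNums {T : Ty} {k : ℕ} {f : ι → Tm D}
    (h : ∀ ns : List ℕ, ns.length = k → Rel δ sv l T fun i => (f i).appNums ns) :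
    Rel δ sv l (Ty.natArrow k T) f := by
  induction k generalizing f with
  | zero => exact h [] rfl
  | succ k ih =>
    rintro g ⟨n, hn⟩
    refine Rel.of_conv (f := fun i => .app (f i) (Tm.num n)) (ih fun ns hns => ?_)
      (hn.mono fun i h => (Conv.refl _).app h)
    exact h (n :: ns) (by simp [hns])

end Rel

/-! ### Evaluation in system `T` -/

/-- The logical relation for a one-element index set: with the filter `⊤` on `Unit`, "eventually"
means "always". -/
theorem TTm.Typed.conv_bool {t : TTm} (h : TTm.Typed [] t .bool) : TConv t .tt ∨ TConv t .ff := by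
  have := HasType.rel (δ := fun _ _ : TTm => False) (sv := fun e : Empty => e.elim)
    (l := (⊤ : Filter Unit)) (k := fun _ => Tm.const) (fun c => c.elim) (fun _ c => c.elim)
    h.2 (σ := fun _ => Tm.var) (by simp)
  simpa [Rel, Tm.replaceConst_const, Tm.subst_var, TConv] using this

theorem TTm.pure_rename {t : TTm} (f : ℕ → ℕ) (h : t.Pure) : Tm.Pure (t.rename f) := by
  induction t generalizing f <;> simp_all [Tm.Pure, Tm.rename]

theorem TTm.pure_subst {t : TTm} {σ : ℕ → TTm} (h : t.Pure) (hσ : ∀ i, (σ i).Pure) :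
    Tm.Pure (t.subst σ) := by
  induction t generalizing σ with
  | lam U t ih =>
    refine ⟨h.1, ih h.2 ?_⟩
    rintro (_ | i)
    · trivial
    · exact TTm.pure_rename _ (hσ i)
  | var i => exact hσ i
  | _ => simp_all [Tm.Pure, Tm.subst]

theorem TTm.pure_num (n : ℕ) : Tm.Pure (Tm.num n : TTm) := by
  induction n <;> simp_all [Tm.Pure, Tm.num]

theorem TTm.pure_appList {t : TTm} {us : List TTm} (h : t.Pure) (hu : ∀ u ∈ us, u.Pure) :
    Tm.Pure (t.appList us) := by
  induction us generalizing t with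
  | nil => exact h
  | cons u us ih => exact ih ⟨h, hu u (by simp)⟩ fun v hv => hu v (by simp [hv])

theorem Predicate.conv_bool (P : Predicate) {ns : List ℕ} (h : ns.length = P.arity + 1) :
    TConv (P.term.appNums ns) .tt ∨ TConv (P.term.appNums ns) .ff := by
  refine TTm.Typed.conv_bool ⟨TTm.pure_appList P.typed.1 ?_, HasType.appNums ?_⟩
  · simp only [List.mem_map]
    rintro _ ⟨n, -, rfl⟩
    exact TTm.pure_num n
  · rw [h]
    exact P.typed.2

namespace Formula

/-- Substitution of terms of system `T` preserves well-formedness. -/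
theorem WF.subst {A : Formula} {k j : ℕ} {σ : ℕ → TTm} (h : A.WF k) (hp : ∀ i, (σ i).Pure)
    (hσ : ∀ i < k, HasType (fun c : Empty => c.elim) (List.replicate j .nat) (σ i) .nat) :
    (A.subst σ).WF j := by
  -- Both hypotheses on the substitution survive the passage under a quantifier.
  have hup : ∀ {k j : ℕ} {σ : ℕ → TTm}, (∀ i, (σ i).Pure) →
      (∀ i < k, HasType (fun c : Empty => c.elim) (List.replicate j .nat) (σ i) .nat) →
      (∀ i, (Tm.up σ i).Pure) ∧ ∀ i < k + 1,
        HasType (fun c : Empty => c.elim) (List.replicate (j + 1) .nat) (Tm.up σ i) .nat := by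
    intro k j σ hp hσ
    refine ⟨?_, ?_⟩
    · rintro (_ | i)
      · trivial
      · exact TTm.pure_rename _ (hp i)
    · rintro (_ | i) hi
      · exact .var (by simp)
      · refine (hσ i (by omega)).renaming fun i U hU => ?_
        simpa [List.replicate_succ] using hU
  induction A generalizing k j σ with
  | atom Q ts =>
    refine ⟨by simpa using h.1, ?_⟩
    simp only [List.mem_map]
    rintro _ ⟨t, ht, rfl⟩
    refine ⟨TTm.pure_subst (h.2 t ht).1 hp, (h.2 t ht).2.subst fun i U hU => ?_⟩
    rw [List.getElem?_replicate] at hU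
    split at hU
    · cases hU
      exact hσ i ‹_›
    · cases hU
  | and A B ihA ihB => exact ⟨ihA h.1 hp hσ, ihB h.2 hp hσ⟩
  | or A B ihA ihB => exact ⟨ihA h.1 hp hσ, ihB h.2 hp hσ⟩
  | imp A B ihA ihB => exact ⟨ihA h.1 hp hσ, ihB h.2 hp hσ⟩
  | all A ih => exact ih h (hup hp hσ).1 (hup hp hσ).2
  | ex A ih => exact ih h (hup hp hσ).1 (hup hp hσ).2

theorem WF.inst {A : Formula} (h : A.WF 1) (n : ℕ) : (A.inst n).WF 0 := by
  refine h.subst ?_ ?_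
  · rintro (_ | i)
    · exact TTm.pure_num n
    · trivial
  · rintro i hi
    obtain rfl : i = 0 := by omega
    exact .num _ n

theorem impFree_subst {A : Formula} (h : A.ImpFree) (σ : ℕ → TTm) : (A.subst σ).ImpFree := by
  induction A generalizing σ <;> simp_all [ImpFree, subst]

theorem type_subst (A : Formula) (σ : ℕ → TTm) : (A.subst σ).type = A.type := by
  induction A generalizing σ <;> simp_all [type, subst]

/-- A closed atom is true or false. -/
theorem WF.conv_bool {Q : TTm} {ts : List TTm} (h : (atom Q ts).WF 0) :
    TConv (Q.appList ts) .tt ∨ TConv (Q.appList ts) .ff :=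
  TTm.Typed.conv_bool ⟨TTm.pure_appList h.1.1 fun t ht => (h.2 t ht).1,
    HasType.appList h.1.2 fun t ht => (h.2 t ht).2⟩

end Formula

/-! ### A graph model of raw terms

Tokens are natural numbers; the denotation of a raw term is a set of tokens. Numbers are lazy: a
successor has the token `tokSucc`, and the token `tokPred x` for each token `x` of its
predecessor. -/

section Tokens

def tokZero : ℕ := Nat.pair 0 0
def tokSucc : ℕ := Nat.pair 0 1
def tokTrue : ℕ := Nat.pair 0 2
def tokFalse : ℕ := Nat.pair 0 3
def tokPred (x : ℕ) : ℕ := Nat.pair 1 x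
def tokFst (x : ℕ) : ℕ := Nat.pair 2 x
def tokSnd (x : ℕ) : ℕ := Nat.pair 3 x
/-- The token of the functions which have the token `x` at all arguments that have the tokens
in `β`. -/
def tokFun (β : List ℕ) (x : ℕ) : ℕ := Nat.pair 4 (Nat.pair (Encodable.encode β) x)
/-- The token of the finite set of (coded) atoms listed by `L`. -/
def tokState (L : List (ℕ × List ℕ × ℕ)) : ℕ := Nat.pair 5 (Encodable.encode L)

/-- The token by which the numeral of `n` is recognized. -/
def tokNum : ℕ → ℕ
  | 0 => tokZero
  | n + 1 => tokPred (tokNum n)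

/-- The tokens of the numeral of `n`. -/
def numTokens : ℕ → List ℕ
  | 0 => [tokZero]
  | n + 1 => tokSucc :: (numTokens n).map tokPred

@[simp] theorem tokFun_inj {β γ : List ℕ} {x y : ℕ} : tokFun β x = tokFun γ y ↔ β = γ ∧ x = y := by
  simp [tokFun, Nat.pair_eq_pair]

@[simp] theorem tokPred_inj {x y : ℕ} : tokPred x = tokPred y ↔ x = y := by
  simp [tokPred, Nat.pair_eq_pair]

@[simp] theorem tokFst_inj {x y : ℕ} : tokFst x = tokFst y ↔ x = y := by
  simp [tokFst, Nat.pair_eq_pair]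

@[simp] theorem tokSnd_inj {x y : ℕ} : tokSnd x = tokSnd y ↔ x = y := by
  simp [tokSnd, Nat.pair_eq_pair]

@[simp] theorem tokState_inj {L L' : List (ℕ × List ℕ × ℕ)} :
    tokState L = tokState L' ↔ L = L' := by
  simp [tokState, Nat.pair_eq_pair]

@[simp] theorem tokZero_ne_tokSucc : tokZero ≠ tokSucc := by simp [tokZero, tokSucc, Nat.pair_eq_pair]
@[simp] theorem tokZero_ne_tokPred (x) : tokZero ≠ tokPred x := by
  simp [tokZero, tokPred, Nat.pair_eq_pair]
@[simp] theorem tokSucc_ne_tokPred (x) : tokSucc ≠ tokPred x := by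
  simp [tokSucc, tokPred, Nat.pair_eq_pair]
@[simp] theorem tokTrue_ne_tokFalse : tokTrue ≠ tokFalse := by
  simp [tokTrue, tokFalse, Nat.pair_eq_pair]
@[simp] theorem tokFst_ne_tokSnd (x y) : tokFst x ≠ tokSnd y := by
  simp [tokFst, tokSnd, Nat.pair_eq_pair]

/-- A numeral has exactly one token that ends in `tokZero`, below as many predecessors as its value;
its other tokens end in `tokSucc`. That one token therefore identifies the number. -/
theorem tokNum_mem_numTokens {m n : ℕ} : tokNum m ∈ numTokens n ↔ m = n := by
  induction n generalizing m with
  | zero => cases m <;> simp [tokNum, numTokens, (tokZero_ne_tokPred _).symm]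
  | succ n ih =>
    cases m with
    | zero => simp [tokNum, numTokens, (tokZero_ne_tokPred _).symm]
    | succ m => simpa [tokNum, numTokens, (tokSucc_ne_tokPred _).symm] using ih

end Tokens

/-! #### Operations on sets of tokens -/

/-- The finite set of tokens listed by `β`. -/
def listSet (β : List ℕ) : Set ℕ := {y | y ∈ β}

/-- Application. -/
def apSet (d e : Set ℕ) : Set ℕ := {x | ∃ β : List ℕ, tokFun β x ∈ d ∧ ∀ y ∈ β, y ∈ e}

/-- Abstraction. -/
def lamSet (F : Set ℕ → Set ℕ) : Set ℕ := {z | ∃ β x, z = tokFun β x ∧ x ∈ F (listSet β)}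

/-- `tokSucc` is present even for empty `d`, because a recursion unfolds at every successor, whether
or not its predecessor has a value. -/
def succSet (d : Set ℕ) : Set ℕ := {z | z = tokSucc ∨ ∃ x ∈ d, z = tokPred x}

def pairSet (d e : Set ℕ) : Set ℕ := {z | (∃ x ∈ d, z = tokFst x) ∨ ∃ x ∈ e, z = tokSnd x}

def condSet : Set ℕ := {z | ∃ β γ δ x, z = tokFun β (tokFun γ (tokFun δ x)) ∧
  (tokTrue ∈ β ∧ x ∈ γ ∨ tokFalse ∈ β ∧ x ∈ δ)}

/-- The tokens of a primitive recursion with initial value listed by `β` and step listed by `γ` at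
a number whose tokens are listed by `δ`. -/
inductive PrecTok (β γ : List ℕ) : List ℕ → ℕ → Prop
  | zero {δ x} : tokZero ∈ δ → x ∈ β → PrecTok β γ δ x
  | succ {δ x} (δ₁ ε δ₂ : List ℕ) : tokSucc ∈ δ → tokFun δ₁ (tokFun ε x) ∈ γ →
      (∀ y ∈ δ₁, tokPred y ∈ δ) → (∀ y ∈ δ₂, tokPred y ∈ δ) →
      (∀ y ∈ ε, PrecTok β γ δ₂ y) → PrecTok β γ δ x

def precSet : Set ℕ := {z | ∃ β γ δ x, z = tokFun β (tokFun γ (tokFun δ x)) ∧ PrecTok β γ δ x}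

theorem apSet_mono {d d' e e' : Set ℕ} (h : d ⊆ d') (h' : e ⊆ e') : apSet d e ⊆ apSet d' e' :=
  fun _ ⟨β, hβ, hy⟩ => ⟨β, h hβ, fun y hyβ => h' (hy y hyβ)⟩

theorem mem_apSet_tokFun {P : List ℕ → ℕ → Prop} {e : Set ℕ} {x : ℕ} :
    x ∈ apSet {z | ∃ β x, z = tokFun β x ∧ P β x} e ↔ ∃ β, P β x ∧ ∀ y ∈ β, y ∈ e := by
  constructor
  · rintro ⟨β, ⟨β', x', h, h'⟩, hβ⟩
    obtain ⟨rfl, rfl⟩ := tokFun_inj.1 h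
    exact ⟨β, h', hβ⟩
  · rintro ⟨β, h, hβ⟩
    exact ⟨β, ⟨β, x, rfl, h⟩, hβ⟩

theorem mem_apSet₃_tokFun {P : List ℕ → List ℕ → List ℕ → ℕ → Prop} {d e f : Set ℕ} {x : ℕ} :
    x ∈ apSet (apSet (apSet
      {z | ∃ β γ δ x, z = tokFun β (tokFun γ (tokFun δ x)) ∧ P β γ δ x} d) e) f ↔
      ∃ β γ δ, P β γ δ x ∧ (∀ y ∈ β, y ∈ d) ∧ (∀ y ∈ γ, y ∈ e) ∧ ∀ y ∈ δ, y ∈ f := by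
  constructor
  · rintro ⟨δ, ⟨γ, ⟨β, ⟨β', γ', δ', x', h, h'⟩, hβ⟩, hγ⟩, hδ⟩
    simp only [tokFun_inj] at h
    obtain ⟨rfl, rfl, rfl, rfl⟩ := h
    exact ⟨β, γ, δ, h', hβ, hγ, hδ⟩
  · rintro ⟨β, γ, δ, h, hβ, hγ, hδ⟩
    exact ⟨δ, ⟨γ, ⟨β, ⟨β, γ, δ, x, rfl, h⟩, hβ⟩, hγ⟩, hδ⟩

theorem PrecTok.mono {β β' γ γ' δ δ' : List ℕ} {x : ℕ} (hβ : β ⊆ β') (hγ : γ ⊆ γ')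
    (hδ : δ ⊆ δ') (h : PrecTok β γ δ x) : PrecTok β' γ' δ' x := by
  induction h generalizing δ' with
  | zero h h' => exact .zero (hδ h) (hβ h')
  | succ δ₁ ε δ₂ h h₁ h₂ h₃ _ ih =>
    exact .succ δ₁ ε δ₂ (hδ h) (hγ h₁) (fun y hy => hδ (h₂ y hy)) (fun y hy => hδ (h₃ y hy))
      fun y hy => ih y hy (fun _ h => h)

theorem apSet_precSet_zero (d e : Set ℕ) :
    apSet (apSet (apSet precSet d) e) {tokZero} = d := by
  ext x
  rw [precSet, mem_apSet₃_tokFun]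
  constructor
  · rintro ⟨β, γ, δ, h, hβ, -, hδ⟩
    cases h with
    | zero _ h => exact hβ _ h
    | succ _ _ _ h => exact absurd (hδ _ h).symm tokZero_ne_tokSucc
  · exact fun hx => ⟨[x], [], [tokZero], .zero (by simp) (by simp), by simpa, by simp, by simp⟩

/-- The constructor `PrecTok.succ` is one unfolding of the recursion: `δ₁` is passed to the step
function, `δ₂` to the recursive call, and `ε` approximates the result of that call. The requirement
of `tokSucc` keeps this clause from applying at zero when `δ₁` and `δ₂` are empty. -/
theorem apSet_precSet_succ (d e f : Set ℕ) :
    apSet (apSet (apSet precSet d) e) (succSet f) =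
      apSet (apSet e f) (apSet (apSet (apSet precSet d) e) f) := by
  ext x
  rw [precSet, mem_apSet₃_tokFun]
  constructor
  · rintro ⟨β, γ, δ, h, hβ, hγ, hδ⟩
    have hpred : ∀ y, tokPred y ∈ δ → y ∈ f := by
      intro y hy
      rcases hδ _ hy with h | ⟨z, hz, h⟩
      · exact absurd h.symm (tokSucc_ne_tokPred _)
      · rwa [tokPred_inj.1 h]
    cases h with
    | zero h =>
      rcases hδ _ h with h | ⟨z, -, h⟩
      · exact absurd h tokZero_ne_tokSucc
      · exact absurd h (tokZero_ne_tokPred z)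
    | succ δ₁ ε δ₂ h h₁ h₂ h₃ h₄ =>
      exact ⟨ε, ⟨δ₁, hγ _ h₁, fun y hy => hpred y (h₂ y hy)⟩, fun y hy =>
        mem_apSet₃_tokFun.2 ⟨β, γ, δ₂, h₄ y hy, hβ, hγ, fun z hz => hpred z (h₃ z hz)⟩⟩
  · rintro ⟨ε, ⟨δ₁, h₁, hδ₁⟩, hε⟩
    -- Each token of `ε` comes with its own finite approximations; since `PrecTok` is monotone,
    -- their concatenations serve all of them at once.
    have key : ∃ β γ δ, (∀ y ∈ β, y ∈ d) ∧ (∀ y ∈ γ, y ∈ e) ∧ (∀ y ∈ δ, y ∈ f) ∧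
        ∀ y ∈ ε, PrecTok β γ δ y := by
      clear h₁
      induction ε with
      | nil => exact ⟨[], [], [], by simp⟩
      | cons y ε ih =>
        obtain ⟨β, γ, δ, hβ, hγ, hδ, h⟩ := ih fun z hz => hε z (by simp [hz])
        obtain ⟨β', γ', δ', h', hβ', hγ', hδ'⟩ := mem_apSet₃_tokFun.1 (hε y (by simp))
        refine ⟨β ++ β', γ ++ γ', δ ++ δ', ?_, ?_, ?_, ?_⟩
        · simpa [or_imp, forall_and] using ⟨hβ, hβ'⟩
        · simpa [or_imp, forall_and] using ⟨hγ, hγ'⟩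
        · simpa [or_imp, forall_and] using ⟨hδ, hδ'⟩
        · rintro z hz
          rcases List.mem_cons.1 hz with rfl | hz
          · exact h'.mono (by simp) (by simp) (by simp)
          · exact (h z hz).mono (by simp) (by simp) (by simp)
    obtain ⟨β, γ, δ, hβ, hγ, hδ, h⟩ := key
    refine ⟨β, tokFun δ₁ (tokFun ε x) :: γ, tokSucc :: (δ₁ ++ δ).map tokPred,
      .succ δ₁ ε δ (by simp) (by simp) (fun y hy => by simp [hy]) (fun y hy => by simp [hy])
        fun y hy => (h y hy).mono (by simp) (by simp) (by simp), hβ, ?_, ?_⟩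
    · simpa using ⟨h₁, hγ⟩
    · simp only [List.mem_cons, List.mem_map, List.mem_append]
      rintro y (rfl | ⟨z, hz | hz, rfl⟩)
      · exact .inl rfl
      · exact .inr ⟨z, hδ₁ z hz, rfl⟩
      · exact .inr ⟨z, hδ z hz, rfl⟩

theorem apSet_condSet_true (d e : Set ℕ) :
    apSet (apSet (apSet condSet {tokTrue}) d) e = d := by
  ext x
  rw [condSet, mem_apSet₃_tokFun]
  constructor
  · rintro ⟨β, γ, δ, h | h, hβ, hγ, -⟩
    · exact hγ _ h.2
    · exact absurd (hβ _ h.1).symm tokTrue_ne_tokFalse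
  · exact fun hx => ⟨[tokTrue], [x], [], by simp, by simp, by simpa, by simp⟩

theorem apSet_condSet_false (d e : Set ℕ) :
    apSet (apSet (apSet condSet {tokFalse}) d) e = e := by
  ext x
  rw [condSet, mem_apSet₃_tokFun]
  constructor
  · rintro ⟨β, γ, δ, h | h, hβ, -, hδ⟩
    · exact absurd (hβ _ h.1) tokTrue_ne_tokFalse
    · exact hδ _ h.2
  · exact fun hx => ⟨[tokFalse], [], [x], by simp, by simp, by simp, by simpa⟩

/-! #### Denotations -/

/-- Extension of an environment. -/
def consEnv (d : Set ℕ) (ρ : ℕ → Set ℕ) : ℕ → Set ℕ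
  | 0 => d
  | i + 1 => ρ i

section Sem

variable {C D : Type} {κ : C → Set ℕ}

/-- The denotation of a raw term, when the constants denote `κ` and the variables denote `ρ`. -/
def sem (κ : C → Set ℕ) : Tm C → (ℕ → Set ℕ) → Set ℕ
  | .var i, ρ => ρ i
  | .zero, _ => {tokZero}
  | .succ t, ρ => succSet (sem κ t ρ)
  | .tt, _ => {tokTrue}
  | .ff, _ => {tokFalse}
  | .cond _, _ => condSet
  | .prec _, _ => precSet
  | .app t u, ρ => apSet (sem κ t ρ) (sem κ u ρ)
  | .pair t u, ρ => pairSet (sem κ t ρ) (sem κ u ρ)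
  | .fst t, ρ => {x | tokFst x ∈ sem κ t ρ}
  | .snd t, ρ => {x | tokSnd x ∈ sem κ t ρ}
  | .lam _ t, ρ => lamSet fun d => sem κ t (consEnv d ρ)
  | .const c, _ => κ c

theorem sem_mono (t : Tm C) {ρ ρ' : ℕ → Set ℕ} (h : ∀ i, ρ i ⊆ ρ' i) :
    sem κ t ρ ⊆ sem κ t ρ' := by
  induction t generalizing ρ ρ' with
  | var i => exact h i
  | succ t ih =>
    rintro z (hz | ⟨x, hx, hz⟩)
    · exact .inl hz
    · exact .inr ⟨x, ih h hx, hz⟩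
  | app t u iht ihu => exact apSet_mono (iht h) (ihu h)
  | pair t u iht ihu =>
    rintro z (⟨x, hx, hz⟩ | ⟨x, hx, hz⟩)
    · exact .inl ⟨x, iht h hx, hz⟩
    · exact .inr ⟨x, ihu h hx, hz⟩
  | fst t ih => exact fun x hx => ih h hx
  | snd t ih => exact fun x hx => ih h hx
  | lam U t ih =>
    rintro z ⟨β, x, hz, hx⟩
    refine ⟨β, x, hz, ih ?_ hx⟩
    rintro (_ | i)
    · exact subset_rfl
    · exact h i
  | _ => exact subset_rfl

/-- Continuity for single tokens is a hypothesis, so that the passage to finitely many tokens is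
available inside the induction that proves `sem_continuous`. -/
theorem sem_continuous_list {t : Tm C} {ρ : ℕ → Set ℕ}
    (h : ∀ {x}, x ∈ sem κ t ρ →
      ∃ b : ℕ → List ℕ, (∀ i, ∀ y ∈ b i, y ∈ ρ i) ∧ x ∈ sem κ t fun i => listSet (b i))
    (β : List ℕ) (hβ : ∀ y ∈ β, y ∈ sem κ t ρ) :
    ∃ b : ℕ → List ℕ, (∀ i, ∀ y ∈ b i, y ∈ ρ i) ∧
      ∀ y ∈ β, y ∈ sem κ t fun i => listSet (b i) := by
  induction β with
  | nil => exact ⟨fun _ => [], by simp⟩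
  | cons y β ih =>
    obtain ⟨b, hb, hb'⟩ := ih fun z hz => hβ z (by simp [hz])
    obtain ⟨a, ha, ha'⟩ := h (hβ y (by simp))
    refine ⟨fun i => a i ++ b i, fun i z hz => ?_, fun z hz => ?_⟩
    · exact (List.mem_append.1 hz).elim (ha i z) (hb i z)
    · rcases List.mem_cons.1 hz with rfl | hz
      · exact sem_mono t (fun i y hy => List.mem_append_left _ hy) ha'
      · exact sem_mono t (fun i y hy => List.mem_append_right _ hy) (hb' z hz)

/-- A token is derived from finitely many tokens of each variable. This compactness is what makes
abstraction over finite sets adequate for β. -/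
theorem sem_continuous (t : Tm C) {ρ : ℕ → Set ℕ} {x : ℕ} (hx : x ∈ sem κ t ρ) :
    ∃ b : ℕ → List ℕ, (∀ i, ∀ y ∈ b i, y ∈ ρ i) ∧ x ∈ sem κ t fun i => listSet (b i) := by
  induction t generalizing ρ x with
  | var i => exact ⟨fun j => if j = i then [x] else [], fun j y hy => by
      by_cases h : j = i <;> simp_all [sem], by simp [sem, listSet]⟩
  | succ t ih =>
    rcases hx with hx | ⟨y, hy, hx⟩
    · exact ⟨fun _ => [], by simp, .inl hx⟩
    · obtain ⟨b, hb, hb'⟩ := ih hy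
      exact ⟨b, hb, .inr ⟨y, hb', hx⟩⟩
  | app t u iht ihu =>
    obtain ⟨β, hβ, hy⟩ := hx
    obtain ⟨a, ha, ha'⟩ := iht hβ
    obtain ⟨b, hb, hb'⟩ := sem_continuous_list ihu β hy
    refine ⟨fun i => a i ++ b i, fun i z hz => (List.mem_append.1 hz).elim (ha i z) (hb i z),
      β, ?_, fun z hz => ?_⟩
    · exact sem_mono t (fun i y hy => List.mem_append_left _ hy) ha'
    · exact sem_mono u (fun i y hy => List.mem_append_right _ hy) (hb' z hz)
  | pair t u iht ihu =>
    rcases hx with ⟨y, hy, hx⟩ | ⟨y, hy, hx⟩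
    · obtain ⟨b, hb, hb'⟩ := iht hy
      exact ⟨b, hb, .inl ⟨y, hb', hx⟩⟩
    · obtain ⟨b, hb, hb'⟩ := ihu hy
      exact ⟨b, hb, .inr ⟨y, hb', hx⟩⟩
  | fst t ih => exact ih hx
  | snd t ih => exact ih hx
  | lam U t ih =>
    obtain ⟨β, y, rfl, hy⟩ := hx
    obtain ⟨b, hb, hb'⟩ := ih hy
    -- The approximation of the bound variable is dropped, since it is contained in `β`.
    refine ⟨fun i => b (i + 1), fun i => hb (i + 1), β, y, rfl, sem_mono t ?_ hb'⟩
    rintro (_ | i)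
    · exact hb 0
    · exact subset_rfl
  | _ => exact ⟨fun _ => [], by simp, hx⟩

theorem sem_rename (t : Tm C) (f : ℕ → ℕ) (ρ : ℕ → Set ℕ) :
    sem κ (t.rename f) ρ = sem κ t (ρ ∘ f) := by
  induction t generalizing f ρ with
  | lam U t ih =>
    simp only [Tm.rename, sem, ih]
    congr 1
    funext d
    congr 1
    funext i
    cases i <;> rfl
  | _ => simp_all [Tm.rename, sem]

theorem sem_subst (t : Tm C) (σ : ℕ → Tm C) (ρ : ℕ → Set ℕ) :
    sem κ (t.subst σ) ρ = sem κ t fun i => sem κ (σ i) ρ := by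
  induction t generalizing σ ρ with
  | lam U t ih =>
    simp only [Tm.subst, sem, ih]
    congr 1
    funext d
    congr 1
    funext i
    cases i with
    | zero => rfl
    | succ i => simp only [Tm.up, consEnv, sem_rename]; rfl
  | _ => simp_all [Tm.subst, sem]

theorem sem_replaceConst {κ' : D → Set ℕ} {f : C → Tm D}
    (h : ∀ c ρ, sem κ' (f c) ρ = κ c) (t : Tm C) (ρ : ℕ → Set ℕ) :
    sem κ' (t.replaceConst f) ρ = sem κ t ρ := by
  induction t generalizing ρ <;> simp_all [Tm.replaceConst, sem]

/-- From left to right this is monotonicity, from right to left continuity: finitely many tokens of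
the argument suffice. No typing is involved. -/
theorem sem_beta (U : Ty) (t u : Tm C) (ρ : ℕ → Set ℕ) :
    sem κ (.app (.lam U t) u) ρ = sem κ (t.subst (Tm.single u)) ρ := by
  have e : (fun i => sem κ (Tm.single u i) ρ) = consEnv (sem κ u ρ) ρ := by
    funext i; cases i <;> rfl
  rw [sem_subst, e]
  ext x
  simp only [sem, lamSet]
  rw [mem_apSet_tokFun]
  constructor
  · rintro ⟨β, h, hβ⟩
    refine sem_mono t ?_ h
    rintro (_ | i)
    · exact hβ
    · exact subset_rfl
  · intro hx
    obtain ⟨b, hb, hb'⟩ := sem_continuous t hx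
    refine ⟨b 0, sem_mono t ?_ hb', hb 0⟩
    rintro (_ | i)
    · exact subset_rfl
    · exact hb (i + 1)

theorem sem_num (n : ℕ) (ρ : ℕ → Set ℕ) : sem κ (Tm.num n) ρ = listSet (numTokens n) := by
  induction n with
  | zero => ext; simp [sem, Tm.num, numTokens, listSet]
  | succ n ih =>
    ext
    simp [sem, Tm.num, numTokens, listSet, ih, succSet, eq_comm]

variable {δ : Tm C → Tm C → Prop}

theorem sem_red (hδ : ∀ t t', δ t t' → ∀ ρ, sem κ t ρ = sem κ t' ρ) {t t' : Tm C}
    (h : Red δ t t') (ρ : ℕ → Set ℕ) : sem κ t ρ = sem κ t' ρ := by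
  induction h generalizing ρ with
  | beta T t u => exact sem_beta T t u ρ
  | fst_pair t u => ext; simp [sem, pairSet]
  | snd_pair t u => ext; simp [sem, pairSet, fun x y => (tokFst_ne_tokSnd x y).symm]
  | prec_zero T u v => exact apSet_precSet_zero _ _
  | prec_succ T u v t => exact apSet_precSet_succ _ _ _
  | cond_tt T u v => exact apSet_condSet_true _ _
  | cond_ff T u v => exact apSet_condSet_false _ _
  | rule h => exact hδ _ _ h ρ
  | _ => simp_all [sem]

theorem sem_conv (hδ : ∀ t t', δ t t' → ∀ ρ, sem κ t ρ = sem κ t' ρ) {t t' : Tm C}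
    (h : Conv δ t t') (ρ : ℕ → Set ℕ) : sem κ t ρ = sem κ t' ρ := by
  induction h with
  | rel _ _ h => exact sem_red hδ h ρ
  | refl => rfl
  | symm _ _ _ ih => exact ih.symm
  | trans _ _ _ _ _ ih ih' => exact ih.trans ih'

/-- The environment of closed terms. -/
def emptyEnv : ℕ → Set ℕ := fun _ => ∅

end Sem

/-! #### Denotations in system `T` -/

def semT (t : TTm) (ρ : ℕ → Set ℕ) : Set ℕ := sem (fun e : Empty => e.elim) t ρ

theorem TConv.semT_eq {t t' : TTm} (h : TConv t t') (ρ : ℕ → Set ℕ) : semT t ρ = semT t' ρ :=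
  sem_conv (δ := fun _ _ : TTm => False) (by simp) h ρ

@[simp] theorem semT_tt (ρ : ℕ → Set ℕ) : semT .tt ρ = {tokTrue} := rfl

@[simp] theorem semT_ff (ρ : ℕ → Set ℕ) : semT .ff ρ = {tokFalse} := rfl

/-- Soundness of the model becomes an equivalence for terms known to have a value. Truth, and
likewise falsity, of a closed atom is thereby a positive condition on tokens. -/
theorem TConv.tokTrue_mem_iff {t : TTm} (h : TConv t .tt ∨ TConv t .ff) (ρ : ℕ → Set ℕ) :
    tokTrue ∈ semT t ρ ↔ TConv t .tt := by
  refine ⟨fun h' => ?_, fun h' => by simp [h'.semT_eq]⟩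
  rcases h with h | h
  · exact h
  · simp [h.semT_eq] at h'

theorem TConv.tokFalse_mem_iff {t : TTm} (h : TConv t .tt ∨ TConv t .ff) (ρ : ℕ → Set ℕ) :
    tokFalse ∈ semT t ρ ↔ TConv t .ff := by
  refine ⟨fun h' => ?_, fun h' => by simp [h'.semT_eq]⟩
  rcases h with h | h
  · simp [h.semT_eq, tokTrue_ne_tokFalse.symm] at h'
  · exact h

theorem TConv.not_tt_ff {t : TTm} (h : TConv t .tt) (h' : TConv t .ff) : False := by
  have e := (h.semT_eq emptyEnv).symm.trans (h'.semT_eq emptyEnv)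
  simp at e

/-! ### Codes of predicates, atoms and states -/

/-- Codes serve to name predicates inside tokens. Only their injectivity matters; they are never
decoded. -/
def Ty.code : Ty → ℕ
  | .nat => Nat.pair 0 0
  | .bool => Nat.pair 1 0
  | .state => Nat.pair 2 0
  | .prod U V => Nat.pair 3 (Nat.pair U.code V.code)
  | .arr U V => Nat.pair 4 (Nat.pair U.code V.code)

theorem Ty.code_injective : Function.Injective Ty.code := by
  intro T T' h
  induction T generalizing T' <;> cases T' <;> simp_all [Ty.code, Nat.pair_eq_pair]
  all_goals grind

def TTm.code : TTm → ℕ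
  | .var i => Nat.pair 0 i
  | .zero => Nat.pair 1 0
  | .succ t => Nat.pair 2 (TTm.code t)
  | .tt => Nat.pair 3 0
  | .ff => Nat.pair 4 0
  | .cond T => Nat.pair 5 T.code
  | .prec T => Nat.pair 6 T.code
  | .app t u => Nat.pair 7 (Nat.pair (TTm.code t) (TTm.code u))
  | .pair t u => Nat.pair 8 (Nat.pair (TTm.code t) (TTm.code u))
  | .fst t => Nat.pair 9 (TTm.code t)
  | .snd t => Nat.pair 10 (TTm.code t)
  | .lam T t => Nat.pair 11 (Nat.pair T.code (TTm.code t))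
  | .const c => c.elim

theorem TTm.code_injective : Function.Injective TTm.code := by
  intro t t' h
  induction t generalizing t' with
  | const c => exact c.elim
  | _ => cases t' <;> simp_all [TTm.code, Nat.pair_eq_pair, Ty.code_injective.eq_iff] <;> grind

def Predicate.code (P : Predicate) : ℕ := Nat.pair P.arity (TTm.code P.term)

theorem Predicate.code_injective : Function.Injective Predicate.code := by
  rintro ⟨k, t, h, h'⟩ ⟨k', t', _, _⟩ e
  simp only [Predicate.code, Nat.pair_eq_pair, TTm.code_injective.eq_iff] at e
  obtain ⟨rfl, rfl⟩ := e
  rfl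

abbrev AtomCode : Type := ℕ × List ℕ × ℕ

def Atom.code (a : Atom) : AtomCode := (a.pred.code, a.args, a.wit)

theorem Atom.code_injective : Function.Injective Atom.code := by
  rintro ⟨P, ns, m, h, h'⟩ ⟨P', ns', m', _, _⟩ e
  simp only [Atom.code, Prod.mk.injEq, Predicate.code_injective.eq_iff] at e
  obtain ⟨rfl, rfl, rfl⟩ := e
  rfl

/-- The list `L` consists of the codes of the atoms of `s`. -/
def Rep (L : List AtomCode) (s : State) : Prop := ∀ c, c ∈ L ↔ ∃ a ∈ s.carrier, a.code = c

/-- The list `L` contains the code of an atom `⟨P, n⃗, m⟩`, where `p` is the code of `P`. -/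
def KnowsCode (L : List AtomCode) (p : ℕ) (ns : List ℕ) : Prop := ∃ c ∈ L, c.1 = p ∧ c.2.1 = ns

def ConsistentCode (a b : AtomCode) : Prop := a.1 = b.1 → a.2.1 = b.2.1 → a.2.2 = b.2.2

/-- Membership in the consistent union of two lists of codes. -/
def MemCunion (L₁ L₂ : List AtomCode) (c : AtomCode) : Prop :=
  c ∈ L₁ ∨ c ∈ L₂ ∧ ∀ a ∈ L₁, ConsistentCode a c

theorem State.ext {s s' : State} (h : s.carrier = s'.carrier) : s = s' := by
  cases s; cases s'; simp_all

theorem exists_rep (s : State) : ∃ L, Rep L s := by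
  obtain ⟨F, hF⟩ := s.finite.exists_finset
  refine ⟨F.toList.map Atom.code, fun c => ?_⟩
  simp [hF]

theorem Rep.unique {L : List AtomCode} {s s' : State} (h : Rep L s) (h' : Rep L s') : s = s' := by
  have key : ∀ {s s' : State}, Rep L s → Rep L s' → s.carrier ⊆ s'.carrier := by
    intro s s' h h' a ha
    obtain ⟨b, hb, e⟩ := (h' _).1 ((h a.code).2 ⟨a, ha, rfl⟩)
    rwa [← Atom.code_injective e]
  exact State.ext ((key h h').antisymm (key h' h))

theorem Rep.mem_congr {L L' : List AtomCode} {s : State} (h : Rep L s) (h' : Rep L' s)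
    (c : AtomCode) : c ∈ L ↔ c ∈ L' := (h c).trans (h' c).symm

theorem Rep.congr {L L' : List AtomCode} {s : State} (h : Rep L s)
    (h' : ∀ c, c ∈ L' ↔ c ∈ L) : Rep L' s := fun c => (h' c).trans (h c)

theorem Rep.knows_iff {L : List AtomCode} {s : State} (h : Rep L s) {P : Predicate}
    {ns : List ℕ} : KnowsCode L P.code ns ↔ s.Knows P ns := by
  constructor
  · rintro ⟨c, hc, h₁, h₂⟩
    obtain ⟨a, ha, rfl⟩ := (h c).1 hc
    exact ⟨a, ha, Predicate.code_injective h₁, h₂⟩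
  · rintro ⟨a, ha, rfl, rfl⟩
    exact ⟨a.code, (h _).2 ⟨a, ha, rfl⟩, rfl, rfl⟩

theorem rep_empty {L : List AtomCode} : Rep L State.empty ↔ L = [] := by
  simp [Rep, State.empty, List.eq_nil_iff_forall_not_mem]

theorem rep_singleton {L : List AtomCode} {a : Atom} :
    Rep L (State.singleton a) ↔ ∀ c, c ∈ L ↔ c = a.code := by
  simp [Rep, State.singleton, eq_comm]

theorem consistentCode_iff {a b : Atom} : ConsistentCode a.code b.code ↔ a.Consistent b := by
  simp [ConsistentCode, Atom.code, Atom.Consistent, Predicate.code_injective.eq_iff]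

theorem Rep.cunion {L₁ L₂ L : List AtomCode} {s₁ s₂ : State} (h₁ : Rep L₁ s₁) (h₂ : Rep L₂ s₂) :
    Rep L (s₁.cunion s₂) ↔ ∀ c, c ∈ L ↔ MemCunion L₁ L₂ c := by
  refine forall_congr' fun c => iff_congr .rfl ?_
  constructor
  · rintro ⟨a, ha | ⟨ha, hc⟩, rfl⟩
    · exact .inl ((h₁ _).2 ⟨a, ha, rfl⟩)
    · refine .inr ⟨(h₂ _).2 ⟨a, ha, rfl⟩, fun c hc' => ?_⟩
      obtain ⟨b, hb, rfl⟩ := (h₁ _).1 hc'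
      exact consistentCode_iff.2 (hc b hb)
  · rintro (hc | ⟨hc, hc'⟩)
    · obtain ⟨a, ha, rfl⟩ := (h₁ _).1 hc
      exact ⟨a, .inl ha, rfl⟩
    · obtain ⟨a, ha, rfl⟩ := (h₂ _).1 hc
      refine ⟨a, .inr ⟨ha, fun b hb => ?_⟩, rfl⟩
      exact consistentCode_iff.1 (hc' _ ((h₁ _).2 ⟨b, hb, rfl⟩))

/-! ### Denotations of the constants -/

/-- The denotation of the `k`-ary functions on numerals whose values are given by `F`. -/
def natFun : ℕ → (List ℕ → Set ℕ) → Set ℕ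
  | 0, F => F []
  | k + 1, F => {z | ∃ β x, z = tokFun β x ∧
      ∃ n, tokNum n ∈ β ∧ x ∈ natFun k fun ns => F (n :: ns)}

theorem natFun_succ_apSet (k : ℕ) (F : List ℕ → Set ℕ) (n : ℕ) :
    apSet (natFun (k + 1) F) (listSet (numTokens n)) = natFun k fun ns => F (n :: ns) := by
  ext x
  rw [natFun, mem_apSet_tokFun]
  constructor
  · rintro ⟨β, ⟨m, hm, h⟩, hβ⟩
    obtain rfl := tokNum_mem_numTokens.1 (hβ _ hm)
    exact h
  · exact fun h => ⟨[tokNum n], ⟨n, by simp, h⟩, by simp [listSet, tokNum_mem_numTokens]⟩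

theorem sem_appNums_of_natFun {C : Type} {κ : C → Set ℕ} {t : Tm C} {ρ : ℕ → Set ℕ}
    {F : List ℕ → Set ℕ} {k : ℕ} {ns : List ℕ} (hk : ns.length = k)
    (h : sem κ t ρ = natFun k F) : sem κ (t.appNums ns) ρ = F ns := by
  subst hk
  induction ns generalizing t F with
  | nil => exact h
  | cons n ns ih =>
    rw [Tm.appNums_cons]
    refine ih (F := fun ns => F (n :: ns)) ?_
    rw [← natFun_succ_apSet, sem, h, sem_num]
    rfl

/-- The denotation of `P` applied to numerals. -/
def predSet (P : Predicate) (ns : List ℕ) : Set ℕ := semT (P.term.appNums ns) emptyEnv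

def oracleSet (P : Predicate) (L : List AtomCode) : Set ℕ :=
  natFun P.arity fun ns => {x | KnowsCode L P.code ns ∧ x = tokTrue ∨
    ¬ KnowsCode L P.code ns ∧ x = tokFalse}

def skolemSet (P : Predicate) (L : List AtomCode) : Set ℕ :=
  natFun P.arity fun ns => {x | (∃ m, (P.code, ns, m) ∈ L ∧ x ∈ numTokens m) ∨
    ¬ KnowsCode L P.code ns ∧ x ∈ numTokens 0}

/-- Truth and falsity of `P` are both tested positively, so that the set is enumerable; the only
negated condition concerns the finite list `L`. Any list whose sole element is the new atom is
admitted as output. -/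
def adderSet (P : Predicate) (L : List AtomCode) : Set ℕ :=
  natFun (P.arity + 1) fun l => {x | ∃ ns m, l = ns ++ [m] ∧
    ((x = tokState [] ∧ (KnowsCode L P.code ns ∨ tokFalse ∈ predSet P l)) ∨
      ¬ KnowsCode L P.code ns ∧ tokTrue ∈ predSet P l ∧
        ∃ L', x = tokState L' ∧ ∀ c, c ∈ L' ↔ c = (P.code, ns, m))}

/-- All lists of the atoms of `s` occur, in any order and with repetitions, so that no listing has
to be singled out. -/
def stateSet (s : State) : Set ℕ := {x | ∃ L, Rep L s ∧ x = tokState L}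

def cunionSet : Set ℕ := {z | ∃ β γ L, z = tokFun β (tokFun γ (tokState L)) ∧
  ∃ L₁ L₂, tokState L₁ ∈ β ∧ tokState L₂ ∈ γ ∧ ∀ c, c ∈ L ↔ MemCunion L₁ L₂ c}

/-- The tokens of a fixed point of the function whose tokens are listed by `β`. -/
inductive FixTok (β : List ℕ) : ℕ → Prop
  | step {x} (ε : List ℕ) : tokFun ε x ∈ β → (∀ y ∈ ε, FixTok β y) → FixTok β x

def fixSet : Set ℕ := {z | ∃ β x, z = tokFun β x ∧ FixTok β x}

/-- The functions of a state which are given by `F` on lists of codes. -/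
def stateFun (F : List AtomCode → Set ℕ) : Set ℕ :=
  {z | ∃ β x, z = tokFun β x ∧ ∃ L, tokState L ∈ β ∧ x ∈ F L}

theorem FixTok.mono {β β' : List ℕ} (h : β ⊆ β') {x : ℕ} (hx : FixTok β x) : FixTok β' x := by
  induction hx with
  | step ε h₁ _ ih => exact .step ε (h h₁) ih

/-- The last step of a derivation in `FixTok` is one application of the function. Conversely the
finitely many derivations of the tokens in `ε` use finitely many tokens of `d`, which are put
together. -/
theorem apSet_fixSet (d : Set ℕ) : apSet fixSet d = apSet d (apSet fixSet d) := by
  ext x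
  constructor
  · intro h
    rw [fixSet, mem_apSet_tokFun] at h
    obtain ⟨β, ⟨ε, h₁, h₂⟩, hβ⟩ := h
    exact ⟨ε, hβ _ h₁, fun y hy => mem_apSet_tokFun.2 ⟨β, h₂ y hy, hβ⟩⟩
  · rintro ⟨ε, h₁, hε⟩
    have key : ∃ β : List ℕ, (∀ y ∈ β, y ∈ d) ∧ ∀ y ∈ ε, FixTok β y := by
      clear h₁
      induction ε with
      | nil => exact ⟨[], by simp⟩
      | cons y ε ih =>
        obtain ⟨β, hβ, h⟩ := ih fun z hz => hε z (by simp [hz])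
        obtain ⟨β', h', hβ'⟩ := mem_apSet_tokFun.1 (hε y (by simp))
        refine ⟨β ++ β', by simpa [or_imp, forall_and] using ⟨hβ, hβ'⟩, fun z hz => ?_⟩
        rcases List.mem_cons.1 hz with rfl | hz
        · exact h'.mono (by simp)
        · exact (h z hz).mono (by simp)
    obtain ⟨β, hβ, h⟩ := key
    refine mem_apSet_tokFun.2 ⟨tokFun ε x :: β, .step ε (by simp) fun y hy =>
      (h y hy).mono (by simp), by simpa using ⟨h₁, hβ⟩⟩

/-- The function may read any listing of the state; the invariance `hF` makes the result independent
of which one it finds. -/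
theorem apSet_stateFun {F : List AtomCode → Set ℕ}
    (hF : ∀ L L', (∀ c, c ∈ L ↔ c ∈ L') → F L = F L') {L : List AtomCode} {s : State}
    (h : Rep L s) : apSet (stateFun F) (stateSet s) = F L := by
  ext x
  rw [stateFun, mem_apSet_tokFun]
  constructor
  · rintro ⟨β, ⟨L', hL', hx⟩, hβ⟩
    obtain ⟨L'', hL'', e⟩ := hβ _ hL'
    obtain rfl := tokState_inj.1 e
    rwa [hF _ _ (h.mem_congr hL'')]
  · exact fun hx => ⟨[tokState L], ⟨L, by simp, hx⟩, by simpa using ⟨L, h, rfl⟩⟩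

theorem knowsCode_congr {L L' : List AtomCode} (h : ∀ c, c ∈ L ↔ c ∈ L') :
    KnowsCode L = KnowsCode L' := by
  funext p ns; simp [KnowsCode, h]

theorem oracleSet_congr (P : Predicate) (L L' : List AtomCode) (h : ∀ c, c ∈ L ↔ c ∈ L') :
    oracleSet P L = oracleSet P L' := by
  simp only [oracleSet, knowsCode_congr h]

theorem skolemSet_congr (P : Predicate) (L L' : List AtomCode) (h : ∀ c, c ∈ L ↔ c ∈ L') :
    skolemSet P L = skolemSet P L' := by
  simp only [skolemSet, knowsCode_congr h, h]

theorem adderSet_congr (P : Predicate) (L L' : List AtomCode) (h : ∀ c, c ∈ L ↔ c ∈ L') :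
    adderSet P L = adderSet P L' := by
  simp only [adderSet, knowsCode_congr h]

section Constants

variable {K : Calculus}

/-- Denotations of the constants of `T_Learn` and `PCF_Learn`. -/
def learnSet : LearnConst K → Set ℕ
  | .st s => stateSet s
  | .cup => cunionSet
  | .chi P => stateFun (oracleSet P)
  | .phi P => stateFun (skolemSet P)
  | .learn P => stateFun (adderSet P)
  | .fix _ _ => fixSet

/-- Denotations of the constants of `T_Class` and `PCF_Class` at the state listed by `L`. -/
def classSet (L : List AtomCode) : ClassConst K → Set ℕ
  | .st s => stateSet s
  | .cup => cunionSet
  | .oracle P => oracleSet P L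
  | .skolem P => skolemSet P L
  | .adder P => adderSet P L
  | .fix _ _ => fixSet

theorem sem_chi {L : List AtomCode} {s : State} (h : Rep L s) (P : Predicate) (ρ : ℕ → Set ℕ) :
    sem learnSet (.app (.const (.chi P)) (stc s) : LearnTm K) ρ = oracleSet P L :=
  apSet_stateFun (oracleSet_congr P) h

theorem sem_phi {L : List AtomCode} {s : State} (h : Rep L s) (P : Predicate) (ρ : ℕ → Set ℕ) :
    sem learnSet (.app (.const (.phi P)) (stc s) : LearnTm K) ρ = skolemSet P L :=
  apSet_stateFun (skolemSet_congr P) h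

theorem sem_learn {L : List AtomCode} {s : State} (h : Rep L s) (P : Predicate) (ρ : ℕ → Set ℕ) :
    sem learnSet (.app (.const (.learn P)) (stc s) : LearnTm K) ρ = adderSet P L :=
  apSet_stateFun (adderSet_congr P) h

/-- The state is moved from the term into the interpretation of the constants, where it appears as a
list of numbers. Only in this form can enumerability be uniform in the state. -/
theorem sem_approx {L : List AtomCode} {s : State} (h : Rep L s) (t : ClassTm K)
    (ρ : ℕ → Set ℕ) : sem learnSet (approx s t) ρ = sem (classSet L) t ρ := by
  refine sem_replaceConst (fun c ρ => ?_) t ρ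
  cases c with
  | oracle P => exact sem_chi h P ρ
  | skolem P => exact sem_phi h P ρ
  | adder P => exact sem_learn h P ρ
  | _ => rfl

theorem sem_learnRule {t t' : LearnTm K} (h : LearnRule K t t') (ρ : ℕ → Set ℕ) :
    sem learnSet t ρ = sem learnSet t' ρ := by
  cases h with
  | chi_true s P ns hns hs =>
    obtain ⟨L, hL⟩ := exists_rep s
    rw [sem_appNums_of_natFun hns (sem_chi hL P ρ)]
    ext x
    simp [hL.knows_iff, hs, sem]
  | chi_false s P ns hns hs =>
    obtain ⟨L, hL⟩ := exists_rep s
    rw [sem_appNums_of_natFun hns (sem_chi hL P ρ)]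
    ext x
    simp [hL.knows_iff, hs, sem]
  | phi_wit s a ha =>
    obtain ⟨L, hL⟩ := exists_rep s
    rw [sem_appNums_of_natFun a.length_args (sem_phi hL a.pred ρ),
      sem_num]
    have hk : s.Knows a.pred a.args := ⟨a, ha, rfl, rfl⟩
    ext x
    simp only [Set.mem_ofPred_eq, hL.knows_iff, hk, listSet, not_true_eq_false, false_and,
      or_false]
    constructor
    · rintro ⟨m, hm, hx⟩
      obtain ⟨b, hb, e⟩ := (hL _).1 hm
      simp only [Atom.code, Prod.mk.injEq, Predicate.code_injective.eq_iff] at e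
      obtain ⟨e₁, e₂, rfl⟩ := e
      rwa [← s.consistent b hb a ha e₁ e₂]
    · exact fun hx => ⟨a.wit, (hL _).2 ⟨a, ha, rfl⟩, hx⟩
  | phi_zero s P ns hns hs =>
    obtain ⟨L, hL⟩ := exists_rep s
    rw [sem_appNums_of_natFun hns (sem_phi hL P ρ), sem_num]
    ext x
    have hk := mt hL.knows_iff.1 hs
    simp only [Set.mem_ofPred_eq, hk, listSet, not_false_eq_true, true_and, or_iff_right_iff_imp]
    rintro ⟨m, hm, -⟩
    exact absurd ⟨_, hm, rfl, rfl⟩ hk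
  | learn_old s P ns m hns hs =>
    obtain ⟨L, hL⟩ := exists_rep s
    rw [sem_appNums_of_natFun (by simp [hns]) (sem_learn hL P ρ)]
    have hns' : (ns ++ [m]).length = P.arity + 1 := by simp [hns]
    have hk : KnowsCode L P.code ns ∨ tokFalse ∈ predSet P (ns ++ [m]) :=
      hs.imp hL.knows_iff.2 (TConv.tokFalse_mem_iff (P.conv_bool hns') _).2
    -- Truth and falsity exclude each other, so the clause of `adderSet` that learns an atom is void
    -- here.
    have hk' : ¬ (¬ KnowsCode L P.code ns ∧ tokTrue ∈ predSet P (ns ++ [m])) := by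
      rintro ⟨h₁, h₂⟩
      exact (TConv.not_tt_ff ((TConv.tokTrue_mem_iff (P.conv_bool hns') _).1 h₂)
        (hs.resolve_left (mt hL.knows_iff.2 h₁)))
    ext x
    simp only [Set.mem_ofPred_eq, stc, sem, learnSet, stateSet, rep_empty, exists_eq_left]
    constructor
    · rintro ⟨ns', m', e, h⟩
      obtain ⟨rfl, e⟩ := List.append_inj' e rfl
      obtain rfl : m = m' := by simpa using e
      rcases h with h | h
      · exact h.1
      · exact absurd ⟨h.1, h.2.1⟩ hk'
    · exact fun hx => ⟨ns, m, rfl, .inl ⟨hx, hk⟩⟩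
  | learn_new s a hs =>
    obtain ⟨L, hL⟩ := exists_rep s
    have hns' : (a.args ++ [a.wit]).length = a.pred.arity + 1 := by simp [a.length_args]
    rw [sem_appNums_of_natFun hns' (sem_learn hL a.pred ρ)]
    have hk := mt hL.knows_iff.1 hs
    have ht := (TConv.tokTrue_mem_iff (a.pred.conv_bool hns') emptyEnv).2 a.holds
    have hf : tokFalse ∉ predSet a.pred (a.args ++ [a.wit]) := fun h =>
      TConv.not_tt_ff a.holds ((TConv.tokFalse_mem_iff (a.pred.conv_bool hns') _).1 h)
    ext x
    simp only [Set.mem_ofPred_eq, stc, sem, learnSet, stateSet, rep_singleton]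
    constructor
    · rintro ⟨ns', m', e, h⟩
      obtain ⟨rfl, e⟩ := List.append_inj' e rfl
      obtain rfl : a.wit = m' := by simpa using e
      rcases h with h | h
      · exact absurd h.2 (not_or.2 ⟨hk, hf⟩)
      · obtain ⟨-, -, L', rfl, h⟩ := h
        exact ⟨L', h, rfl⟩
    · rintro ⟨L', h, rfl⟩
      exact ⟨a.args, a.wit, rfl, .inr ⟨hk, ht, L', rfl, h⟩⟩
  | cup s₁ s₂ =>
    ext x
    simp only [sem, stc, learnSet]
    constructor
    · rintro ⟨γ, ⟨β, ⟨β', γ', L, e, L₁, L₂, h₁, h₂, h⟩, hβ⟩, hγ⟩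
      simp only [tokFun_inj] at e
      obtain ⟨rfl, rfl, rfl⟩ := e
      obtain ⟨L₁', hL₁, e₁⟩ := hβ _ h₁
      obtain ⟨L₂', hL₂, e₂⟩ := hγ _ h₂
      obtain rfl := tokState_inj.1 e₁
      obtain rfl := tokState_inj.1 e₂
      exact ⟨L, (hL₁.cunion hL₂).2 h, rfl⟩
    · rintro ⟨L, hL, rfl⟩
      obtain ⟨L₁, h₁⟩ := exists_rep s₁
      obtain ⟨L₂, h₂⟩ := exists_rep s₂
      exact ⟨[tokState L₂], ⟨[tokState L₁], ⟨_, _, _, rfl, L₁, L₂, by simp, by simp,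
        (h₁.cunion h₂).1 hL⟩, by simpa using ⟨L₁, h₁, rfl⟩⟩, by simpa using ⟨L₂, h₂, rfl⟩⟩
  | fix h U u => exact apSet_fixSet _

theorem LConv.sem_eq {t t' : LearnTm K} (h : LConv t t') (ρ : ℕ → Set ℕ) :
    sem learnSet t ρ = sem learnSet t' ρ :=
  sem_conv (fun _ _ h => sem_learnRule h) h ρ

/-- The model separates numerals, independently of confluence; the confluence proof can thus rely on
uniqueness of values. -/
theorem LConv.num_inj {m n : ℕ} (h : LConv (Tm.num m : LearnTm K) (Tm.num n)) : m = n := by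
  have e := h.sem_eq emptyEnv
  rw [sem_num, sem_num] at e
  exact tokNum_mem_numTokens.1 (e ▸ tokNum_mem_numTokens.2 rfl : tokNum m ∈ listSet _)

theorem LConv.not_tt_ff (h : LConv (.tt : LearnTm K) .ff) : False := by
  have e := h.sem_eq emptyEnv
  simp [sem] at e

theorem LConv.stc_inj {s s' : State} (h : LConv (stc s : LearnTm K) (stc s')) : s = s' := by
  have e : stateSet s = stateSet s' := h.sem_eq emptyEnv
  obtain ⟨L, hL⟩ := exists_rep s
  obtain ⟨L', hL', e'⟩ : tokState L ∈ stateSet s' := e ▸ (⟨L, hL, rfl⟩ : tokState L ∈ stateSet s)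
  obtain rfl := tokState_inj.1 e'
  exact hL.unique hL'

end Constants

/-! ### Confluence -/

namespace Tm

variable {C : Type}

/-- The term at the head of a sequence of applications. -/
def head : Tm C → Tm C
  | app t _ => head t
  | t => t

/-- The number of arguments to which the head of a term is applied. -/
def numArgs : Tm C → ℕ
  | app t _ => numArgs t + 1
  | _ => 0

@[simp] theorem head_appList (t : Tm C) (us : List (Tm C)) : head (appList t us) = head t := by
  induction us generalizing t with
  | nil => rfl
  | cons u us ih => rw [appList, ih, head]

@[simp] theorem numArgs_appList (t : Tm C) (us : List (Tm C)) :
    numArgs (appList t us) = numArgs t + us.length := by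
  induction us generalizing t with
  | nil => rfl
  | cons u us ih => rw [appList, ih, numArgs, List.length_cons]; omega

end Tm

section Confluence

variable {K : Calculus}

/-- Numerals, boolean constants and state constants. -/
inductive IsValue : LearnTm K → Prop
  | num (n) : IsValue (Tm.num n)
  | tt : IsValue .tt
  | ff : IsValue .ff
  | stc (s) : IsValue (stc s)

theorem IsValue.subst {v : LearnTm K} (h : IsValue v) (σ : ℕ → LearnTm K) : v.subst σ = v := by
  cases h <;> simp [Tm.subst, LBR.stc]

theorem IsValue.rename {v : LearnTm K} (h : IsValue v) (f : ℕ → ℕ) : v.rename f = v := by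
  cases h <;> simp [Tm.rename, LBR.stc]

theorem tokNum_not_mem_stateSet (n : ℕ) (s : State) : tokNum n ∉ stateSet s := by
  rintro ⟨L, -, h⟩
  cases n <;> simp [tokNum, tokZero, tokPred, tokState, Nat.pair_eq_pair] at h

theorem tokTrue_not_mem_numTokens (n : ℕ) : tokTrue ∉ numTokens n ∧ tokFalse ∉ numTokens n := by
  cases n <;> simp [numTokens, tokTrue, tokFalse, tokZero, tokSucc, tokPred, Nat.pair_eq_pair]

theorem tokTrue_not_mem_stateSet (s : State) : tokTrue ∉ stateSet s ∧ tokFalse ∉ stateSet s := by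
  constructor <;> rintro ⟨L, -, h⟩ <;>
    simp [tokTrue, tokFalse, tokState, Nat.pair_eq_pair] at h

/-- Equal values are identical. -/
theorem IsValue.eq_of_conv {v w : LearnTm K} (hv : IsValue v) (hw : IsValue w) (h : LConv v w) :
    v = w := by
  have e := h.sem_eq emptyEnv
  cases hv with
  | num m =>
    cases hw with
    | num n => rw [h.num_inj]
    | tt =>
      exact ((tokTrue_not_mem_numTokens m).1 (by rw [sem_num] at e; exact e.superset rfl)).elim
    | ff =>
      exact ((tokTrue_not_mem_numTokens m).2 (by rw [sem_num] at e; exact e.superset rfl)).elim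
    | stc s =>
      have : tokNum m ∈ stateSet s := by
        rw [sem_num] at e
        exact e.subset (tokNum_mem_numTokens.2 rfl)
      exact (tokNum_not_mem_stateSet m s this).elim
  | tt =>
    cases hw with
    | num n =>
      exact ((tokTrue_not_mem_numTokens n).1 (by rw [sem_num] at e; exact e.subset rfl)).elim
    | tt => rfl
    | ff => exact h.not_tt_ff.elim
    | stc s => exact ((tokTrue_not_mem_stateSet s).1 (e.subset rfl)).elim
  | ff =>
    cases hw with
    | num n =>
      exact ((tokTrue_not_mem_numTokens n).2 (by rw [sem_num] at e; exact e.subset rfl)).elim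
    | tt => exact (LConv.not_tt_ff (Conv.symm h)).elim
    | ff => rfl
    | stc s => exact ((tokTrue_not_mem_stateSet s).2 (e.subset rfl)).elim
  | stc s =>
    cases hw with
    | num n =>
      have : tokNum n ∈ stateSet s := by
        rw [sem_num] at e
        exact e.superset (tokNum_mem_numTokens.2 rfl)
      exact (tokNum_not_mem_stateSet n s this).elim
    | tt => exact ((tokTrue_not_mem_stateSet s).1 (e.superset rfl)).elim
    | ff => exact ((tokTrue_not_mem_stateSet s).2 (e.superset rfl)).elim
    | stc s' => rw [h.stc_inj]

/-- The number of arguments in the rules for a constant other than a fixed point combinator. -/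
def LearnConst.arity : LearnConst K → ℕ
  | .st _ => 0
  | .cup => 2
  | .chi P => P.arity + 1
  | .phi P => P.arity + 1
  | .learn P => P.arity + 2
  | .fix _ _ => 0

/-- The rules other than those for fixed point combinators. -/
def RigidRule (l r : LearnTm K) : Prop :=
  LearnRule K l r ∧ ∀ h U u, l ≠ .app (.const (.fix h U)) u

theorem RigidRule.isValue {l r : LearnTm K} (h : RigidRule l r) : IsValue r := by
  obtain ⟨h, h'⟩ := h
  cases h with
  | chi_true => exact .tt
  | chi_false => exact .ff
  | phi_wit => exact .num _
  | phi_zero => exact .num _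
  | learn_old => exact .stc _
  | learn_new => exact .stc _
  | cup => exact .stc _
  | fix h U u => exact absurd rfl (h' h U u)

/-- Left hand sides are closed and fully applied to values. Hence they are unaffected by
substitution and contain no smaller redex, which rules out critical overlaps. -/
theorem RigidRule.eq_appList {l r : LearnTm K} (h : RigidRule l r) :
    ∃ c args, l = Tm.appList (.const c) args ∧ args.length = c.arity ∧ 0 < c.arity ∧
      ∀ a ∈ args, IsValue a := by
  have key : ∀ (s : State) (ns : List ℕ), ∀ a ∈ stc s :: ns.map (Tm.num : ℕ → LearnTm K),
      IsValue a := by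
    intro s ns a ha
    simp only [List.mem_cons, List.mem_map] at ha
    rcases ha with rfl | ⟨n, -, rfl⟩
    · exact .stc s
    · exact .num n
  obtain ⟨h, h'⟩ := h
  cases h with
  | chi_true s P ns hns => exact ⟨.chi P, _, rfl, by simp [hns, LearnConst.arity], by simp [LearnConst.arity], key s ns⟩
  | chi_false s P ns hns => exact ⟨.chi P, _, rfl, by simp [hns, LearnConst.arity], by simp [LearnConst.arity], key s ns⟩
  | phi_wit s a => exact ⟨.phi a.pred, _, rfl, by simp [a.length_args, LearnConst.arity], by simp [LearnConst.arity], key s _⟩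
  | phi_zero s P ns hns => exact ⟨.phi P, _, rfl, by simp [hns, LearnConst.arity], by simp [LearnConst.arity], key s ns⟩
  | learn_old s P ns m hns => exact ⟨.learn P, _, rfl, by simp [hns, LearnConst.arity], by simp [LearnConst.arity], key s _⟩
  | learn_new s a => exact ⟨.learn a.pred, _, rfl, by simp [a.length_args, LearnConst.arity], by simp [LearnConst.arity], key s _⟩
  | cup s₁ s₂ =>
    refine ⟨.cup, [stc s₁, stc s₂], rfl, rfl, by simp [LearnConst.arity], ?_⟩
    simp only [List.mem_cons, List.not_mem_nil, or_false]
    rintro a (rfl | rfl) <;> exact .stc _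
  | fix h U u => exact absurd rfl (h' h U u)

theorem RigidRule.head {l r : LearnTm K} (h : RigidRule l r) :
    ∃ c, l.head = .const c ∧ l.numArgs = c.arity ∧ 0 < c.arity := by
  obtain ⟨c, args, rfl, h₁, h₂, -⟩ := h.eq_appList
  exact ⟨c, by simp [Tm.head], by simp [Tm.numArgs, h₁], h₂⟩

/-- Both results are values convertible through the common left hand side, and the model identifies
convertible values; the rules need not be compared pair by pair. -/
theorem RigidRule.unique {l r r' : LearnTm K} (h : RigidRule l r) (h' : RigidRule l r') :
    r = r' :=
  h.isValue.eq_of_conv h'.isValue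
    ((Conv.of_red (.rule h.1)).symm.trans (.of_red (.rule h'.1)))

theorem appList_values_subst {c : LearnConst K} {args : List (LearnTm K)}
    (h : ∀ a ∈ args, IsValue a) (σ : ℕ → LearnTm K) :
    (Tm.appList (.const c) args).subst σ = Tm.appList (.const c) args := by
  rw [Tm.subst_appList, List.map_congr_left (g := id) (fun a ha => (h a ha).subst σ), List.map_id]
  rfl

theorem appList_values_rename {c : LearnConst K} {args : List (LearnTm K)}
    (h : ∀ a ∈ args, IsValue a) (f : ℕ → ℕ) :
    (Tm.appList (.const c) args).rename f = Tm.appList (.const c) args := by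
  induction args using List.reverseRecOn with
  | nil => rfl
  | append_singleton args a ih =>
    simp only [List.mem_append, List.mem_singleton] at h
    rw [Tm.appList_concat, Tm.rename, ih fun b hb => h b (.inl hb), (h a (.inr rfl)).rename]

/-- Parallel reduction. -/
inductive Par : LearnTm K → LearnTm K → Prop
  | var (i) : Par (.var i) (.var i)
  | zero : Par .zero .zero
  | succ {t t'} : Par t t' → Par (.succ t) (.succ t')
  | tt : Par .tt .tt
  | ff : Par .ff .ff
  | cond (T) : Par (.cond T) (.cond T)
  | prec (T) : Par (.prec T) (.prec T)
  | app {t t' u u'} : Par t t' → Par u u' → Par (.app t u) (.app t' u')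
  | pair {t t' u u'} : Par t t' → Par u u' → Par (.pair t u) (.pair t' u')
  | fst {t t'} : Par t t' → Par (.fst t) (.fst t')
  | snd {t t'} : Par t t' → Par (.snd t) (.snd t')
  | lam (T) {t t'} : Par t t' → Par (.lam T t) (.lam T t')
  | const (c) : Par (.const c) (.const c)
  | beta (T) {t t' u u'} : Par t t' → Par u u' →
      Par (.app (.lam T t) u) (t'.subst (Tm.single u'))
  | fst_pair {t t'} (u) : Par t t' → Par (.fst (.pair t u)) t'
  | snd_pair (t) {u u'} : Par u u' → Par (.snd (.pair t u)) u'
  | prec_zero (T) {u u'} (v) : Par u u' → Par (.app (.app (.app (.prec T) u) v) .zero) u'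
  | prec_succ (T) {u u' v v' t t'} : Par u u' → Par v v' → Par t t' →
      Par (.app (.app (.app (.prec T) u) v) (.succ t))
        (.app (.app v' t') (.app (.app (.app (.prec T) u') v') t'))
  | cond_tt (T) {u u'} (v) : Par u u' → Par (.app (.app (.app (.cond T) .tt) u) v) u'
  | cond_ff (T u) {v v'} : Par v v' → Par (.app (.app (.app (.cond T) .ff) u) v) v'
  | rule {l r} : RigidRule l r → Par l r
  | fix (h : K = Calculus.PCF) (U) {u u'} : Par u u' →
      Par (.app (.const (.fix h U)) u) (.app u' (.app (.const (.fix h U)) u'))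

theorem Par.refl (t : LearnTm K) : Par t t := by
  induction t with
  | var i => exact .var i
  | zero => exact .zero
  | succ _ ih => exact .succ ih
  | tt => exact .tt
  | ff => exact .ff
  | cond T => exact .cond T
  | prec T => exact .prec T
  | app _ _ ih ih' => exact .app ih ih'
  | pair _ _ ih ih' => exact .pair ih ih'
  | fst _ ih => exact .fst ih
  | snd _ ih => exact .snd ih
  | lam T _ ih => exact .lam T ih
  | const c => exact .const c

theorem Red.par {t t' : LearnTm K} (h : Red (LearnRule K) t t') : Par t t' := by
  induction h with
  | beta T t u => exact .beta T (.refl t) (.refl u)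
  | fst_pair t u => exact .fst_pair u (.refl t)
  | snd_pair t u => exact .snd_pair t (.refl u)
  | prec_zero T u v => exact .prec_zero T v (.refl u)
  | prec_succ T u v t => exact .prec_succ T (.refl u) (.refl v) (.refl t)
  | cond_tt T u v => exact .cond_tt T v (.refl u)
  | cond_ff T u v => exact .cond_ff T u (.refl v)
  | @rule t t' h =>
    by_cases hf : ∃ h U u, t = .app (.const (.fix h U)) u
    · obtain ⟨h', U, u, rfl⟩ := hf
      generalize e : Tm.app (.const (.fix h' U)) u = l at h
      cases h with
      | fix h U u' =>
        cases e
        exact .fix _ _ (.refl _)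
      | cup => simp at e
      | _ => simpa [Tm.appNums, Tm.head] using congrArg Tm.head e
    · exact .rule ⟨h, by simpa using hf⟩
  | succ _ ih => exact .succ ih
  | app_left u _ ih => exact .app ih (.refl u)
  | app_right t _ ih => exact .app (.refl t) ih
  | pair_left u _ ih => exact .pair ih (.refl u)
  | pair_right t _ ih => exact .pair (.refl t) ih
  | fst _ ih => exact .fst ih
  | snd _ ih => exact .snd ih
  | lam T _ ih => exact .lam T ih

/-- Reduction in any number of steps. -/
abbrev Reds : LearnTm K → LearnTm K → Prop := Relation.ReflTransGen (Red (LearnRule K))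

theorem Reds.map {f : LearnTm K → LearnTm K}
    (hf : ∀ t u, Red (LearnRule K) t u → Red (LearnRule K) (f t) (f u)) {t u : LearnTm K}
    (h : Reds t u) : Reds (f t) (f u) := h.lift f hf

theorem Reds.app {t t' u u' : LearnTm K} (h : Reds t t') (h' : Reds u u') :
    Reds (.app t u) (.app t' u') :=
  (h.map fun _ _ => Red.app_left u).trans (h'.map fun _ _ => Red.app_right t')

theorem Par.reds {t t' : LearnTm K} (h : Par t t') : Reds t t' := by
  have single : ∀ {t t' : LearnTm K}, Red (LearnRule K) t t' → Reds t t' :=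
    fun h => Relation.ReflTransGen.single h
  induction h with
  | var | zero | tt | ff | cond | prec | const => exact .refl
  | succ _ ih => exact ih.map fun _ _ => .succ
  | app _ _ ih ih' => exact ih.app ih'
  | @pair t t' u u' _ _ ih ih' =>
    exact (ih.map fun _ _ => Red.pair_left u).trans (ih'.map fun _ _ => Red.pair_right t')
  | fst _ ih => exact ih.map fun _ _ => .fst
  | snd _ ih => exact ih.map fun _ _ => .snd
  | lam T _ ih => exact ih.map fun _ _ => .lam T
  | beta T _ _ ih ih' =>
    exact (Reds.app (ih.map fun _ _ => .lam T) ih').trans (single (.beta _ _ _))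
  | fst_pair u _ ih => exact (single (.fst_pair _ _)).trans ih
  | snd_pair t _ ih => exact (single (.snd_pair _ _)).trans ih
  | prec_zero T v _ ih => exact (single (.prec_zero _ _ _)).trans ih
  | prec_succ T _ _ _ ih ih' ih'' =>
    exact (single (.prec_succ _ _ _ _)).trans
      ((ih'.app ih'').app (((Reds.app .refl ih).app ih').app ih''))
  | cond_tt T v _ ih => exact (single (.cond_tt _ _ _)).trans ih
  | cond_ff T u _ ih => exact (single (.cond_ff _ _ _)).trans ih
  | rule h => exact single (.rule h.1)
  | fix h U _ ih =>
    exact (single (.rule (.fix h U _))).trans (ih.app (Reds.app .refl ih))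

theorem Par.rename {t t' : LearnTm K} (h : Par t t') (f : ℕ → ℕ) :
    Par (t.rename f) (t'.rename f) := by
  induction h generalizing f with
  | var | zero | tt | ff | cond | prec | const => exact .refl _
  | succ _ ih => exact .succ (ih f)
  | app _ _ ih ih' => exact .app (ih f) (ih' f)
  | pair _ _ ih ih' => exact .pair (ih f) (ih' f)
  | fst _ ih => exact .fst (ih f)
  | snd _ ih => exact .snd (ih f)
  | lam T _ ih => exact .lam T (ih _)
  | @beta T t t' u u' _ _ ih ih' =>
    have e : (t'.subst (Tm.single u')).rename f =
        (t'.rename (Tm.upr f)).subst (Tm.single (u'.rename f)) := by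
      rw [Tm.rename_subst, Tm.subst_rename]
      congr 1
      funext i
      cases i <;> rfl
    rw [e]
    exact .beta T (ih _) (ih' _)
  | fst_pair u _ ih => exact .fst_pair _ (ih f)
  | snd_pair t _ ih => exact .snd_pair _ (ih f)
  | prec_zero T v _ ih => exact .prec_zero T _ (ih f)
  | prec_succ T _ _ _ ih ih' ih'' => exact .prec_succ T (ih f) (ih' f) (ih'' f)
  | cond_tt T v _ ih => exact .cond_tt T _ (ih f)
  | cond_ff T u _ ih => exact .cond_ff T _ (ih f)
  | rule h =>
    obtain ⟨c, args, e, -, -, ha⟩ := h.eq_appList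
    rw [h.isValue.rename]
    subst e
    rw [appList_values_rename ha]
    exact .rule h
  | fix h U _ ih => exact .fix h U (ih f)

theorem Par.up {σ σ' : ℕ → LearnTm K} (h : ∀ i, Par (σ i) (σ' i)) (i : ℕ) :
    Par (Tm.up σ i) (Tm.up σ' i) := by
  cases i with
  | zero => exact .var 0
  | succ i => exact (h i).rename _

theorem Par.subst {t t' : LearnTm K} (h : Par t t') {σ σ' : ℕ → LearnTm K}
    (hσ : ∀ i, Par (σ i) (σ' i)) : Par (t.subst σ) (t'.subst σ') := by
  induction h generalizing σ σ' with
  | var i => exact hσ i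
  | zero | tt | ff | cond | prec | const => exact .refl _
  | succ _ ih => exact .succ (ih hσ)
  | app _ _ ih ih' => exact .app (ih hσ) (ih' hσ)
  | pair _ _ ih ih' => exact .pair (ih hσ) (ih' hσ)
  | fst _ ih => exact .fst (ih hσ)
  | snd _ ih => exact .snd (ih hσ)
  | lam T _ ih => exact .lam T (ih (Par.up hσ))
  | beta T _ _ ih ih' =>
    rw [Tm.subst_single_subst]
    exact .beta T (ih (Par.up hσ)) (ih' hσ)
  | fst_pair u _ ih => exact .fst_pair _ (ih hσ)
  | snd_pair t _ ih => exact .snd_pair _ (ih hσ)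
  | prec_zero T v _ ih => exact .prec_zero T _ (ih hσ)
  | prec_succ T _ _ _ ih ih' ih'' => exact .prec_succ T (ih hσ) (ih' hσ) (ih'' hσ)
  | cond_tt T v _ ih => exact .cond_tt T _ (ih hσ)
  | cond_ff T u _ ih => exact .cond_ff T _ (ih hσ)
  | rule h =>
    obtain ⟨c, args, e, -, -, ha⟩ := h.eq_appList
    rw [h.isValue.subst]
    subst e
    rw [appList_values_subst ha]
    exact .rule h
  | fix h U _ ih => exact .fix h U (ih hσ)

theorem Par.subst_single {t t' u u' : LearnTm K} (h : Par t t') (h' : Par u u') :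
    Par (t.subst (Tm.single u)) (t'.subst (Tm.single u')) := by
  refine h.subst ?_
  rintro (_ | i)
  · exact h'
  · exact .var i

/-! #### Inversion of parallel reduction -/

/-- A term that is not an application of a constant is not the left hand side of a rule. -/
theorem RigidRule.false_of_head {l r : LearnTm K} (h : RigidRule l r)
    (hl : ∀ c, l.head ≠ .const c) : False := by
  obtain ⟨c, hc, -⟩ := h.head
  exact hl c hc

theorem Par.eq_of_isValue {v x : LearnTm K} (hv : IsValue v) (h : Par v x) : x = v := by
  cases hv with
  | num n =>
    induction n generalizing x with
    | zero =>
      cases h with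
      | zero => rfl
      | rule h => exact (h.false_of_head (by simp [Tm.num, Tm.head])).elim
    | succ n ih =>
      cases h with
      | succ h => rw [ih h]; rfl
      | rule h => exact (h.false_of_head (by simp [Tm.num, Tm.head])).elim
  | tt =>
    cases h with
    | tt => rfl
    | rule h => exact (h.false_of_head (by simp [Tm.head])).elim
  | ff =>
    cases h with
    | ff => rfl
    | rule h => exact (h.false_of_head (by simp [Tm.head])).elim
  | stc s =>
    cases h with
    | const => rfl
    | rule h =>
      obtain ⟨c, h₁, h₂, h₃⟩ := h.head
      simp only [stc, Tm.numArgs] at h₂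
      omega

theorem Par.lam_inv {T : Ty} {t x : LearnTm K} (h : Par (.lam T t) x) :
    ∃ t', x = .lam T t' ∧ Par t t' := by
  cases h with
  | lam _ h => exact ⟨_, rfl, h⟩
  | rule h => exact (h.false_of_head (by simp [Tm.head])).elim

theorem Par.pair_inv {t u x : LearnTm K} (h : Par (.pair t u) x) :
    ∃ t' u', x = .pair t' u' ∧ Par t t' ∧ Par u u' := by
  cases h with
  | pair h h' => exact ⟨_, _, rfl, h, h'⟩
  | rule h => exact (h.false_of_head (by simp [Tm.head])).elim

theorem Par.succ_inv {t x : LearnTm K} (h : Par (.succ t) x) : ∃ t', x = .succ t' ∧ Par t t' := by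
  cases h with
  | succ h => exact ⟨_, rfl, h⟩
  | rule h => exact (h.false_of_head (by simp [Tm.head])).elim

theorem Par.app_prec_inv {T : Ty} {t u x : LearnTm K} (h : Par (.app (.app (.prec T) t) u) x) :
    ∃ t' u', x = .app (.app (.prec T) t') u' ∧ Par t t' ∧ Par u u' := by
  cases h with
  | app h h' =>
    cases h with
    | app h h'' =>
      cases h with
      | prec => exact ⟨_, _, rfl, h'', h'⟩
      | rule h => exact (h.false_of_head (by simp [Tm.head])).elim
    | rule h => exact (h.false_of_head (by simp [Tm.head])).elim
  | rule h => exact (h.false_of_head (by simp [Tm.head])).elim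

theorem Par.app_cond_inv {T : Ty} {t u x : LearnTm K} (h : Par (.app (.app (.cond T) t) u) x) :
    ∃ t' u', x = .app (.app (.cond T) t') u' ∧ Par t t' ∧ Par u u' := by
  cases h with
  | app h h' =>
    cases h with
    | app h h'' =>
      cases h with
      | cond => exact ⟨_, _, rfl, h'', h'⟩
      | rule h => exact (h.false_of_head (by simp [Tm.head])).elim
    | rule h => exact (h.false_of_head (by simp [Tm.head])).elim
  | rule h => exact (h.false_of_head (by simp [Tm.head])).elim

theorem Par.const_inv {c : LearnConst K} {x : LearnTm K} (h : Par (.const c) x) :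
    x = .const c := by
  cases h with
  | const => rfl
  | rule h =>
    obtain ⟨c', -, h₂, h₃⟩ := h.head
    simp only [Tm.numArgs] at h₂
    omega

/-- A constant with too few arguments for its rules, all of them values, cannot move. Fixed point
combinators are excluded because their `arity` is set to 0. -/
theorem Par.appList_inv {c : LearnConst K} {args : List (LearnTm K)} {x : LearnTm K}
    (ha : ∀ a ∈ args, IsValue a) (hc : args.length < c.arity)
    (h : Par (Tm.appList (.const c) args) x) : x = Tm.appList (.const c) args := by
  induction args using List.reverseRecOn generalizing x with
  | nil => exact h.const_inv
  | append_singleton args a ih =>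
    simp only [List.mem_append, List.mem_singleton] at ha
    have hc' : args.length < c.arity := by simp at hc; omega
    rw [Tm.appList_concat] at h ⊢
    generalize e : Tm.appList (.const c) args = t at h
    have e₁ := congrArg Tm.head e
    have e₂ := congrArg Tm.numArgs e
    simp only [Tm.head_appList, Tm.numArgs_appList] at e₁ e₂
    cases h with
    | app h h' =>
      subst e
      rw [ih (fun b hb => ha b (.inl hb)) hc' h, Par.eq_of_isValue (ha a (.inr rfl)) h']
    | rule h =>
      obtain ⟨c', h₁, h₂, h₃⟩ := h.head
      rw [Tm.head, ← e₁] at h₁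
      rw [Tm.numArgs, ← e₂] at h₂
      cases h₁
      simp [Tm.numArgs] at h₂ hc
      omega
    | fix h U h' =>
      simp only [Tm.head, Tm.const.injEq] at e₁
      subst e₁
      simp [LearnConst.arity] at hc
    | _ => simp [Tm.head] at e₁

/-- Every term has a complete development. -/
theorem Par.exists_development (t : LearnTm K) : ∃ c, ∀ t', Par t t' → Par t' c := by
  induction t with
  | var i =>
    refine ⟨.var i, fun t' h => ?_⟩
    cases h with
    | var => exact .var i
    | rule h => exact (h.false_of_head (by simp [Tm.head])).elim
  | zero => exact ⟨.zero, fun t' h => Par.eq_of_isValue (.num 0) h ▸ .zero⟩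
  | succ t ih =>
    obtain ⟨c, hc⟩ := ih
    refine ⟨.succ c, fun t' h => ?_⟩
    obtain ⟨t', rfl, h₁⟩ := h.succ_inv
    exact .succ (hc _ h₁)
  | tt => exact ⟨.tt, fun t' h => Par.eq_of_isValue .tt h ▸ .tt⟩
  | ff => exact ⟨.ff, fun t' h => Par.eq_of_isValue .ff h ▸ .ff⟩
  | cond T =>
    refine ⟨.cond T, fun t' h => ?_⟩
    cases h with
    | cond => exact .cond T
    | rule h => exact (h.false_of_head (by simp [Tm.head])).elim
  | prec T =>
    refine ⟨.prec T, fun t' h => ?_⟩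
    cases h with
    | prec => exact .prec T
    | rule h => exact (h.false_of_head (by simp [Tm.head])).elim
  | const c => exact ⟨.const c, fun t' h => h.const_inv ▸ .const c⟩
  | pair t u iht ihu =>
    obtain ⟨c, hc⟩ := iht
    obtain ⟨d, hd⟩ := ihu
    refine ⟨.pair c d, fun t' h => ?_⟩
    obtain ⟨t', u', rfl, h, h'⟩ := h.pair_inv
    exact .pair (hc _ h) (hd _ h')
  | lam T t ih =>
    obtain ⟨c, hc⟩ := ih
    refine ⟨.lam T c, fun t' h => ?_⟩
    obtain ⟨t', rfl, h₁⟩ := h.lam_inv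
    exact .lam T (hc _ h₁)
  | fst t ih =>
    obtain ⟨c, hc⟩ := ih
    by_cases hp : ∃ a b, t = .pair a b
    · obtain ⟨a, b, rfl⟩ := hp
      obtain ⟨ca, cb, rfl, -, -⟩ := (hc _ (.refl _)).pair_inv
      refine ⟨ca, fun t' h => ?_⟩
      cases h with
      | fst h =>
        obtain ⟨a', b', rfl, -, -⟩ := h.pair_inv
        obtain ⟨_, _, e, h₁, h₂⟩ := (hc _ h).pair_inv
        cases e
        exact .fst_pair _ h₁
      | fst_pair _ h =>
        obtain ⟨_, _, e, h₁, h₂⟩ := (hc _ (.pair h (.refl _))).pair_inv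
        cases e
        exact h₁
      | rule h => exact (h.false_of_head (by simp [Tm.head])).elim
    · refine ⟨.fst c, fun t' h => ?_⟩
      cases h with
      | fst h => exact .fst (hc _ h)
      | fst_pair => simp at hp
      | rule h => exact (h.false_of_head (by simp [Tm.head])).elim
  | snd t ih =>
    obtain ⟨c, hc⟩ := ih
    by_cases hp : ∃ a b, t = .pair a b
    · obtain ⟨a, b, rfl⟩ := hp
      obtain ⟨ca, cb, rfl, -, -⟩ := (hc _ (.refl _)).pair_inv
      refine ⟨cb, fun t' h => ?_⟩
      cases h with
      | snd h =>
        obtain ⟨a', b', rfl, -, -⟩ := h.pair_inv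
        obtain ⟨_, _, e, h₁, h₂⟩ := (hc _ h).pair_inv
        cases e
        exact .snd_pair _ h₂
      | snd_pair _ h =>
        obtain ⟨_, _, e, h₁, h₂⟩ := (hc _ (.pair (.refl _) h)).pair_inv
        cases e
        exact h₂
      | rule h => exact (h.false_of_head (by simp [Tm.head])).elim
    · refine ⟨.snd c, fun t' h => ?_⟩
      cases h with
      | snd h => exact .snd (hc _ h)
      | snd_pair => simp at hp
      | rule h => exact (h.false_of_head (by simp [Tm.head])).elim
  | app t u iht ihu =>
    obtain ⟨c, hc⟩ := iht
    obtain ⟨d, hd⟩ := ihu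
    -- The development contracts a root redex whenever there is one. For a rigid redex nothing can
    -- happen inside, so its unique result is the development.
    by_cases hr : ∃ r, RigidRule (.app t u) r
    · obtain ⟨r, hr⟩ := hr
      refine ⟨r, fun x h => ?_⟩
      obtain ⟨k, hk, hk', -⟩ := hr.head
      cases h with
      | rule h => exact hr.unique h ▸ .refl _
      | app h h' =>
        obtain ⟨c, args, e, hl, hp, ha⟩ := hr.eq_appList
        obtain ⟨args, a, rfl⟩ : ∃ as a, args = as ++ [a] := by
          rcases List.eq_nil_or_concat args with rfl | ⟨as, a, rfl⟩
          · simp at hl; omega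
          · exact ⟨as, a, by simp⟩
        rw [Tm.appList_concat, Tm.app.injEq] at e
        obtain ⟨rfl, rfl⟩ := e
        simp only [List.mem_append, List.mem_singleton] at ha
        rw [Par.appList_inv (fun b hb => ha b (.inl hb)) (by simp at hl; omega) h,
          Par.eq_of_isValue (ha _ (.inr rfl)) h']
        exact .rule hr
      | fix h U h' =>
        simp only [Tm.head, Tm.const.injEq] at hk
        subst hk
        simp [Tm.numArgs, LearnConst.arity] at hk'
      | _ => simp [Tm.head] at hk
    push Not at hr
    by_cases hlam : ∃ T b, t = .lam T b
    · obtain ⟨T, b, rfl⟩ := hlam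
      obtain ⟨cb, rfl, -⟩ := (hc _ (.refl _)).lam_inv
      refine ⟨cb.subst (Tm.single d), fun x h => ?_⟩
      cases h with
      | app h h' =>
        obtain ⟨b', rfl, -⟩ := h.lam_inv
        obtain ⟨_, e, h₁⟩ := (hc _ h).lam_inv
        cases e
        exact .beta T h₁ (hd _ h')
      | beta _ h h' =>
        obtain ⟨_, e, h₁⟩ := (hc _ (.lam T h)).lam_inv
        cases e
        exact h₁.subst_single (hd _ h')
      | rule h => exact (hr _ h).elim
    by_cases hfix : ∃ h U, t = .const (.fix h U)
    · obtain ⟨hK, U, rfl⟩ := hfix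
      refine ⟨.app d (.app (.const (.fix hK U)) d), fun x h => ?_⟩
      cases h with
      | app h h' =>
        rw [h.const_inv]
        exact .fix _ _ (hd _ h')
      | fix _ _ h => exact .app (hd _ h) (.app (.const _) (hd _ h))
      | rule h => exact (hr _ h).elim
    by_cases hprec : ∃ T a b, t = .app (.app (.prec T) a) b
    · obtain ⟨T, a, b, rfl⟩ := hprec
      obtain ⟨ca, cb, rfl, -, -⟩ := (hc _ (.refl _)).app_prec_inv
      -- The induction hypothesis concerns the partial application as a whole; as such a term keeps
      -- its shape, it splits into developments of the two arguments.
      have inv : ∀ {a' b'}, Par a a' → Par b b' → Par a' ca ∧ Par b' cb := by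
        intro a' b' h h'
        obtain ⟨_, _, e, h₁, h₂⟩ := (hc _ (.app (.app (.prec T) h) h')).app_prec_inv
        cases e
        exact ⟨h₁, h₂⟩
      by_cases hu : u = .zero
      · subst hu
        refine ⟨ca, fun x h => ?_⟩
        cases h with
        | app h h' =>
          obtain ⟨a', b', rfl, h₁, h₂⟩ := h.app_prec_inv
          rw [Par.eq_of_isValue (.num 0) h']
          exact .prec_zero T _ (inv h₁ h₂).1
        | prec_zero _ _ h => exact (inv h (.refl _)).1
        | rule h => exact (hr _ h).elim
      by_cases hu' : ∃ w, u = .succ w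
      · obtain ⟨w, rfl⟩ := hu'
        obtain ⟨cw, rfl, -⟩ := (hd _ (.refl _)).succ_inv
        have inv' : ∀ {w'}, Par w w' → Par w' cw := by
          intro w' h
          obtain ⟨_, e, h₁⟩ := (hd _ (.succ h)).succ_inv
          cases e
          exact h₁
        refine ⟨.app (.app cb cw) (.app (.app (.app (.prec T) ca) cb) cw), fun x h => ?_⟩
        cases h with
        | app h h' =>
          obtain ⟨a', b', rfl, h₁, h₂⟩ := h.app_prec_inv
          obtain ⟨w', rfl, h₃⟩ := h'.succ_inv
          exact .prec_succ T (inv h₁ h₂).1 (inv h₁ h₂).2 (inv' h₃)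
        | prec_succ _ h₁ h₂ h₃ =>
          exact .app (.app (inv h₁ h₂).2 (inv' h₃))
            (.app (.app (.app (.prec T) (inv h₁ h₂).1) (inv h₁ h₂).2) (inv' h₃))
        | rule h => exact (hr _ h).elim
      · refine ⟨.app (.app (.app (.prec T) ca) cb) d, fun x h => ?_⟩
        cases h with
        | app h h' => exact .app (hc _ h) (hd _ h')
        | prec_zero => simp at hu
        | prec_succ => simp at hu'
        | rule h => exact (hr _ h).elim
    by_cases hcond : ∃ T a b, t = .app (.app (.cond T) a) b
    · obtain ⟨T, a, b, rfl⟩ := hcond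
      obtain ⟨ca, cb, rfl, -, -⟩ := (hc _ (.refl _)).app_cond_inv
      have inv : ∀ {a' b'}, Par a a' → Par b b' → Par a' ca ∧ Par b' cb := by
        intro a' b' h h'
        obtain ⟨_, _, e, h₁, h₂⟩ := (hc _ (.app (.app (.cond T) h) h')).app_cond_inv
        cases e
        exact ⟨h₁, h₂⟩
      by_cases ha : a = .tt
      · subst ha
        refine ⟨cb, fun x h => ?_⟩
        cases h with
        | app h h' =>
          obtain ⟨a', b', rfl, h₁, h₂⟩ := h.app_cond_inv
          rw [Par.eq_of_isValue .tt h₁]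
          exact .cond_tt T _ (inv h₁ h₂).2
        | cond_tt _ _ h => exact (inv (.refl _) h).2
        | rule h => exact (hr _ h).elim
      by_cases ha' : a = .ff
      · subst ha'
        refine ⟨d, fun x h => ?_⟩
        cases h with
        | app h h' =>
          obtain ⟨a', b', rfl, h₁, h₂⟩ := h.app_cond_inv
          rw [Par.eq_of_isValue .ff h₁]
          exact .cond_ff T _ (hd _ h')
        | cond_ff _ _ h => exact hd _ h
        | rule h => exact (hr _ h).elim
      · refine ⟨.app (.app (.app (.cond T) ca) cb) d, fun x h => ?_⟩
        cases h with
        | app h h' => exact .app (hc _ h) (hd _ h')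
        | cond_tt => simp at ha
        | cond_ff => simp at ha'
        | rule h => exact (hr _ h).elim
    · refine ⟨.app c d, fun x h => ?_⟩
      cases h with
      | app h h' => exact .app (hc _ h) (hd _ h')
      | beta => simp at hlam
      | prec_zero => simp at hprec
      | prec_succ => simp at hprec
      | cond_tt => simp at hcond
      | cond_ff => simp at hcond
      | fix => exact (hfix ⟨_, _, rfl⟩).elim
      | rule h => exact (hr _ h).elim

/-- Two parallel steps from a term meet in its complete development, so parallel reduction has the
diamond property; it lies between one-step and many-step reduction. -/
theorem Reds.confluent {t u v : LearnTm K} (h : Reds t u) (h' : Reds t v) :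
    ∃ w, Reds u w ∧ Reds v w := by
  have hpar : ∀ {t u : LearnTm K}, Reds t u → Relation.ReflTransGen Par t u :=
    fun h => h.lift id fun _ _ => Red.par
  have hreds : ∀ {t u : LearnTm K}, Relation.ReflTransGen Par t u → Reds t u := by
    intro t u h
    induction h with
    | refl => exact .refl
    | tail _ h ih => exact ih.trans h.reds
  obtain ⟨w, hw, hw'⟩ := Relation.church_rosser (r := Par) (fun a b c hb hc => by
    obtain ⟨d, hd⟩ := Par.exists_development a
    exact ⟨d, .single (hd _ hb), .single (hd _ hc)⟩) (hpar h) (hpar h')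
  exact ⟨w, hreds hw, hreds hw'⟩

theorem LConv.join {t u : LearnTm K} (h : LConv t u) : ∃ w, Reds t w ∧ Reds u w := by
  induction h with
  | rel _ _ h => exact ⟨_, .single h, .refl⟩
  | refl => exact ⟨_, .refl, .refl⟩
  | symm _ _ _ ih => exact ih.imp fun w h => h.symm
  | trans _ _ _ _ _ ih ih' =>
    obtain ⟨w, h₁, h₂⟩ := ih
    obtain ⟨w', h₁', h₂'⟩ := ih'
    obtain ⟨z, hz, hz'⟩ := h₂.confluent h₁'
    exact ⟨z, h₁.trans hz, h₂'.trans hz'⟩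

theorem Normal.eq_of_reds {t u : LearnTm K} (h : Normal (LearnRule K) t) (h' : Reds t u) :
    u = t := by
  rcases h'.cases_head with rfl | ⟨v, hv, -⟩
  · rfl
  · exact (h v hv).elim

/-- Invariants of reduction, such as types and freshness, do not transfer along equations; this
makes them applicable to the value of a term. -/
theorem LConv.reds_of_normal {t v : LearnTm K} (h : LConv t v) (hv : Normal (LearnRule K) v) :
    Reds t v := by
  obtain ⟨w, h₁, h₂⟩ := h.join
  rwa [hv.eq_of_reds h₂] at h₁

theorem IsValue.normal {v : LearnTm K} (h : IsValue v) : Normal (LearnRule K) v := by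
  intro w hw
  cases h with
  | num n =>
    induction n generalizing w with
    | zero =>
      generalize e : (Tm.num 0 : LearnTm K) = t at hw
      cases hw with
      | rule h =>
        subst e
        exact RigidRule.false_of_head ⟨h, by simp [Tm.num]⟩ (by simp [Tm.num, Tm.head])
      | _ => simp [Tm.num] at e
    | succ n ih =>
      cases hw with
      | succ h => exact ih _ h
      | rule h =>
        exact RigidRule.false_of_head ⟨h, by simp [Tm.num]⟩ (by simp [Tm.num, Tm.head])
  | tt =>
    cases hw with
    | rule h => exact RigidRule.false_of_head ⟨h, by simp⟩ (by simp [Tm.head])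
  | ff =>
    cases hw with
    | rule h => exact RigidRule.false_of_head ⟨h, by simp⟩ (by simp [Tm.head])
  | stc s =>
    cases hw with
    | rule h =>
      obtain ⟨c, h₁, h₂, h₃⟩ := RigidRule.head ⟨h, by simp [LBR.stc]⟩
      simp only [LBR.stc, Tm.numArgs] at h₂
      omega

end Confluence

/-! ### Canonical forms -/

section Canonical

variable {K : Calculus}

def LearnConst.type : LearnConst K → Ty
  | .st _ => .state
  | .cup => .arr .state (.arr .state .state)
  | .chi P => .arr .state (Ty.natArrow P.arity .bool)
  | .phi P => .arr .state (Ty.natArrow P.arity .nat)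
  | .learn P => .arr .state (Ty.natArrow (P.arity + 1) .state)
  | .fix _ U => .arr (.arr U U) U

theorem HasType.approx {Γ : List Ty} {t : ClassTm K} {T : Ty}
    (h : HasType ClassConst.type Γ t T) (s : State) :
    HasType LearnConst.type Γ (approx s t) T := by
  have hs : ∀ Γ s, HasType (LearnConst.type (K := K)) Γ (stc s) .state :=
    fun Γ s => .const (LearnConst.st s)
  refine h.replaceConst fun c Γ => ?_
  cases c with
  | st s' => exact hs Γ s'
  | cup => exact .const LearnConst.cup
  | oracle P => exact .app (.const (LearnConst.chi P)) (hs Γ s)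
  | skolem P => exact .app (.const (LearnConst.phi P)) (hs Γ s)
  | adder P => exact .app (.const (LearnConst.learn P)) (hs Γ s)
  | fix h U => exact .const (LearnConst.fix h U)

/-- Reduction preserves types. -/
theorem HasType.red {Γ : List Ty} {t t' : LearnTm K} {T : Ty}
    (h : HasType LearnConst.type Γ t T) (h' : Red (LearnRule K) t t') :
    HasType LearnConst.type Γ t' T := by
  have hs : ∀ Γ s, HasType (LearnConst.type (K := K)) Γ (stc s) .state :=
    fun Γ s => .const (LearnConst.st s)
  induction h' generalizing Γ T with
  | beta U t u =>
    cases h with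
    | app h h' =>
      cases h with
      | lam _ h => exact h.subst_single h'
  | fst_pair t u =>
    cases h with
    | fst h =>
      cases h with
      | pair h _ => exact h
  | snd_pair t u =>
    cases h with
    | snd h =>
      cases h with
      | pair _ h => exact h
  | prec_zero U u v =>
    cases h with
    | app h _ =>
      cases h with
      | app h _ =>
        cases h with
        | app h h' =>
          cases h
          exact h'
  | prec_succ U u v t =>
    cases h with
    | app h h₃ =>
      cases h with
      | app h h₂ =>
        cases h with
        | app h h₁ =>
          cases h
          cases h₃ with
          | succ h₃ =>
            exact .app (.app h₂ h₃) (.app (.app (.app (.prec U) h₁) h₂) h₃)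
  | cond_tt U u v =>
    cases h with
    | app h _ =>
      cases h with
      | app h h' =>
        cases h with
        | app h _ =>
          cases h
          exact h'
  | cond_ff U u v =>
    cases h with
    | app h h' =>
      cases h with
      | app h _ =>
        cases h with
        | app h _ =>
          cases h
          exact h'
  | rule hr =>
    cases hr with
    | chi_true s P ns hns =>
      rw [h.unique (.appNums (T := .bool) (by rw [hns]; exact .app (.const (LearnConst.chi P)) (hs Γ s)))]
      exact .tt
    | chi_false s P ns hns =>
      rw [h.unique (.appNums (T := .bool) (by rw [hns]; exact .app (.const (LearnConst.chi P)) (hs Γ s)))]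
      exact .ff
    | phi_wit s a =>
      rw [h.unique (.appNums (T := .nat)
        (by rw [a.length_args]; exact .app (.const (LearnConst.phi a.pred)) (hs Γ s)))]
      exact .num _ _
    | phi_zero s P ns hns =>
      rw [h.unique (.appNums (T := .nat) (by rw [hns]; exact .app (.const (LearnConst.phi P)) (hs Γ s)))]
      exact .num _ _
    | learn_old s P ns m hns =>
      rw [h.unique (.appNums (T := .state)
        (by simpa [hns] using .app (.const (LearnConst.learn P)) (hs Γ s)))]
      exact hs _ _
    | learn_new s a =>
      rw [h.unique (.appNums (T := .state)
        (by simpa [a.length_args] using .app (.const (LearnConst.learn a.pred)) (hs Γ s)))]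
      exact hs _ _
    | cup s₁ s₂ =>
      rw [h.unique (.app (.app (.const LearnConst.cup) (hs Γ s₁)) (hs Γ s₂))]
      exact hs _ _
    | fix h' U u =>
      cases h with
      | app h h'' =>
        have e := h.unique (.const (LearnConst.fix h' U))
        cases e
        exact .app h'' (.app (.const (LearnConst.fix h' _)) h'')
  | succ _ ih =>
    cases h with
    | succ h => exact .succ (ih h)
  | app_left u _ ih =>
    cases h with
    | app h h' => exact .app (ih h) h'
  | app_right t _ ih =>
    cases h with
    | app h h' => exact .app h (ih h')
  | pair_left u _ ih =>
    cases h with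
    | pair h h' => exact .pair (ih h) h'
  | pair_right t _ ih =>
    cases h with
    | pair h h' => exact .pair h (ih h')
  | fst _ ih =>
    cases h with
    | fst h => exact .fst (ih h)
  | snd _ ih =>
    cases h with
    | snd h => exact .snd (ih h)
  | lam U _ ih =>
    cases h with
    | lam _ h => exact .lam U (ih h)

theorem HasType.reds {Γ : List Ty} {t t' : LearnTm K} {T : Ty}
    (h : HasType LearnConst.type Γ t T) (h' : Reds t t') :
    HasType LearnConst.type Γ t' T := by
  induction h' with
  | refl => exact h
  | tail _ hr ih => exact ih.red hr

/-- The constants which compute from a state and `k` numerals a value of the type `R`. -/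
inductive NumConst : LearnConst K → ℕ → Ty → Prop
  | chi (P) : NumConst (.chi P) P.arity .bool
  | phi (P) : NumConst (.phi P) P.arity .nat
  | learn (P) : NumConst (.learn P) (P.arity + 1) .state

theorem NumConst.type_eq {c : LearnConst K} {k : ℕ} {R : Ty} (h : NumConst c k R) :
    c.type = .arr .state (Ty.natArrow k R) := by
  cases h <;> rfl

/-- Saturated queries never get stuck: either the state has the information or not, and in the case
of `add_P` the predicate is true or false by `Predicate.conv_bool`. -/
theorem NumConst.exists_rule {c : LearnConst K} {k : ℕ} {R : Ty} (h : NumConst c k R)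
    (s : State) {ns : List ℕ} (hns : ns.length = k) :
    ∃ r, LearnRule K (Tm.appNums (.app (.const c) (stc s)) ns) r := by
  cases h with
  | chi P =>
    by_cases hs : s.Knows P ns
    · exact ⟨_, .chi_true s P ns hns hs⟩
    · exact ⟨_, .chi_false s P ns hns hs⟩
  | phi P =>
    by_cases hs : s.Knows P ns
    · obtain ⟨a, ha, rfl, rfl⟩ := hs
      exact ⟨_, .phi_wit s a ha⟩
    · exact ⟨_, .phi_zero s P ns hns hs⟩
  | learn P =>
    obtain ⟨ns, m, rfl⟩ : ∃ ns' m, ns = ns' ++ [m] := by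
      rcases List.eq_nil_or_concat ns with rfl | ⟨ns', m, rfl⟩
      · simp at hns
      · exact ⟨ns', m, by simp⟩
    have hns' : ns.length = P.arity := by simpa using hns
    by_cases hs : s.Knows P ns
    · exact ⟨_, .learn_old s P ns m hns' (.inl hs)⟩
    · rcases P.conv_bool hns with ht | hf
      · exact ⟨_, .learn_new s ⟨P, ns, m, hns', ht⟩ hs⟩
      · exact ⟨_, .learn_old s P ns m hns' (.inr hf)⟩

/-- Closed normal forms of functional types. -/
inductive FunValue : LearnTm K → Prop
  | lam (T t) : FunValue (.lam T t)
  | cond₀ (T) : FunValue (.cond T)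
  | cond₁ (T) {b} : b = .tt ∨ b = .ff → FunValue (.app (.cond T) b)
  | cond₂ (T) {b} (u) : b = .tt ∨ b = .ff → FunValue (.app (.app (.cond T) b) u)
  | prec₀ (T) : FunValue (.prec T)
  | prec₁ (T u) : FunValue (.app (.prec T) u)
  | prec₂ (T u v) : FunValue (.app (.app (.prec T) u) v)
  | cup₀ : FunValue (.const .cup)
  | cup₁ (s) : FunValue (.app (.const .cup) (stc s))
  | fix (h U) : FunValue (.const (LearnConst.fix h U))
  | num₀ {c k R} : NumConst c k R → FunValue (.const c)
  | num₁ {c k R} (s) (ns : List ℕ) : NumConst c k R → ns.length < k →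
      FunValue (Tm.appNums (.app (.const c) (stc s)) ns)

/-- Closed normal forms of a given type. -/
def Canonical : Ty → LearnTm K → Prop
  | .nat, t => ∃ n, t = Tm.num n
  | .bool, t => t = .tt ∨ t = .ff
  | .state, t => ∃ s, t = stc s
  | .prod _ _, t => ∃ u v, t = .pair u v
  | .arr _ _, t => FunValue t

/-- An argument given to a functional normal form either extends a partial application or completes
a redex, and the latter is excluded by normality. -/
theorem FunValue.canonical_app {t u : LearnTm K} {U V : Ty} (h : FunValue t)
    (ht : HasType LearnConst.type [] t (.arr U V)) (hu : Canonical U u)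
    (hn : Normal (LearnRule K) (.app t u)) : Canonical V (.app t u) := by
  cases h with
  | lam T t => exact (hn _ (.beta _ _ _)).elim
  | cond₀ T =>
    cases ht
    exact FunValue.cond₁ _ hu
  | cond₁ T hb =>
    cases ht with
    | app ht _ =>
      cases ht
      exact .cond₂ _ u hb
  | cond₂ T v hb =>
    rcases hb with rfl | rfl
    · exact (hn _ (.cond_tt _ _ _)).elim
    · exact (hn _ (.cond_ff _ _ _)).elim
  | prec₀ T =>
    cases ht
    exact .prec₁ _ u
  | prec₁ T v =>
    cases ht with
    | app ht _ =>
      cases ht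
      exact .prec₂ T v u
  | prec₂ T v w =>
    cases ht with
    | app ht _ =>
      cases ht with
      | app ht _ =>
        cases ht
        obtain ⟨n, rfl⟩ := hu
        cases n with
        | zero => exact (hn _ (.prec_zero _ _ _)).elim
        | succ n => exact (hn _ (.prec_succ _ _ _ _)).elim
  | cup₀ =>
    have e := ht.unique (.const LearnConst.cup)
    cases e
    obtain ⟨s, rfl⟩ := hu
    exact .cup₁ s
  | cup₁ s =>
    have e := ht.unique (.app (.const LearnConst.cup) (.const (LearnConst.st s)))
    cases e
    obtain ⟨s', rfl⟩ := hu
    exact (hn _ (.rule (.cup _ _))).elim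
  | fix h W => exact (hn _ (.rule (.fix h W u))).elim
  | @num₀ c k R hc =>
    have e := ht.unique (.const c)
    rw [hc.type_eq] at e
    cases e
    obtain ⟨s, rfl⟩ := hu
    cases k with
    | zero =>
      obtain ⟨r, hr⟩ := hc.exists_rule s (ns := []) rfl
      exact (hn _ (.rule hr)).elim
    | succ k => exact .num₁ s [] hc (by simp)
  | @num₁ c k R s ns hc hns =>
    -- `j + 1` is the number of missing numerals: for `j = 0` the argument `u` completes a redex.
    obtain ⟨j, rfl⟩ : ∃ j, k = ns.length + (j + 1) := ⟨k - ns.length - 1, by omega⟩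
    have hadd : ∀ (i j : ℕ) (R : Ty), Ty.natArrow (i + j) R = Ty.natArrow i (Ty.natArrow j R) := by
      intro i j R
      induction i with
      | zero => simp [Ty.natArrow]
      | succ i ih => rw [Nat.add_right_comm, Ty.natArrow, ih, Ty.natArrow]
    have hc' := HasType.const (Γ := []) (ct := LearnConst.type) c
    rw [hc.type_eq, hadd] at hc'
    have e := ht.unique (.appNums (.app hc' (.const (LearnConst.st s))))
    rw [Ty.natArrow] at e
    cases e
    obtain ⟨n, rfl⟩ := hu
    rw [← Tm.appNums_concat] at hn ⊢
    cases j with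
    | zero =>
      obtain ⟨r, hr⟩ := hc.exists_rule s (ns := ns ++ [n]) (by simp)
      exact (hn _ (.rule hr)).elim
    | succ j => exact .num₁ s (ns ++ [n]) hc (by simp)

/-- Closed normal terms are in canonical form. -/
theorem HasType.canonical {t : LearnTm K} {T : Ty} (h : HasType LearnConst.type [] t T)
    (hn : Normal (LearnRule K) t) : Canonical T t := by
  generalize e : ([] : List Ty) = Γ at h
  induction h with
  | var h => subst e; simp at h
  | zero => exact ⟨0, rfl⟩
  | succ _ ih =>
    obtain ⟨n, rfl⟩ := ih (fun _ h => hn _ (.succ h)) e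
    exact ⟨n + 1, rfl⟩
  | tt => exact .inl rfl
  | ff => exact .inr rfl
  | cond T => exact .cond₀ T
  | prec T => exact .prec₀ T
  | app h _ ih ih' =>
    subst e
    exact FunValue.canonical_app (ih (fun _ h => hn _ (.app_left _ h)) rfl) h
      (ih' (fun _ h => hn _ (.app_right _ h)) rfl) hn
  | pair => exact ⟨_, _, rfl⟩
  | fst _ ih =>
    obtain ⟨u, v, rfl⟩ := ih (fun _ h => hn _ (.fst h)) e
    exact (hn _ (.fst_pair _ _)).elim
  | snd _ ih =>
    obtain ⟨u, v, rfl⟩ := ih (fun _ h => hn _ (.snd h)) e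
    exact (hn _ (.snd_pair _ _)).elim
  | lam U => exact .lam U _
  | const c =>
    cases c with
    | st s => exact ⟨s, rfl⟩
    | cup => exact .cup₀
    | chi P => exact .num₀ (.chi P)
    | phi P => exact .num₀ (.phi P)
    | learn P => exact .num₀ (.learn P)
    | fix h U => exact .fix h U

/-! ### Evaluation of stable terms -/

/-- At each state, a convergent term is equal to a canonical form. -/
theorem Converges.exists_canonical {t : ClassTm K} {T : Ty} (h : Converges t)
    (ht : ClosedOfType t T) (s : State) : ∃ v, LConv (approx s t) v ∧ Canonical T v := by
  -- Convergence along the constant sequence yields a normal form at the single state `s`.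
  obtain ⟨v, hv, i, hi⟩ := h (fun _ => s) fun _ => subset_rfl
  have hc := hi i le_rfl
  exact ⟨v, hc, ((ht.approx s).reds (hc.reds_of_normal hv)).canonical hv⟩

theorem Converges.eventually_eq {t : ClassTm K} (h : Converges t) {s : ℕ → State}
    (hs : ∀ i, (s i).carrier ⊆ (s (i + 1)).carrier) :
    ∃ i, ∀ j, i ≤ j → LConv (approx (s j) t) (approx (s i) t) := by
  obtain ⟨v, -, i, hi⟩ := h s hs
  exact ⟨i, fun j hj => (hi j hj).trans (hi i le_rfl).symm⟩

theorem Stable.closed {T : Ty} {t : ClassTm K} (h : Stable T t) : ClosedOfType t T := by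
  cases T <;> exact h.1

theorem approx_num (s : State) (n : ℕ) : approx s (Tm.num n : ClassTm K) = Tm.num n := by
  simp [approx]

theorem Stable.num (n : ℕ) : Stable .nat (Tm.num n : ClassTm K) :=
  ⟨.num _ n, fun s _ => ⟨Tm.num n, (IsValue.num n).normal, 0, fun j _ => by
    rw [approx_num]; exact .refl _⟩⟩

/-! ### Stability of the terms of `T_Class` -/

theorem State.knows_mono {s s' : State} (h : s.carrier ⊆ s'.carrier) {P : Predicate}
    {ns : List ℕ} (hk : s.Knows P ns) : s'.Knows P ns :=
  let ⟨a, ha, h'⟩ := hk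
  ⟨a, h ha, h'⟩

open Filter in
-- By the fundamental lemma it suffices to treat the constants. As the states increase, knowledge
-- about given arguments is either acquired at some stage and kept with the same witness, or never
-- acquired; in both cases the answers to queries become constant.
theorem ClosedOfType.rel {t : ClassTm .T} {T : Ty} (h : ClosedOfType t T) {s : ℕ → State}
    (hs : ∀ i, (s i).carrier ⊆ (s (i + 1)).carrier) :
    Rel (LearnRule .T) stc atTop T fun i => approx (s i) t := by
  have hmono : ∀ i j, i ≤ j → (s i).carrier ⊆ (s j).carrier := fun i j hij =>
    monotone_nat_of_le_succ (f := fun i => (s i).carrier) hs hij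
  have hk : ∀ P ns, (∃ i, (s i).Knows P ns ∧ ∀ j, i ≤ j → (s j).Knows P ns) ∨
      ∀ i, ¬ (s i).Knows P ns := by
    intro P ns
    by_cases h : ∃ i, (s i).Knows P ns
    · obtain ⟨i, hi⟩ := h
      exact .inl ⟨i, hi, fun j hj => State.knows_mono (hmono i j hj) hi⟩
    · exact .inr (by simpa using h)
  rw [← funext fun i => Tm.subst_var (approx (s i) t)]
  refine HasType.rel ?_ ?_ h (σ := fun _ => Tm.var) (by simp)
  · intro c
    cases c with
    | st s' => exact ⟨s', .of_forall fun _ => .refl _⟩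
    | cup =>
      rintro f ⟨s₁, h₁⟩ g ⟨s₂, h₂⟩
      refine ⟨s₁.cunion s₂, ?_⟩
      filter_upwards [h₁, h₂] with i h₁ h₂
      exact (((Conv.refl _).app h₁).app h₂).trans (.of_red (.rule (.cup _ _)))
    | oracle P =>
      refine Rel.of_appNums fun ns hns => ?_
      rcases hk P ns with ⟨i, -, hi⟩ | hi
      · exact .inl (eventually_atTop.2
          ⟨i, fun j hj => .of_red (.rule (.chi_true _ _ _ hns (hi j hj)))⟩)
      · exact .inr (.of_forall fun j => .of_red (.rule (.chi_false _ _ _ hns (hi j))))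
    | skolem P =>
      refine Rel.of_appNums fun ns hns => ?_
      rcases hk P ns with ⟨i, ⟨a, ha, rfl, rfl⟩, hi⟩ | hi
      · exact ⟨a.wit, eventually_atTop.2
          ⟨i, fun j hj => .of_red (.rule (.phi_wit _ a (hmono i j hj ha)))⟩⟩
      · exact ⟨0, .of_forall fun j => .of_red (.rule (.phi_zero _ _ _ hns (hi j)))⟩
    -- Once the arguments are known nothing more is added; if they never become known, the answer
    -- depends only on the truth of the predicate.
    | adder P =>
      refine Rel.of_appNums fun l hl => ?_
      obtain ⟨ns, m, rfl⟩ : ∃ ns' m, l = ns' ++ [m] := by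
        rcases List.eq_nil_or_concat l with rfl | ⟨ns', m, rfl⟩
        · simp at hl
        · exact ⟨ns', m, by simp⟩
      have hns : ns.length = P.arity := by simpa using hl
      rcases hk P ns with ⟨i, -, hi⟩ | hi
      · exact ⟨.empty, eventually_atTop.2
          ⟨i, fun j hj => .of_red (.rule (.learn_old _ _ _ _ hns (.inl (hi j hj))))⟩⟩
      · rcases P.conv_bool hl with ht | hf
        · exact ⟨.singleton ⟨P, ns, m, hns, ht⟩, .of_forall fun j =>
            .of_red (.rule (.learn_new _ ⟨P, ns, m, hns, ht⟩ (hi j)))⟩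
        · exact ⟨.empty, .of_forall fun j =>
            .of_red (.rule (.learn_old _ _ _ _ hns (.inr hf)))⟩
    | fix h => exact absurd h (by simp)
  · intro i c σ
    cases c <;> rfl

/-- Only atomic types need the logical relation: a stable argument is itself a closed term of
`T_Class`, so at function types closure under typed application is enough. -/
theorem ClosedOfType.stable {t : ClassTm .T} {T : Ty} (h : ClosedOfType t T) : Stable T t := by
  induction T generalizing t with
  | nat =>
    refine ⟨h, fun s hs => ?_⟩
    obtain ⟨n, hn⟩ := h.rel hs
    obtain ⟨i, hi⟩ := Filter.eventually_atTop.1 hn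
    exact ⟨_, (IsValue.num n).normal, i, hi⟩
  | bool =>
    refine ⟨h, fun s hs => ?_⟩
    rcases h.rel hs with h | h <;> obtain ⟨i, hi⟩ := Filter.eventually_atTop.1 h
    · exact ⟨_, IsValue.tt.normal, i, hi⟩
    · exact ⟨_, IsValue.ff.normal, i, hi⟩
  | state =>
    refine ⟨h, fun s hs => ?_⟩
    obtain ⟨e, he⟩ := h.rel hs
    obtain ⟨i, hi⟩ := Filter.eventually_atTop.1 he
    exact ⟨_, (IsValue.stc e).normal, i, hi⟩
  | prod U V ihU ihV => exact ⟨h, ihU (.fst h), ihV (.snd h)⟩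
  | arr U V _ ihV => exact ⟨h, fun u hu => ihV (.app h hu.closed)⟩

theorem Admissible.stable {t : ClassTm K} {A : Formula} (h : Admissible t A) :
    Stable A.type t := by
  cases K with
  | T => exact h.1.stable
  | PCF => exact h.2.2 rfl

end Canonical

/-! ### Realizers learn only new atoms -/

section Fresh

variable {K : Calculus}

/-- The atoms of `e` are about arguments at which `s` has no information. -/
def State.Fresh (s e : State) : Prop := ∀ a ∈ e.carrier, ¬ s.Knows a.pred a.args

/-- The state `s` occurs in the term only as first argument of the constants `χ_P`, `φ_P`,
`add_P`, and all other states occurring in it are fresh for `s`. -/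
inductive FreshTm (s : State) : LearnTm K → Prop
  | var (i) : FreshTm s (.var i)
  | zero : FreshTm s .zero
  | succ {t} : FreshTm s t → FreshTm s (.succ t)
  | tt : FreshTm s .tt
  | ff : FreshTm s .ff
  | cond (T) : FreshTm s (.cond T)
  | prec (T) : FreshTm s (.prec T)
  | app {t u} : FreshTm s t → FreshTm s u → FreshTm s (.app t u)
  | pair {t u} : FreshTm s t → FreshTm s u → FreshTm s (.pair t u)
  | fst {t} : FreshTm s t → FreshTm s (.fst t)
  | snd {t} : FreshTm s t → FreshTm s (.snd t)
  | lam (T) {t} : FreshTm s t → FreshTm s (.lam T t)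
  | st {e} : s.Fresh e → FreshTm s (.const (.st e))
  | cup : FreshTm s (.const .cup)
  | fix (h U) : FreshTm s (.const (.fix h U))
  | query {c k R} : NumConst c k R → FreshTm s (.app (.const c) (stc s))

variable {s : State}

theorem FreshTm.num (n : ℕ) : FreshTm s (Tm.num n : LearnTm K) := by
  induction n with
  | zero => exact .zero
  | succ n ih => exact .succ ih

theorem FreshTm.rename {t : LearnTm K} (h : FreshTm s t) (f : ℕ → ℕ) :
    FreshTm s (t.rename f) := by
  induction h generalizing f with
  | var i => exact .var _
  | zero => exact .zero
  | succ _ ih => exact .succ (ih f)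
  | tt => exact .tt
  | ff => exact .ff
  | cond T => exact .cond T
  | prec T => exact .prec T
  | app _ _ ih ih' => exact .app (ih f) (ih' f)
  | pair _ _ ih ih' => exact .pair (ih f) (ih' f)
  | fst _ ih => exact .fst (ih f)
  | snd _ ih => exact .snd (ih f)
  | lam T _ ih => exact .lam T (ih _)
  | st h => exact .st h
  | cup => exact .cup
  | fix h U => exact .fix h U
  | query h => exact .query h

theorem FreshTm.subst {t : LearnTm K} (h : FreshTm s t) {σ : ℕ → LearnTm K}
    (hσ : ∀ i, FreshTm s (σ i)) : FreshTm s (t.subst σ) := by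
  induction h generalizing σ with
  | var i => exact hσ i
  | zero => exact .zero
  | succ _ ih => exact .succ (ih hσ)
  | tt => exact .tt
  | ff => exact .ff
  | cond T => exact .cond T
  | prec T => exact .prec T
  | app _ _ ih ih' => exact .app (ih hσ) (ih' hσ)
  | pair _ _ ih ih' => exact .pair (ih hσ) (ih' hσ)
  | fst _ ih => exact .fst (ih hσ)
  | snd _ ih => exact .snd (ih hσ)
  | lam T _ ih =>
    refine .lam T (ih ?_)
    rintro (_ | i)
    · exact .var 0
    · exact (hσ i).rename _
  | st h => exact .st h
  | cup => exact .cup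
  | fix h U => exact .fix h U
  | query h => exact .query h

theorem FreshTm.const_st {e : State} (h : FreshTm s (stc e : LearnTm K)) : s.Fresh e := by
  cases h with
  | st h => exact h

/-- The side condition excludes the guarded queries `χ_P s`, `φ_P s`, `add_P s`, whose components
are not covered by the invariant separately. -/
theorem FreshTm.app_inv {t u : LearnTm K} (h : FreshTm s (.app t u)) (ht : ∀ c, t ≠ .const c) :
    FreshTm s t ∧ FreshTm s u := by
  cases h with
  | app h h' => exact ⟨h, h'⟩
  | query => exact (ht _ rfl).elim

/-- A query constant satisfies the invariant only together with the argument `s`, so every query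
occurring in the term is addressed to `s`. -/
theorem FreshTm.state_eq {c : LearnConst K} {k : ℕ} {R : Ty} (hc : NumConst c k R) {s' : State}
    {ns : List ℕ} (h : FreshTm s (Tm.appNums (.app (.const c) (stc s')) ns)) : s' = s := by
  induction ns using List.reverseRecOn with
  | nil =>
    generalize e : Tm.appNums (Tm.app (Tm.const c) (stc s')) [] = t at h
    cases h with
    | app h _ =>
      cases e
      cases hc <;> cases h
    | query =>
      simp only [Tm.appNums, Tm.appList, List.map_nil, Tm.app.injEq, stc, Tm.const.injEq,
        LearnConst.st.injEq] at e
      exact e.2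
    | _ => simp [Tm.appNums, Tm.appList] at e
  | append_singleton ns n ih =>
    rw [Tm.appNums_concat] at h
    refine ih (h.app_inv fun d e => ?_).1
    have := congrArg Tm.numArgs e
    simp [Tm.appNums, Tm.numArgs] at this

/-- Atoms are created only by `add_P`, which is queried at `s` and returns an atom only if `s` knows
nothing about its arguments; consistent union of fresh states stays fresh. -/
theorem FreshTm.red {t t' : LearnTm K} (h : FreshTm s t) (hr : Red (LearnRule K) t t') :
    FreshTm s t' := by
  have empty : FreshTm s (stc State.empty : LearnTm K) :=
    .st fun a ha => ha.elim
  induction hr with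
  | beta U t u =>
    obtain ⟨h, h'⟩ := h.app_inv (by simp)
    cases h with
    | lam _ h =>
      refine h.subst ?_
      rintro (_ | i)
      · exact h'
      · exact .var i
  | fst_pair t u =>
    cases h with
    | fst h =>
      cases h with
      | pair h _ => exact h
  | snd_pair t u =>
    cases h with
    | snd h =>
      cases h with
      | pair _ h => exact h
  | prec_zero U u v =>
    exact (((h.app_inv (by simp)).1.app_inv (by simp)).1.app_inv (by simp)).2
  | prec_succ U u v t =>
    obtain ⟨h, h₃⟩ := h.app_inv (by simp)
    obtain ⟨h', h₂⟩ := h.app_inv (by simp)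
    cases h₃ with
    | succ h₃ => exact .app (.app h₂ h₃) (.app h h₃)
  | cond_tt U u v => exact ((h.app_inv (by simp)).1.app_inv (by simp)).2
  | cond_ff U u v => exact (h.app_inv (by simp)).2
  | rule hr =>
    cases hr with
    | chi_true => exact .tt
    | chi_false => exact .ff
    | phi_wit => exact .num _
    | phi_zero => exact .num _
    | learn_old => exact empty
    | learn_new s' a hs =>
      obtain rfl := h.state_eq (.learn a.pred)
      refine .st ?_
      rintro b rfl
      exact hs
    | cup s₁ s₂ =>
      obtain ⟨h, h₂⟩ := h.app_inv (by simp)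
      have h₁ : s.Fresh s₁ := by
        cases h with
        | app _ h => exact h.const_st
        | query hq => cases hq
      refine .st ?_
      rintro a (ha | ha)
      · exact h₁ a ha
      · exact h₂.const_st a ha.1
    | fix h' U u =>
      cases h with
      | app h h' => exact .app h' (.app h h')
      | query hq => cases hq
  | succ _ ih =>
    cases h with
    | succ h => exact .succ (ih h)
  | app_left u hr ih =>
    cases h with
    | app h h' => exact .app (ih h) h'
    | query => exact (Par.const_inv hr.par ▸ FreshTm.query ‹_›)
  | app_right t hr ih =>
    cases h with
    | app h h' => exact .app h (ih h')
    | query => exact ((IsValue.stc s).normal _ hr).elim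
  | pair_left u _ ih =>
    cases h with
    | pair h h' => exact .pair (ih h) h'
  | pair_right t _ ih =>
    cases h with
    | pair h h' => exact .pair h (ih h')
  | fst _ ih =>
    cases h with
    | fst h => exact .fst (ih h)
  | snd _ ih =>
    cases h with
    | snd h => exact .snd (ih h)
  | lam U _ ih =>
    cases h with
    | lam _ h => exact .lam U (ih h)

theorem HasEmptyState.freshTm {t : ClassTm K} (h : HasEmptyState t) (s : State) :
    FreshTm s (approx s t) := by
  induction t with
  | var i => exact .var i
  | zero => exact .zero
  | succ t ih => exact .succ (ih h)
  | tt => exact .tt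
  | ff => exact .ff
  | cond T => exact .cond T
  | prec T => exact .prec T
  | app t u iht ihu => exact .app (iht h.1) (ihu h.2)
  | pair t u iht ihu => exact .pair (iht h.1) (ihu h.2)
  | fst t ih => exact .fst (ih h)
  | snd t ih => exact .snd (ih h)
  | lam T t ih => exact .lam T (ih h)
  | const c =>
    cases c with
    | st s' =>
      obtain rfl := h s' rfl
      exact .st fun a ha => ha.elim
    | cup => exact .cup
    | oracle P => exact .query (.chi P)
    | skolem P => exact .query (.phi P)
    | adder P => exact .query (.learn P)
    | fix hK U => exact .fix hK U

/-- The atoms which a term of state `∅` learns at `s` are new. -/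
theorem HasEmptyState.fresh {t : ClassTm K} (h : HasEmptyState t) {s e : State}
    (he : LConv (approx s t) (stc e)) : s.Fresh e := by
  have hr := LConv.reds_of_normal he (IsValue.stc e).normal
  have key : ∀ {v}, Reds (approx s t) v → FreshTm s v := by
    intro v hv
    induction hv with
    | refl => exact h.freshTm s
    | tail _ hr ih => exact ih.red hr
  exact (key hr).const_st

theorem hasEmptyState_num (n : ℕ) : HasEmptyState (Tm.num n : ClassTm K) := by
  induction n with
  | zero => trivial
  | succ n ih => exact ih

theorem State.subset_cunion (s e : State) : s.carrier ⊆ (s.cunion e).carrier :=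
  fun _ ha => .inl ha

/-- Inconsistency of two atoms requires equal predicate and arguments, which freshness forbids;
hence consistent union discards nothing. -/
theorem State.Fresh.subset_cunion {s e : State} (h : s.Fresh e) :
    e.carrier ⊆ (s.cunion e).carrier :=
  fun a ha => .inr ⟨ha, fun b hb h₁ h₂ => (h a ha ⟨b, hb, h₁, h₂⟩).elim⟩

/-- Learning the same atoms a second time is impossible; this closes the termination argument. -/
theorem State.eq_empty_of_fresh {s e : State} (h : s.Fresh e) (h' : e.carrier ⊆ s.carrier) :
    e = State.empty :=
  State.ext (Set.eq_empty_of_forall_notMem fun a ha => h a ha ⟨a, h' ha, rfl, rfl⟩)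

end Fresh

/-! ### Realizers of subformula occurrences -/

section Occurrences

variable {K : Calculus}

/-- The type of `occRealizer A t a`. -/
def typeAt : Formula → List ℕ → Ty
  | A, [] => A.type
  | .ex B, _ :: l => typeAt B l
  | .all B, _ :: l => typeAt B l
  | .and B C, i :: l => if i = 0 then typeAt B l else typeAt C l
  | .or B C, i :: l => if i = 0 then typeAt B l else typeAt C l
  | .imp B C, _ :: _ => (Formula.imp B C).type
  | .atom _ _, _ :: _ => .state
termination_by structural _ l => l

theorem typeAt_subst (A : Formula) (σ : ℕ → TTm) (a : List ℕ) :
    typeAt (A.subst σ) a = typeAt A a := by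
  induction a generalizing A σ with
  | nil => exact A.type_subst σ
  | cons i a ih => cases A <;> simp [Formula.subst, typeAt, ih, Formula.type, Formula.type_subst]

/-- The address need not be an occurrence: the default clauses of `typeAt` match those of
`occRealizer`. Therefore the strategy can be computed on arbitrary lists and not only on plays. -/
theorem stable_occRealizer {A : Formula} {t : ClassTm K} (h : Stable A.type t) (a : List ℕ) :
    Stable (typeAt A a) (occRealizer A t a) := by
  induction a generalizing A t with
  | nil => exact h
  | cons i a ih =>
    cases A with
    | atom Q ts => exact h
    | imp B C => exact h
    | and B C =>
      simp only [typeAt, occRealizer]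
      split
      · exact ih h.2.1
      · exact ih h.2.2
    | or B C =>
      simp only [typeAt, occRealizer]
      split
      · exact ih h.2.2.2.1
      · exact ih h.2.2.2.2
    | all B =>
      have := ih (A := B.inst i) (t := t.app (Tm.num i))
        (by rw [Formula.inst, B.type_subst]; exact h.2 _ (.num i))
      rwa [Formula.inst, typeAt_subst] at this
    | ex B =>
      have := ih (A := B.inst i) (t := .snd t)
        (by rw [Formula.inst, B.type_subst]; exact h.2.2)
      rwa [Formula.inst, typeAt_subst] at this

theorem hasEmptyState_occRealizer {A : Formula} {t : ClassTm K} (h : HasEmptyState t)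
    (a : List ℕ) : HasEmptyState (occRealizer A t a) := by
  induction a generalizing A t with
  | nil => exact h
  | cons i a ih =>
    cases A with
    | atom Q ts => exact h
    | imp B C => exact h
    | and B C => simp only [occRealizer]; split <;> exact ih h
    | or B C => simp only [occRealizer]; split <;> exact ih h
    | all B => exact ih (t := t.app (Tm.num i)) ⟨h, hasEmptyState_num i⟩
    | ex B => exact ih (t := .snd t) h

theorem subAt_append {A B : Formula} {a : List ℕ} (h : subAt A a = some B) (b : List ℕ) :
    subAt A (a ++ b) = subAt B b := by
  induction a generalizing A with
  | nil => cases h; rfl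
  | cons i a ih =>
    cases A with
    | atom Q ts => simp [subAt] at h
    | imp B C => simp [subAt] at h
    | and B C =>
      simp only [List.cons_append, subAt] at h ⊢
      split_ifs at h ⊢ <;> exact ih h
    | or B C =>
      simp only [List.cons_append, subAt] at h ⊢
      split_ifs at h ⊢ <;> exact ih h
    | all B => exact ih h
    | ex B => exact ih h

theorem occRealizer_append {A B : Formula} {a : List ℕ} (h : subAt A a = some B)
    (t : ClassTm K) (b : List ℕ) :
    occRealizer A t (a ++ b) = occRealizer B (occRealizer A t a) b := by
  induction a generalizing A t with
  | nil => cases h; rfl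
  | cons i a ih =>
    cases A with
    | atom Q ts => simp [subAt] at h
    | imp B C => simp [subAt] at h
    | and B C =>
      simp only [List.cons_append, subAt, occRealizer] at h ⊢
      split_ifs at h ⊢ <;> exact ih h _
    | or B C =>
      simp only [List.cons_append, subAt, occRealizer] at h ⊢
      split_ifs at h ⊢ <;> exact ih h _
    | all B => exact ih h _
    | ex B => exact ih h _

theorem typeAt_eq {A B : Formula} {a : List ℕ} (h : subAt A a = some B) :
    typeAt A a = B.type := by
  induction a generalizing A with
  | nil => cases h; rfl
  | cons i a ih =>
    cases A with
    | atom Q ts => simp [subAt] at h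
    | imp B C => simp [subAt] at h
    | and B C =>
      simp only [subAt, typeAt] at h ⊢
      split_ifs at h ⊢ <;> exact ih h
    | or B C =>
      simp only [subAt, typeAt] at h ⊢
      split_ifs at h ⊢ <;> exact ih h
    | all B => rw [← ih h, Formula.inst, typeAt_subst]; rfl
    | ex B => rw [← ih h, Formula.inst, typeAt_subst]; rfl

/-- Numerals do not change the size of a formula, so each choice lowers it by at least one. This
bounds the length of the plays of `T_A`. -/
theorem size_subAt {A B : Formula} {a : List ℕ} (h : subAt A a = some B) :
    B.size + a.length ≤ A.size := by
  induction a generalizing A with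
  | nil => cases h; simp
  | cons i a ih =>
    cases A with
    | atom Q ts => simp [subAt] at h
    | imp B C => simp [subAt] at h
    | and B C =>
      simp only [subAt] at h
      split_ifs at h <;> have := ih h <;> simp [Formula.size] <;> omega
    | or B C =>
      simp only [subAt] at h
      split_ifs at h <;> have := ih h <;> simp [Formula.size] <;> omega
    | all B => have := ih h; simp [Formula.size, Formula.size_inst] at this ⊢; omega
    | ex B => have := ih h; simp [Formula.size, Formula.size_inst] at this ⊢; omega

theorem wf_subAt {A B : Formula} {a : List ℕ} (h : subAt A a = some B) (hA : A.WF 0) :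
    B.WF 0 := by
  induction a generalizing A with
  | nil => cases h; exact hA
  | cons i a ih =>
    cases A with
    | atom Q ts => simp [subAt] at h
    | imp B C => simp [subAt] at h
    | and B C =>
      simp only [subAt] at h
      split_ifs at h
      exacts [ih h hA.1, ih h hA.2]
    | or B C =>
      simp only [subAt] at h
      split_ifs at h
      exacts [ih h hA.1, ih h hA.2]
    | all B => exact ih h (Formula.WF.inst hA i)
    | ex B => exact ih h (Formula.WF.inst hA i)

theorem impFree_subAt {A B : Formula} {a : List ℕ} (h : subAt A a = some B) (hA : A.ImpFree) :
    B.ImpFree := by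
  induction a generalizing A with
  | nil => cases h; exact hA
  | cons i a ih =>
    cases A with
    | atom Q ts => simp [subAt] at h
    | imp B C => simp [subAt] at h
    | and B C =>
      simp only [subAt] at h
      split_ifs at h
      exacts [ih h hA.1, ih h hA.2]
    | or B C =>
      simp only [subAt] at h
      split_ifs at h
      exacts [ih h hA.1, ih h hA.2]
    | all B => exact ih h (Formula.impFree_subst (A := B) hA _)
    | ex B => exact ih h (Formula.impFree_subst (A := B) hA _)

/-! #### Values of realizers -/

theorem Stable.exists_num {t : ClassTm K} (h : Stable .nat t) (s : State) :
    ∃ n, LConv (approx s t) (Tm.num n) := by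
  obtain ⟨v, hv, n, rfl⟩ := h.2.exists_canonical h.1 s
  exact ⟨n, hv⟩

theorem Stable.tt_or_ff {t : ClassTm K} (h : Stable .bool t) (s : State) :
    LConv (approx s t) .tt ∨ LConv (approx s t) .ff := by
  obtain ⟨v, hv, rfl | rfl⟩ := h.2.exists_canonical h.1 s
  · exact .inl hv
  · exact .inr hv

theorem Stable.exists_stc {t : ClassTm K} (h : Stable .state t) (s : State) :
    ∃ e, LConv (approx s t) (stc e) := by
  obtain ⟨v, hv, e, rfl⟩ := h.2.exists_canonical h.1 s
  exact ⟨e, hv⟩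

/-- The chosen value is the only one, since the model separates numerals. -/
theorem LConv.numValue_eq {t : ClassTm K} {s : State} {n : ℕ}
    (h : LConv (approx s t) (Tm.num n)) : numValue s t = n :=
  LConv.num_inj ((Conv.symm (Classical.epsilon_spec
    (p := fun n => LConv (approx s t) (Tm.num n)) ⟨n, h⟩)).trans h)

theorem LConv.stateValue_eq {t : ClassTm K} {s e : State}
    (h : LConv (approx s t) (stc e)) : stateValue s t = e :=
  LConv.stc_inj ((Conv.symm (Classical.epsilon_spec
    (p := fun e => LConv (approx s t) (stc e)) ⟨e, h⟩)).trans h)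

theorem Stable.conv_numValue {t : ClassTm K} (h : Stable .nat t) (s : State) :
    LConv (approx s t) (Tm.num (numValue s t)) := by
  obtain ⟨n, hn⟩ := h.exists_num s
  rwa [hn.numValue_eq]

theorem Stable.conv_stateValue {t : ClassTm K} (h : Stable .state t) (s : State) :
    LConv (approx s t) (stc (stateValue s t)) := by
  obtain ⟨e, he⟩ := h.exists_stc s
  rwa [he.stateValue_eq]

end Occurrences

/-! ### Plays of the Tarski game -/

section Tarski

variable {A : Formula} {K : Calculus}

theorem subset_update (s : State) (t : ClassTm K) : s.carrier ⊆ (update s t).carrier :=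
  s.subset_cunion _

theorem mem_tarskiMoves_E₁ {a b : List ℕ} :
    (a, b) ∈ (tarski A).E₁ ↔ ∃ i, b = a ++ [i] ∧ IsEloise A a ∧ b ∈ occurrences A := by
  constructor
  · rintro ⟨a', i, h₁, h₂, h₃, e⟩
    cases e
    exact ⟨i, rfl, h₁, h₃⟩
  · rintro ⟨i, rfl, h₁, h₂⟩
    refine ⟨a, i, h₁, ?_, h₂, rfl⟩
    rcases h₁ with ⟨B, h⟩ | ⟨B, C, h⟩
    exacts [⟨_, h⟩, ⟨_, h⟩]

theorem mem_tarskiMoves_E₂ {a b : List ℕ} :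
    (a, b) ∈ (tarski A).E₂ ↔ ∃ i, b = a ++ [i] ∧ IsAbelard A a ∧ b ∈ occurrences A := by
  constructor
  · rintro ⟨a', i, h₁, h₂, h₃, e⟩
    cases e
    exact ⟨i, rfl, h₁, h₃⟩
  · rintro ⟨i, rfl, h₁, h₂⟩
    refine ⟨a, i, h₁, ?_, h₂, rfl⟩
    rcases h₁ with ⟨B, h⟩ | ⟨B, C, h⟩
    exacts [⟨_, h⟩, ⟨_, h⟩]

theorem ex_move {a : List ℕ} {B : Formula} (h : subAt A a = some (.ex B)) (n : ℕ) :
    (a, a ++ [n]) ∈ (tarski A).E₁ :=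
  mem_tarskiMoves_E₁.2 ⟨n, rfl, .inl ⟨B, h⟩, B.inst n, by rw [subAt_append h]; rfl⟩

theorem or_move {a : List ℕ} {B C : Formula} (h : subAt A a = some (.or B C)) {i : ℕ}
    (hi : i = 0 ∨ i = 1) : (a, a ++ [i]) ∈ (tarski A).E₁ := by
  refine mem_tarskiMoves_E₁.2 ⟨i, rfl, .inr ⟨B, C, h⟩, ?_⟩
  rcases hi with rfl | rfl
  · exact ⟨B, by rw [subAt_append h]; rfl⟩
  · exact ⟨C, by rw [subAt_append h]; rfl⟩

theorem mem_dom_E₁ {a : List ℕ} : a ∈ Dom (tarski A).E₁ ↔ IsEloise A a := by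
  constructor
  · rintro ⟨b, h⟩
    obtain ⟨i, -, h, -⟩ := mem_tarskiMoves_E₁.1 h
    exact h
  · rintro (⟨B, h⟩ | ⟨B, C, h⟩)
    · exact ⟨_, ex_move h 0⟩
    · exact ⟨_, or_move h (.inl rfl)⟩

theorem mem_dom_E₂ {a : List ℕ} : a ∈ Dom (tarski A).E₂ ↔ IsAbelard A a := by
  constructor
  · rintro ⟨b, h⟩
    obtain ⟨i, -, h, -⟩ := mem_tarskiMoves_E₂.1 h
    exact h
  · rintro (⟨B, h⟩ | ⟨B, C, h⟩)
    · exact ⟨a ++ [0], mem_tarskiMoves_E₂.2 ⟨0, rfl, .inl ⟨B, h⟩, B.inst 0, by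
        rw [subAt_append h]; rfl⟩⟩
    · exact ⟨a ++ [0], mem_tarskiMoves_E₂.2 ⟨0, rfl, .inr ⟨B, C, h⟩, B, by
        rw [subAt_append h]; rfl⟩⟩

/-- The finite plays of `T_A` that start with `A`. -/
structure RootPlay (A : Formula) (p : List (List ℕ)) : Prop where
  mem : p ∈ (tarski A).finPlays
  head : p.head? = some rootOcc

theorem rootPlay_rootPlay : RootPlay A rootPlay := by
  refine ⟨(Game.mem_finPlays _).2 ⟨?_, ?_⟩, rfl⟩
  · intro i v h
    cases i with
    | zero =>
      obtain rfl : rootOcc = v := by simpa [rootPlay] using h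
      exact ⟨A, rfl⟩
    | succ i => simp [rootPlay] at h
  · intro i v w h h'
    simp [rootPlay] at h'

theorem RootPlay.exists_concat {p : List (List ℕ)} (hp : RootPlay A p) :
    ∃ q a, p = q ++ [a] := by
  rcases List.eq_nil_or_concat p with rfl | ⟨q, a, rfl⟩
  · simpa using hp.head
  · exact ⟨q, a, by simp⟩

theorem RootPlay.of_prefix {p q : List (List ℕ)} (hp : RootPlay A p) (h : q <+: p)
    (hq : q ≠ []) : RootPlay A q := by
  obtain ⟨r, rfl⟩ := h
  refine ⟨Game.mem_finPlays_of_append _ hp.mem, ?_⟩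
  have := hp.head
  rwa [List.head?_append_of_ne_nil _ hq] at this

theorem RootPlay.concat {q : List (List ℕ)} {a b : List ℕ} (hp : RootPlay A (q ++ [a]))
    (h : (a, b) ∈ (tarski A).E₁ ∪ (tarski A).E₂) : RootPlay A (q ++ [a, b]) := by
  refine ⟨Game.mem_finPlays_concat _ hp.mem h, ?_⟩
  have := hp.head
  rw [← List.singleton_append (l := [b]), ← List.append_assoc,
    List.head?_append_of_ne_nil _ (by simp)]
  exact this

theorem RootPlay.step {p : List (List ℕ)} (hp : RootPlay A p) {j : ℕ} {a b : List ℕ}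
    (ha : p[j]? = some a) (hb : p[j + 1]? = some b) :
    ∃ i, b = a ++ [i] ∧ (IsEloise A a ∨ IsAbelard A a) ∧ b ∈ occurrences A := by
  rcases ((Game.mem_finPlays _).1 hp.mem).2 j a b ha hb with h | h
  · obtain ⟨i, h₁, h₂, h₃⟩ := mem_tarskiMoves_E₁.1 h
    exact ⟨i, h₁, .inl h₂, h₃⟩
  · obtain ⟨i, h₁, h₂, h₃⟩ := mem_tarskiMoves_E₂.1 h
    exact ⟨i, h₁, .inr h₂, h₃⟩

theorem RootPlay.exists_subAt {p : List (List ℕ)} (hp : RootPlay A p) {j : ℕ} {a : List ℕ}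
    (ha : p[j]? = some a) : ∃ B, subAt A a = some B :=
  ((Game.mem_finPlays _).1 hp.mem).1 j a ha

theorem RootPlay.length_of_getElem {p : List (List ℕ)} (hp : RootPlay A p) {j : ℕ} {a : List ℕ}
    (ha : p[j]? = some a) : a.length = j := by
  induction j generalizing a with
  | zero =>
    have := hp.head
    rw [List.head?_eq_getElem?, ha] at this
    cases this
    rfl
  | succ j ih =>
    have hj : j < p.length := by
      have := (List.getElem?_eq_some_iff.1 ha).1
      omega
    obtain ⟨i, rfl, -⟩ := hp.step (List.getElem?_eq_getElem hj) ha
    simp [ih (List.getElem?_eq_getElem hj)]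

theorem RootPlay.length_le {p : List (List ℕ)} (hp : RootPlay A p) :
    p.length ≤ A.size + 1 := by
  obtain ⟨q, a, rfl⟩ := hp.exists_concat
  have ha : (q ++ [a])[q.length]? = some a := by simp
  obtain ⟨B, hB⟩ := hp.exists_subAt ha
  have h₁ := hp.length_of_getElem ha
  have h₂ := size_subAt hB
  simp
  omega

@[simp] theorem lastOcc_concat (q : List (List ℕ)) (a : List ℕ) : lastOcc (q ++ [a]) = a := by
  simp [lastOcc]

theorem rho_concat (u : ClassTm K) (q : List (List ℕ)) (a : List ℕ) :
    rho A u (q ++ [a]) = occRealizer A u a := by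
  simp [rho]

theorem lastOcc_take {p : List (List ℕ)} {j : ℕ} {a : List ℕ} (h : p[j]? = some a) :
    lastOcc (p.take (j + 1)) = a := by
  rw [List.take_add_one, h]
  simp

theorem rho_take (u : ClassTm K) {p : List (List ℕ)} {j : ℕ} {a : List ℕ} (h : p[j]? = some a) :
    rho A u (p.take (j + 1)) = occRealizer A u a := by
  rw [rho, lastOcc_take h]

/-- If no move of player one in `p` is to be revised at `s`, then the realizers associated to the
positions in `p` realize them at `s`. -/
theorem RootPlay.realizesAt {u : ClassTm K} {s : State} (hs : RealizesAt s A u)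
    {p : List (List ℕ)} (hp : RootPlay A p) (hr : ∀ j, ¬ Revised A u s p j) {j : ℕ}
    {a : List ℕ} (ha : p[j]? = some a) {B : Formula} (hB : subAt A a = some B) :
    RealizesAt s B (occRealizer A u a) := by
  induction j generalizing a B with
  | zero =>
    have := hp.head
    rw [List.head?_eq_getElem?, ha] at this
    cases this
    cases hB
    exact hs
  | succ j ih =>
    have hj : j < p.length := by
      have := (List.getElem?_eq_some_iff.1 ha).1
      omega
    have hj' := List.getElem?_eq_getElem hj
    obtain ⟨i, rfl, ho, -⟩ := hp.step hj' ha
    have hr' := hr (j + 1)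
    simp only [Revised, not_and, not_exists, Nat.add_sub_cancel] at hr'
    -- The position with index `j` in the list is the `(j + 1)`-st of the play, so revision of the
    -- choice made there is indexed by `j + 1`.
    have hr'' := hr' (by omega) _ _ hj' ha
    rw [rho_take u hj'] at hr''
    generalize p[j] = b at *
    rcases ho with (⟨C, hC⟩ | ⟨C, D, hC⟩) | ⟨C, hC⟩ | ⟨C, D, hC⟩ <;>
      have ih := ih hj' hC <;>
      rw [occRealizer_append hC] <;>
      rw [subAt_append hC] at hB <;>
      rw [RealizesAt] at ih
    -- As the choice is not revised, it is the instance which the realizer indicates at `s`, and for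
    -- this instance the second component is a realizer.
    · have h₁ : LConv (approx s (.fst (occRealizer A u b))) (Tm.num i) := by
        by_contra h
        exact hr'' (.inl ⟨⟨C, hC⟩, h⟩)
      obtain ⟨n, h₂, h₃⟩ := ih
      obtain rfl := LConv.num_inj ((Conv.symm h₁).trans h₂)
      cases hB
      exact h₃
    · have hi : i = 0 ∨ i = 1 := by
        simp only [subAt] at hB
        split_ifs at hB with h h <;> simp [h]
      rcases hi with rfl | rfl
      · cases hB
        rcases ih with h | h
        · exact h.2
        · exact (hr'' (.inr ⟨⟨_, _, hC⟩, .inl ⟨rfl, h.1⟩⟩)).elim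
      · cases hB
        rcases ih with h | h
        · exact (hr'' (.inr ⟨⟨_, _, hC⟩, .inr ⟨rfl, h.1⟩⟩)).elim
        · exact h.2
    · cases hB
      exact ih i
    · simp only [subAt] at hB
      split_ifs at hB with h h
      · subst h
        cases hB
        exact ih.1
      · subst h
        cases hB
        exact ih.2

end Tarski

/-! ### Termination -/

section Termination

variable {A : Formula} {K : Calculus} {u : ClassTm K}

/-- The moves in plays of `1Back(T_A)` which are correct for `ω`, with the associated states. -/
inductive Step (A : Formula) (u : ClassTm K) :
    State → List (List ℕ) → State → List (List ℕ) → Prop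
  | abelard {s : State} {q : List (List ℕ)} {a : List ℕ} (b) : IsAbelard A a → Step A u s (q ++ [a]) s (q ++ [a] ++ [b])
  | ex {s : State} {q : List (List ℕ)} {a : List ℕ} {B n} : subAt A a = some (.ex B) →
      LConv (approx s (.fst (occRealizer A u a))) (Tm.num n) →
      Step A u s (q ++ [a]) s (q ++ [a] ++ [a ++ [n]])
  | or_left {s : State} {q : List (List ℕ)} {a : List ℕ} {B C} : subAt A a = some (.or B C) →
      LConv (approx s (.fst (occRealizer A u a))) .tt →
      Step A u s (q ++ [a]) s (q ++ [a] ++ [a ++ [0]])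
  | or_right {s : State} {q : List (List ℕ)} {a : List ℕ} {B C} : subAt A a = some (.or B C) →
      LConv (approx s (.fst (occRealizer A u a))) .ff →
      Step A u s (q ++ [a]) s (q ++ [a] ++ [a ++ [1]])
  | back {s : State} {q : List (List ℕ)} {a : List ℕ} {Q ts} : subAt A a = some (.atom Q ts) → ¬ TConv (Q.appList ts) .tt →
      Step A u s (q ++ [a]) (update s (occRealizer A u a))
        (backtrack A u (update s (occRealizer A u a)) (q ++ [a]))

theorem backtrack_eq (s : State) (p : List (List ℕ)) :
    (∃ j, Revised A u s p j ∧ backtrack A u s p = p.take j) ∨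
      (∀ j, ¬ Revised A u s p j) ∧ backtrack A u s p = p := by
  classical
  by_cases h : ∃ j, Revised A u s p j
  · exact .inl ⟨_, Nat.find_spec h, by rw [backtrack, dif_pos h]⟩
  · exact .inr ⟨by simpa using h, by rw [backtrack, dif_neg h]⟩

theorem Revised.bounds {s : State} {p : List (List ℕ)} {j : ℕ} (h : Revised A u s p j) :
    1 ≤ j ∧ j < p.length := by
  obtain ⟨h₁, a, i, -, h₂, -⟩ := h
  exact ⟨h₁, (List.getElem?_eq_some_iff.1 h₂).1⟩

theorem backtrack_prefix (s : State) (p : List (List ℕ)) : backtrack A u s p <+: p := by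
  rcases backtrack_eq (A := A) (u := u) s p with ⟨j, -, h⟩ | ⟨-, h⟩ <;> rw [h]
  exact List.take_prefix j p

theorem Step.subset {s s' : State} {p p' : List (List ℕ)} (h : Step A u s p s' p') :
    s.carrier ⊆ s'.carrier := by
  cases h with
  | back => exact subset_update s _
  | _ => exact subset_rfl

/-- A move extends the play or backtracks to an initial segment. -/
theorem Step.prefix_or {s s' : State} {p p' : List (List ℕ)} (h : Step A u s p s' p') :
    p <+: p' ∨ p' <+: p := by
  cases h with
  | back => exact .inr (backtrack_prefix _ _)
  | _ => exact .inl (List.prefix_append _ _)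

/-- If a correct move leaves a proper extension `r` of `q` for a play of which `r` is not an initial
segment, then a move at the end of `q` has been revised. -/
theorem Step.keeps {s s' : State} {p p' q : List (List ℕ)} {b : List ℕ}
    (h : Step A u s p s' p') (hp : q ++ [b] <+: p) (hp' : q <+: p')
    (hr : ¬ Revised A u s' p q.length) : q ++ [b] <+: p' := by
  cases h with
  | @back q₀ a Q ts =>
    rcases backtrack_eq (A := A) (u := u) (update s (occRealizer A u a)) (q₀ ++ [a]) with
      ⟨j, hj, e⟩ | ⟨-, e⟩
    · rw [e] at hp' ⊢
      have hlen := hp'.length_le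
      have hj' : j ≠ q.length := fun h => hr (h ▸ hj)
      have := hj.bounds
      rw [List.length_take] at hlen
      refine List.prefix_of_prefix_length_le hp (List.take_prefix _ _) ?_
      simp only [List.length_append, List.length_take, List.length_cons, List.length_nil] at *
      omega
    · rwa [e]
  | _ => exact hp.trans (List.prefix_append _ _)

/-- An infinite sequence of correct moves would settle on ever longer initial segments. To extend a
settled segment q, one waits until the realizer at its end has its final value along the increasing
states. If the play visits q after that, the move made at q is never revised, and q cannot end in a
false atom; if it does not, the position after q cannot change either, because moves only extend or
shorten. -/
theorem exists_eventually_prefix (hu : Realizes u A)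
    {S : ℕ → State} {p : ℕ → List (List ℕ)} (hp : ∀ i, RootPlay A (p i))
    (h : ∀ i, Step A u (S i) (p i) (S (i + 1)) (p (i + 1))) (k : ℕ) :
    ∃ (i₀ : ℕ) (q : List (List ℕ)), q.length = k + 1 ∧ ∀ i, i₀ ≤ i → q <+: p i := by
  have hst : Stable A.type u := hu.1.stable
  have hmono : ∀ i, (S i).carrier ⊆ (S (i + 1)).carrier := fun i => (h i).subset
  induction k with
  | zero =>
    refine ⟨0, [rootOcc], rfl, fun i _ => ?_⟩
    have := (hp i).head
    cases hpi : p i with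
    | nil => simp [hpi] at this
    | cons a l =>
      rw [hpi] at this
      cases this
      simp
  | succ k ih =>
    obtain ⟨i₀, q, hq, hpre⟩ := ih
    -- it suffices that from some stage on the play properly extends `q`
    -- and the move at the end of `q` is not revised
    have stay : ∀ i₁ b, i₀ ≤ i₁ → q ++ [b] <+: p i₁ →
        (∀ i, i₁ ≤ i → q ++ [b] <+: p i → ¬ Revised A u (S (i + 1)) (p i) q.length) →
        ∃ (i₀ : ℕ) (q : List (List ℕ)), q.length = k + 1 + 1 ∧ ∀ i, i₀ ≤ i → q <+: p i := by
      intro i₁ b hi₁ hb hr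
      refine ⟨i₁, q ++ [b], by simp [hq], fun i hi => ?_⟩
      induction i, hi using Nat.le_induction with
      | base => exact hb
      | succ i hi ih => exact (h i).keeps ih (hpre _ (by omega)) (hr i hi ih)
    obtain ⟨q₀, a, rfl⟩ : ∃ q₀ a, q = q₀ ++ [a] := by
      rcases List.eq_nil_or_concat q with rfl | ⟨q₀, a, rfl⟩
      · simp at hq
      · exact ⟨q₀, a, by simp⟩
    have hget : ∀ {r}, q₀ ++ [a] <+: r → r[q₀.length]? = some a := by
      rintro _ ⟨r, rfl⟩
      simp
    have hget' : ∀ {r b}, q₀ ++ [a] ++ [b] <+: r → r[q₀.length + 1]? = some b := by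
      rintro _ b ⟨r, rfl⟩
      simp
    obtain ⟨B, hB⟩ := (hp i₀).exists_subAt (hget (hpre i₀ le_rfl))
    have hstB := stable_occRealizer hst a
    rw [typeAt_eq hB] at hstB
    -- a stage from which on the realizer associated to `q` does not change its mind
    have hstable : ∃ i₁, i₀ ≤ i₁ ∧ ∀ j, i₁ ≤ j →
        (∀ B', B = .ex B' → LConv (approx (S j) (.fst (occRealizer A u a)))
          (approx (S i₁) (.fst (occRealizer A u a)))) ∧
        (∀ B' C, B = .or B' C → LConv (approx (S j) (.fst (occRealizer A u a)))
          (approx (S i₁) (.fst (occRealizer A u a)))) ∧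
        (∀ Q ts, B = .atom Q ts → LConv (approx (S j) (occRealizer A u a))
          (approx (S i₁) (occRealizer A u a))) := by
      have key : ∀ {t : ClassTm K}, Converges t → ∃ i₁, i₀ ≤ i₁ ∧ ∀ j, i₁ ≤ j →
          LConv (approx (S j) t) (approx (S i₁) t) := by
        intro t ht
        obtain ⟨i, hi⟩ := ht.eventually_eq hmono
        exact ⟨max i₀ i, le_max_left _ _, fun j hj =>
          (hi j ((le_max_right _ _).trans hj)).trans (hi _ (le_max_right _ _)).symm⟩
      cases B with
      | ex B' =>
        obtain ⟨i₁, h₁, h₂⟩ := key hstB.2.1.2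
        exact ⟨i₁, h₁, fun j hj => ⟨fun _ _ => h₂ j hj, by simp, by simp⟩⟩
      | or B' C =>
        obtain ⟨i₁, h₁, h₂⟩ := key hstB.2.1.2
        exact ⟨i₁, h₁, fun j hj => ⟨by simp, fun _ _ _ => h₂ j hj, by simp⟩⟩
      | atom Q ts =>
        obtain ⟨i₁, h₁, h₂⟩ := key hstB.2
        exact ⟨i₁, h₁, fun j hj => ⟨by simp, by simp, fun _ _ _ => h₂ j hj⟩⟩
      | _ => exact ⟨i₀, le_rfl, fun j hj => ⟨by simp, by simp, by simp⟩⟩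
    obtain ⟨i₁, hi₁, hstable⟩ := hstable
    -- Does the play return to the settled segment itself after its realizer has stopped changing?
    by_cases hall : ∃ i, i₁ ≤ i ∧ p i = q₀ ++ [a]
    · obtain ⟨i, hi, hpi⟩ := hall
      have hi' := h i
      have hpre' := hpre (i + 1) (by omega)
      rw [hpi] at hi'
      generalize hs : S (i + 1) = s' at hi'
      generalize hr : p (i + 1) = r at hi' hpre'
      generalize hl : q₀ ++ [a] = l at hi'
      -- A revision at the end of the settled segment contradicts either the kind of position or the
      -- indication of the realizer of `a` at the later state.
      have revised : ∀ {j b}, q₀ ++ [a] ++ [b] <+: p j →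
          Revised A u (S (j + 1)) (p j) (q₀ ++ [a]).length → ∃ n, b = a ++ [n] ∧
            (((∃ B, subAt A a = some (.ex B)) ∧
              ¬ LConv (approx (S (j + 1)) (.fst (occRealizer A u a))) (Tm.num n)) ∨
            ((∃ B C, subAt A a = some (.or B C)) ∧
              ((n = 0 ∧ LConv (approx (S (j + 1)) (.fst (occRealizer A u a))) .ff) ∨
              (n = 1 ∧ LConv (approx (S (j + 1)) (.fst (occRealizer A u a))) .tt)))) := by
        rintro j b hb ⟨-, a', n, h₁, h₂, h₃⟩
        have ha := hget ((List.prefix_append _ _).trans hb)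
        simp only [List.length_append, List.length_cons, List.length_nil, zero_add,
          Nat.add_sub_cancel] at h₁ h₂ h₃
        rw [ha] at h₁
        cases h₁
        rw [rho_take u ha] at h₃
        rw [hget' hb] at h₂
        exact ⟨n, Option.some.inj h₂, h₃⟩
      cases hi' with
      | @abelard q a' b hab =>
        obtain ⟨rfl, ha'⟩ := List.append_inj' hl rfl
        obtain rfl := (List.cons.inj ha').1
        refine stay (i + 1) b (by omega) (hr ▸ List.prefix_rfl) fun j _ hj hR => ?_
        obtain ⟨n, -, ⟨⟨B, hB⟩, -⟩ | ⟨⟨B, C, hB⟩, -⟩⟩ := revised hj hR <;>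
        rcases hab with ⟨D, hD⟩ | ⟨D, E, hD⟩ <;> rw [hB] at hD <;> cases hD
      | @ex q a' B' n hB' hn =>
        obtain ⟨rfl, ha'⟩ := List.append_inj' hl rfl
        obtain rfl := (List.cons.inj ha').1
        obtain rfl := Option.some.inj (hB.symm.trans hB')
        refine stay (i + 1) _ (by omega) (by rw [hr]) fun j hj hj' hR => ?_
        obtain ⟨m, hm, ⟨-, hR⟩ | ⟨⟨_, _, h⟩, -⟩⟩ := revised hj' hR
        · obtain rfl : n = m := by simpa using hm
          -- The instance `n` was indicated at stage `i`, and the indication has not changed since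
          -- stage `i₁`.
          exact hR (((hstable (j + 1) (by omega)).1 _ rfl).trans
            (((hstable i hi).1 _ rfl).symm.trans hn))
        · rw [hB] at h; cases h
      | @or_left q a' B' C hB' hn =>
        obtain ⟨rfl, ha'⟩ := List.append_inj' hl rfl
        obtain rfl := (List.cons.inj ha').1
        obtain rfl := Option.some.inj (hB.symm.trans hB')
        refine stay (i + 1) _ (by omega) (by rw [hr]) fun j hj hj' hR => ?_
        have hc := ((hstable (j + 1) (by omega)).2.1 _ _ rfl).trans
            (((hstable i hi).2.1 _ _ rfl).symm.trans hn)
        obtain ⟨m, hm, ⟨⟨_, h⟩, -⟩ | ⟨-, ⟨-, hR⟩ | ⟨rfl, -⟩⟩⟩ := revised hj' hR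
        · rw [hB] at h; cases h
        · exact LConv.not_tt_ff ((Conv.symm hc).trans hR)
        · simp at hm
      | @or_right q a' B' C hB' hn =>
        obtain ⟨rfl, ha'⟩ := List.append_inj' hl rfl
        obtain rfl := (List.cons.inj ha').1
        obtain rfl := Option.some.inj (hB.symm.trans hB')
        refine stay (i + 1) _ (by omega) (by rw [hr]) fun j hj hj' hR => ?_
        have hc := ((hstable (j + 1) (by omega)).2.1 _ _ rfl).trans
            (((hstable i hi).2.1 _ _ rfl).symm.trans hn)
        obtain ⟨m, hm, ⟨⟨_, h⟩, -⟩ | ⟨-, ⟨rfl, -⟩ | ⟨-, hR⟩⟩⟩ := revised hj' hR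
        · rw [hB] at h; cases h
        · simp at hm
        · exact LConv.not_tt_ff ((Conv.symm hR).trans hc)
      | @back q a' Q ts hB' hQ =>
        obtain ⟨rfl, ha'⟩ := List.append_inj' hl rfl
        obtain rfl := (List.cons.inj ha').1
        obtain rfl := Option.some.inj (hB.symm.trans hB')
        exfalso
        -- Backtracking to a proper initial segment would leave the settled segment. If nothing is
        -- revised, the realizer of the false atom is correct at the new state, so its value there
        -- must be nonempty. By stability that value is the `e` just learned, which is already in
        -- the new state and yet fresh for it.
        rcases backtrack_eq (A := A) (u := u) (update (S i) (occRealizer A u a)) (q₀ ++ [a]) with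
          ⟨j, hj, e⟩ | ⟨hj, e⟩
        · rw [e] at hpre'
          have := hpre'.length_le
          rw [List.length_take] at this
          have := hj.bounds
          omega
        · rw [← hs] at hj
          rw [e] at hr
          have hreal := RootPlay.realizesAt (hu.2 (S (i + 1))) (hr ▸ hp (i + 1)) hj
            (hget List.prefix_rfl) hB
          rw [RealizesAt] at hreal
          obtain ⟨e, he⟩ := Stable.exists_stc hstB (S i)
          have he' : LConv (approx (S (i + 1)) (occRealizer A u a)) (stc e) :=
            ((hstable (i + 1) (by omega)).2.2 _ _ rfl).trans
              (((hstable i hi).2.2 _ _ rfl).symm.trans he)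
          have hes := hasEmptyState_occRealizer (A := A) hu.1.2.1 a
          have hsub : e.carrier ⊆ (S (i + 1)).carrier := by
            rw [hs, update, he.stateValue_eq]
            exact (hes.fresh he).subset_cunion
          rw [State.eq_empty_of_fresh (hes.fresh he') hsub] at he'
          exact hQ (hreal he')
    · push Not at hall
      -- All later positions properly extend the settled segment. Successive positions are
      -- comparable as initial segments, so they agree on the next element.
      have hlt : ∀ i, i₁ ≤ i → ∃ b, q₀ ++ [a] ++ [b] <+: p i := by
        intro i hi
        obtain ⟨r, hr⟩ := hpre i (by omega)
        cases r with
        | nil => exact absurd (by simpa using hr.symm) (hall i hi)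
        | cons b r => exact ⟨b, r, by rw [← hr]; simp⟩
      obtain ⟨b, hb⟩ := hlt i₁ le_rfl
      refine ⟨i₁, q₀ ++ [a] ++ [b], by simp at hq ⊢; omega, fun i hi => ?_⟩
      induction i, hi using Nat.le_induction with
      | base => exact hb
      | succ i hi ih =>
        rcases (h i).prefix_or with h' | h'
        · exact ih.trans h'
        · obtain ⟨b', hb'⟩ := hlt (i + 1) (by omega)
          have := List.prefix_of_prefix_length_le ih (hb'.trans h') (by simp)
          have e := this.eq_of_length (by simp)
          rwa [e]

/-- There is no infinite sequence of correct moves. -/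
theorem not_forall_step (hu : Realizes u A) {S : ℕ → State}
    {p : ℕ → List (List ℕ)} (hp : ∀ i, RootPlay A (p i))
    (h : ∀ i, Step A u (S i) (p i) (S (i + 1)) (p (i + 1))) : False := by
  -- The settled segment has length `A.size + 2`, one more than a play of `T_A` can have.
  obtain ⟨i₀, q, hq, hpre⟩ := exists_eventually_prefix hu hp h (A.size + 1)
  have h₁ := (hpre i₀ le_rfl).length_le
  have h₂ := (hp i₀).length_le
  omega

end Termination

/-! ### The strategy is winning -/

section OneBackMoves

variable {α : Type} {G : Game α}

/-- For forward moves, player one is on the move at `a`, so player two is not and the play is not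
complete, hence not won; for backtracking moves these are the side conditions of the move. -/
theorem of_mem_dom_oneBack_E₁ {p : List α} {a : α} (h : p ++ [a] ∈ Dom (oneBack G).E₁) :
    p ++ [a] ∈ G.finPlays ∧ a ∉ Dom G.E₂ ∧ (↑(p ++ [a]) : Seq α) ∉ G.W := by
  obtain ⟨r, h | h⟩ := h
  · obtain ⟨q, b, c, h₁, h₂, e⟩ := h
    obtain ⟨rfl, e'⟩ := List.append_inj' (Prod.ext_iff.1 e).1 rfl
    obtain rfl : a = b := by simpa using e'
    refine ⟨h₁, fun h => Set.disjoint_left.1 G.disjoint ⟨c, h₂⟩ h, fun h => ?_⟩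
    obtain ⟨-, h | ⟨l, v, e, hv⟩⟩ := G.W_sub _ h
    · exact h (Stream'.Seq.terminates_ofList _)
    · have e := Stream'.Seq.ofList_injective e
      obtain rfl : a = v := by simpa using (List.append_inj' e rfl).2
      exact hv ⟨c, .inl h₂⟩
  · obtain ⟨q, b, r, h₁, -, h₂, h₃, e⟩ := h
    have e := (Prod.ext_iff.1 e).1
    simp only at e
    rw [e]
    refine ⟨h₁, h₂ a ?_, h₃⟩
    have := congrArg List.getLast? e
    rw [List.getLast?_append_of_ne_nil _ (by simp : b :: r ≠ [])] at this
    simpa using this.symm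

/-- The case of an empty `q` in `backMoves`. It keeps player one from ever being stuck at a position
that is not won and where player two is not on the move. -/
theorem dummy_mem_oneBack_E₁ {p : List α} {a : α} (h₁ : p ++ [a] ∈ G.finPlays)
    (h₂ : a ∉ Dom G.E₂) (h₃ : (↑(p ++ [a]) : Seq α) ∉ G.W) :
    (p ++ [a], p ++ [a]) ∈ (oneBack G).E₁ := by
  refine .inr ⟨p, a, [], h₁, .inr rfl, ?_, h₃, rfl⟩
  rintro d hd
  obtain rfl : a = d := by simpa using hd
  exact h₂

theorem exists_concat_of_mem_dom_oneBack_E₁ {p : List α} (h : p ∈ Dom (oneBack G).E₁) :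
    ∃ q a, p = q ++ [a] := by
  rcases List.eq_nil_or_concat p with rfl | ⟨q, a, rfl⟩
  · obtain ⟨r, ⟨q, b, c, -, -, e⟩ | ⟨q, b, r, -, -, -, -, e⟩⟩ := h <;> simp at e
  · exact ⟨q, a, by simp⟩

theorem take_add_one_of_get? {s : Seq α} {i : ℕ} {v : α} (h : s.get? i = some v) :
    s.take (i + 1) = s.take i ++ [v] := by
  apply List.ext_getElem?
  intro k
  have hlen : (s.take i).length = i :=
    Stream'.Seq.length_take_of_le_length fun _ => by
      rcases i with _ | i
      · simp
      · apply Nat.le_of_lt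
        exact Stream'.Seq.lt_length_iff.2 ⟨v, h⟩
  rw [Stream'.Seq.getElem?_take, List.getElem?_append, hlen, Stream'.Seq.getElem?_take]
  rcases Nat.lt_trichotomy k i with hk | rfl | hk
  · simp [hk, Nat.lt_succ_of_lt hk]
  · simp [h]
  · have : ¬ k < i + 1 := by omega
    have h' : ¬ k < i := by omega
    simp only [this, h', if_false]
    rw [List.getElem?_eq_none]
    simp
    omega

end OneBackMoves

/-! ### Legality and outcome of the strategy -/

section Winning

variable {A : Formula} {K : Calculus} {u : ClassTm K}

theorem rootPlay_of_isPlay {P : Seq (List (List ℕ))} (hP : (oneBack (tarski A)).IsPlay P)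
    (h0 : Game.StartsFrom rootPlay P) {i : ℕ} {p : List (List ℕ)} (hp : P.get? i = some p) :
    RootPlay A p := by
  induction i generalizing p with
  | zero =>
    rw [Game.StartsFrom, hp] at h0
    cases h0
    exact rootPlay_rootPlay
  | succ i ih =>
    obtain ⟨q, hq⟩ : ∃ q, P.get? i = some q := by
      exact P.ge_stable (Nat.le_succ i) hp
    have h := ih hq
    have key : ∀ {E}, E ⊆ (tarski A).E₁ ∪ (tarski A).E₂ → (q, p) ∈ forwardMoves (tarski A) E →
        RootPlay A p := by
      rintro E hE ⟨r, a, b, -, hab, e⟩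
      cases e
      exact h.concat (hE hab)
    rcases hP.2 i q p hq hp with (h' | h') | h'
    · exact key Set.subset_union_left h'
    · obtain ⟨r, a, b, -, -, -, -, e⟩ := h'
      cases e
      exact h.of_prefix ⟨b, by simp⟩ (by simp)
    · exact key Set.subset_union_right h'

/-- `stateFrom` consumes the play from the front, whereas a play in progress grows at its end. -/
theorem stateFrom_concat (s : State) (Q : List (List (List ℕ))) (p p' : List (List ℕ)) :
    stateFrom A u s (Q ++ [p, p']) = nextState A u (stateFrom A u s (Q ++ [p])) p p' := by
  induction Q generalizing s with
  | nil => simp [stateFrom]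
  | cons q Q ih =>
    cases Q with
    | nil => simp [stateFrom]
    | cons q' Q => exact ih _

theorem isTrueAtom_mem_W {q : List (List ℕ)} {a : List ℕ} (h : q ++ [a] ∈ (tarski A).finPlays)
    (ha : IsTrueAtom A a) : (↑(q ++ [a]) : Seq (List ℕ)) ∈ (tarski A).W := by
  refine ⟨⟨h, .inr ⟨q, a, rfl, ?_⟩⟩, q, a, rfl, ha⟩
  obtain ⟨Q, ts, hQ, -⟩ := ha
  rintro ⟨b, h | h⟩
  · obtain ⟨B, h⟩ | ⟨B, C, h⟩ := mem_dom_E₁.1 ⟨b, h⟩ <;> rw [hQ] at h <;> cases h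
  · obtain ⟨B, h⟩ | ⟨B, C, h⟩ := mem_dom_E₂.1 ⟨b, h⟩ <;> rw [hQ] at h <;> cases h

/-- A revised move was made at a position of player one, and the initial segment ending there is a
legal target; without a revised move the result is the dummy move. -/
theorem backtrack_mem {s : State} {q : List (List ℕ)} {a : List ℕ}
    (h₁ : q ++ [a] ∈ (tarski A).finPlays) (h₂ : a ∉ Dom (tarski A).E₂)
    (h₃ : (↑(q ++ [a]) : Seq (List ℕ)) ∉ (tarski A).W) :
    (q ++ [a], backtrack A u s (q ++ [a])) ∈ (oneBack (tarski A)).E₁ := by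
  rcases backtrack_eq (A := A) (u := u) s (q ++ [a]) with ⟨j, hj, e⟩ | ⟨-, e⟩
  · rw [e]
    have hb := hj.bounds
    obtain ⟨h0, a', i, ha', -, hE⟩ := hj
    obtain ⟨j, rfl⟩ : ∃ k, j = k + 1 := ⟨j - 1, by omega⟩
    simp only [Nat.add_sub_cancel] at ha'
    obtain ⟨hlt, hget⟩ := List.getElem?_eq_some_iff.1 ha'
    have e₁ : q ++ [a] = (q ++ [a]).take j ++ a' :: (q ++ [a]).drop (j + 1) := by
      rw [← hget, List.cons_getElem_drop_succ, List.take_append_drop]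
    have e₂ : (q ++ [a]).take (j + 1) = (q ++ [a]).take j ++ [a'] := by
      rw [List.take_add_one, ha']; rfl
    refine .inr ⟨(q ++ [a]).take j, a', (q ++ [a]).drop (j + 1), e₁ ▸ h₁, .inl ?_, ?_, e₁ ▸ h₃,
      Prod.ext e₁ e₂⟩
    · exact mem_dom_E₁.2 (hE.imp And.left And.left)
    · intro d hd
      have := congrArg List.getLast? e₁
      rw [List.getLast?_append_of_ne_nil _ (by simp : a' :: _ ≠ []), hd] at this
      obtain rfl : a = d := by simpa using this
      exact h₂
  · rw [e]
    exact dummy_mem_oneBack_E₁ h₁ h₂ h₃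

theorem move_mem (s : State) {p : List (List ℕ)} (hp : p ∈ Dom (oneBack (tarski A)).E₁) :
    (p, move A u s p) ∈ (oneBack (tarski A)).E₁ := by
  obtain ⟨q, a, rfl⟩ := exists_concat_of_mem_dom_oneBack_E₁ hp
  obtain ⟨h₁, h₂, h₃⟩ := of_mem_dom_oneBack_E₁ hp
  have hd := dummy_mem_oneBack_E₁ h₁ h₂ h₃
  have hl : lastOcc (q ++ [a]) = a := by simp [lastOcc]
  unfold move
  rw [hl]
  split
  · next B hB => exact .inl ⟨q, a, _, h₁, ex_move hB _, by rw [List.append_assoc]; rfl⟩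
  · next B C hB =>
    refine .inl ⟨q, a, _, h₁, or_move hB ?_, by rw [List.append_assoc]; rfl⟩
    split <;> simp
  · split
    · exact backtrack_mem h₁ h₂ h₃
    · exact hd
  · exact hd

theorem move_mem_finPlays (s : State) {p : List (List ℕ)} (hp : RootPlay A p) :
    move A u s p ∈ (tarski A).finPlays := by
  obtain ⟨q, a, rfl⟩ := hp.exists_concat
  have hl : lastOcc (q ++ [a]) = a := by simp [lastOcc]
  unfold move
  rw [hl]
  split
  · next B hB =>
    rw [List.append_assoc]
    exact Game.mem_finPlays_concat _ hp.mem (.inl (ex_move hB _))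
  · next B C hB =>
    rw [List.append_assoc]
    refine Game.mem_finPlays_concat _ hp.mem (.inl (or_move hB ?_))
    split <;> simp
  · split
    · obtain ⟨r, hr⟩ := backtrack_prefix (A := A) (u := u)
        (update s (rho A u (q ++ [a]))) (q ++ [a])
      exact Game.mem_finPlays_of_append (q := r) _ (hr.symm ▸ hp.mem)
    · exact hp.mem
  · exact hp.mem

theorem isStrategy_omega : (oneBack (tarski A)).IsStrategy (omega A u) := by
  refine ⟨fun P hP => ?_, fun P p hP hp => ?_⟩
  · rcases List.eq_nil_or_concat P with rfl | ⟨Q, p, rfl⟩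
    -- On the empty play the value is the default `[]`, which is a position because the empty
    -- sequence is a play of `T_A`.
    · exact (Game.mem_finPlays _).2 ⟨by simp [omega], by simp [omega]⟩
    · simp only [List.concat_eq_append] at hP ⊢
      have hQ : (Q ++ [p])[Q.length]? = some p := by simp
      unfold omega
      split
      · next h =>
        have h' : Game.StartsFrom rootPlay (↑(Q ++ [p]) : Seq (List (List ℕ))) := by
          rw [Game.StartsFrom, Stream'.Seq.ofList_get?, ← List.head?_eq_getElem?, h]
        have := move_mem_finPlays (u := u) (playState A u (Q ++ [p]))
          (rootPlay_of_isPlay hP h' ((Stream'.Seq.ofList_get? _ _).trans hQ))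
        rwa [List.getLast?_concat]
      · simpa using ((Game.mem_finPlays _).1 hP).1 _ p hQ
  · rw [List.append_assoc]
    refine Game.mem_finPlays_concat _ hP (.inl ?_)
    unfold omega
    split
    · simpa using move_mem _ hp
    · obtain ⟨q, a, rfl⟩ := exists_concat_of_mem_dom_oneBack_E₁ hp
      obtain ⟨h₁, h₂, h₃⟩ := of_mem_dom_oneBack_E₁ hp
      simpa using dummy_mem_oneBack_E₁ h₁ h₂ h₃

/-- Passage from the game to the relation on which termination was proved. Stability provides the
values that `numValue` and the test in `move` refer to, and two-valuedness of closed atoms shows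
that a position not won ends in a false one. -/
theorem Step.of_mem (hst : Stable A.type u) (hA : A.Closed) (hA' : A.ImpFree) {s : State}
    {p p' : List (List ℕ)} (hp : RootPlay A p)
    (h : (p, p') ∈ (oneBack (tarski A)).E₁ ∪ (oneBack (tarski A)).E₂)
    (hm : (p, p') ∈ (oneBack (tarski A)).E₁ → move A u s p = p') :
    Step A u s p (nextState A u s p p') p' := by
  obtain ⟨q, a, rfl⟩ := hp.exists_concat
  -- A forward move lengthens the play, so the condition for an update fails.
  have hfwd : ∀ b, nextState A u s (q ++ [a]) (q ++ [a] ++ [b]) = s := by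
    intro b
    refine if_neg fun h => ?_
    have := h.1.length_le
    simp at this
  rcases h with h | h
  · obtain ⟨h₁, h₂, h₃⟩ := of_mem_dom_oneBack_E₁ ⟨_, h⟩
    obtain rfl := hm h
    obtain ⟨B, hB⟩ := hp.exists_subAt (j := q.length) (a := a) (by simp)
    have hstB := stable_occRealizer hst a
    rw [typeAt_eq hB] at hstB
    have hl : lastOcc (q ++ [a]) = a := by simp [lastOcc]
    cases B with
    | ex B =>
      simp only [move, hl, hB, hfwd]
      rw [rho_concat]
      exact .ex hB (hstB.2.1.conv_numValue s)
    | or B C =>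
      simp only [move, hl, hB, hfwd]
      rw [rho_concat]
      split
      · next h => exact .or_left hB h
      · next h => exact .or_right hB ((hstB.2.1.tt_or_ff s).resolve_left h)
    | atom Q ts =>
      have hff : TConv (Q.appList ts) .ff := by
        refine (Formula.WF.conv_bool (wf_subAt hB hA)).resolve_left fun h => h₃ ?_
        exact isTrueAtom_mem_W h₁ ⟨Q, ts, hB, h⟩
      simp only [move, hl, hB, hff, if_true]
      -- The state is updated even when the backtracking is a dummy move, since a play is an initial
      -- segment of itself.
      rw [nextState, if_pos ⟨backtrack_prefix _ _, by rw [rho_concat]; exact hstB.closed⟩,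
        rho_concat]
      exact .back hB fun h => h.not_tt_ff hff
    | and B C => exact absurd (mem_dom_E₂.2 (.inr ⟨B, C, hB⟩)) h₂
    | all B => exact absurd (mem_dom_E₂.2 (.inl ⟨B, hB⟩)) h₂
    | imp B C => exact (impFree_subAt hB hA').elim
  · obtain ⟨r, c, b, -, hab, e⟩ := h
    obtain ⟨e₁, rfl⟩ := Prod.ext_iff.1 e
    obtain ⟨rfl, e'⟩ := List.append_inj' e₁ rfl
    obtain rfl : a = c := by simpa using e'
    have e : q ++ [a, b] = q ++ [a] ++ [b] := by simp
    simp only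
    rw [e, hfwd]
    exact .abelard b (mem_dom_E₂.1 ⟨b, hab⟩)

/-- An infinite correct play, read with the states of its finite initial parts, would be an infinite
sequence of the moves in `Step`. -/
theorem terminates_of_correct (hA : A.Closed) (hA' : A.ImpFree) (hu : Realizes u A)
    {P : Seq (List (List ℕ))} (hP : (oneBack (tarski A)).IsPlay P)
    (h0 : Game.StartsFrom rootPlay P) (hc : (oneBack (tarski A)).Correct (omega A u) P) :
    P.Terminates := by
  by_contra hT
  have hsome : ∀ i, ∃ p, P.get? i = some p := by
    intro i
    by_contra h
    exact hT ⟨i, Option.eq_none_iff_forall_ne_some.2 (by simpa using h)⟩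
  choose p hp using hsome
  have hroot : ∀ i, RootPlay A (p i) := fun i => rootPlay_of_isPlay hP h0 (hp i)
  refine not_forall_step hu (S := fun i => playState A u (P.take (i + 1))) hroot fun i => ?_
  have e : P.take (i + 1) = P.take i ++ [p i] := take_add_one_of_get? (hp i)
  have hS : playState A u (P.take (i + 1 + 1)) =
      nextState A u (playState A u (P.take (i + 1))) (p i) (p (i + 1)) := by
    rw [take_add_one_of_get? (hp (i + 1)), e, playState, playState, ← stateFrom_concat,
      List.append_assoc]
    rfl
  simp only [hS]
  refine Step.of_mem hu.1.stable hA hA' (hroot i) (hP.2 i _ _ (hp i) (hp (i + 1))) fun h => ?_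
  have := hc i _ _ (hp i) (hp (i + 1)) h
  have hhead : (P.take (i + 1)).head? = some rootPlay := by
    rw [List.head?_eq_getElem?, Stream'.Seq.getElem?_take, if_pos (by omega)]
    exact h0
  rw [omega, if_pos hhead] at this
  rw [← this, e]
  simp

/-- At a final position that is not won, either player two could move, or else the dummy move is
available; both contradict completeness. -/
theorem mem_W_of_complete (hA : A.Closed) (hA' : A.ImpFree) (hu : Realizes u A)
    {P : Seq (List (List ℕ))} (hP : (oneBack (tarski A)).IsComplete P)
    (h0 : Game.StartsFrom rootPlay P) (hc : (oneBack (tarski A)).Correct (omega A u) P) :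
    P ∈ (oneBack (tarski A)).W := by
  refine ⟨hP, ?_⟩
  obtain ⟨hw, h | ⟨Q, p, rfl, hp⟩⟩ := hP
  · exact absurd (terminates_of_correct hA hA' hu hw h0 hc) h
  refine ⟨Q, p, rfl, ?_⟩
  have hr : RootPlay A p :=
    rootPlay_of_isPlay hw h0 (i := Q.length) (by rw [Stream'.Seq.ofList_get?]; simp)
  obtain ⟨q, a, rfl⟩ := hr.exists_concat
  by_contra hW
  refine hp ⟨_, .inl (dummy_mem_oneBack_E₁ hr.mem (fun h => ?_) hW)⟩
  obtain ⟨b, h⟩ := h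
  exact hp ⟨_, .inr ⟨q, a, b, hr.mem, h, rfl⟩⟩

end Winning

theorem exists_trueAtom_of_mem_W {A : Formula} {P : Seq (List (List ℕ))}
    (h : P ∈ (oneBack (tarski A)).W) : ∃ (Q : List (List (List ℕ))) (p : List (List ℕ))
      (a : List ℕ), P = ↑(Q ++ [p ++ [a]]) ∧ IsTrueAtom A a := by
  obtain ⟨-, Q, p, rfl, -, q, a, e, ha⟩ := h
  obtain rfl := Stream'.Seq.ofList_injective e
  exact ⟨Q, q, a, rfl, ha⟩

/-! ### Recursively enumerable relations -/

attribute [fun_prop] Primrec PrimrecPred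

/-! ### Closure properties of primitive recursive functions and predicates -/

namespace Primrec

variable {α β γ : Type*} [Primcodable α] [Primcodable β] [Primcodable γ]

@[fun_prop] theorem id_fun : Primrec fun a : α => a := Primrec.id

@[fun_prop] theorem const_fun (b : β) : Primrec fun _ : α => b := Primrec.const b

@[fun_prop] theorem comp_fun {f : β → γ} {g : α → β} (hf : Primrec f) (hg : Primrec g) :
    Primrec fun a => f (g a) := hf.comp hg

@[fun_prop] theorem prodFst {f : α → β × γ} (hf : Primrec f) : Primrec fun a => (f a).1 :=
  Primrec.fst.comp hf

@[fun_prop] theorem prodSnd {f : α → β × γ} (hf : Primrec f) : Primrec fun a => (f a).2 :=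
  Primrec.snd.comp hf

@[fun_prop] theorem prodMk {f : α → β} {g : α → γ} (hf : Primrec f) (hg : Primrec g) :
    Primrec fun a => (f a, g a) := hf.pair hg

@[fun_prop] theorem natPair {f g : α → ℕ} (hf : Primrec f) (hg : Primrec g) :
    Primrec fun a => Nat.pair (f a) (g a) := Primrec₂.natPair.comp hf hg

@[fun_prop] theorem natSub {f g : α → ℕ} (hf : Primrec f) (hg : Primrec g) :
    Primrec fun a => f a - g a := Primrec.nat_sub.comp hf hg

@[fun_prop] theorem encode_fun {f : α → β} (hf : Primrec f) :
    Primrec fun a => Encodable.encode (f a) := Primrec.encode.comp hf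

@[fun_prop] theorem someFun {f : α → β} (hf : Primrec f) : Primrec fun a => some (f a) :=
  Primrec.option_some.comp hf

@[fun_prop] theorem optionGetD {f : α → Option β} {g : α → β} (hf : Primrec f) (hg : Primrec g) :
    Primrec fun a => (f a).getD (g a) := Primrec.option_getD.comp hf hg

@[fun_prop] theorem listCons {f : α → β} {g : α → List β} (hf : Primrec f) (hg : Primrec g) :
    Primrec fun a => f a :: g a := Primrec.list_cons.comp hf hg

@[fun_prop] theorem listAppend {f g : α → List β} (hf : Primrec f) (hg : Primrec g) :
    Primrec fun a => f a ++ g a := Primrec.list_append.comp hf hg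

@[fun_prop] theorem listLength {f : α → List β} (hf : Primrec f) :
    Primrec fun a => (f a).length := Primrec.list_length.comp hf

@[fun_prop] theorem listTail {f : α → List β} (hf : Primrec f) :
    Primrec fun a => (f a).tail := Primrec.list_tail.comp hf

@[fun_prop] theorem listHead? {f : α → List β} (hf : Primrec f) :
    Primrec fun a => (f a).head? := Primrec.list_head?.comp hf

@[fun_prop] theorem listGetElem? {f : α → List β} {g : α → ℕ} (hf : Primrec f) (hg : Primrec g) :
    Primrec fun a => (f a)[g a]? := Primrec.list_getElem?.comp hf hg

@[fun_prop] theorem listGetLast? {f : α → List β} (hf : Primrec f) :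
    Primrec fun a => (f a).getLast? := by
  simp only [List.getLast?_eq_getElem?]
  fun_prop

@[fun_prop] theorem listTake {f : α → ℕ} {g : α → List β} (hf : Primrec f) (hg : Primrec g) :
    Primrec fun a => (g a).take (f a) := Primrec.list_take.comp hf hg

@[fun_prop] theorem listMap {f : α → List β} {g : α → β → γ} (hf : Primrec f)
    (hg : Primrec fun p : α × β => g p.1 p.2) : Primrec fun a => (f a).map (g a) :=
  Primrec.list_map hf hg

@[fun_prop] theorem listRange {f : α → ℕ} (hf : Primrec f) :
    Primrec fun a => List.range (f a) := Primrec.list_range.comp hf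

@[fun_prop] theorem listFoldr {f : α → List β} {g : α → γ} {h : α → β → γ → γ} (hf : Primrec f)
    (hg : Primrec g) (hh : Primrec fun p : α × β × γ => h p.1 p.2.1 p.2.2) :
    Primrec fun a => (f a).foldr (h a) (g a) :=
  Primrec.list_foldr (h := fun a p => h a p.1 p.2) hf hg hh

@[fun_prop] theorem natRec {f : α → ℕ} {g : α → β} {h : α → ℕ → β → β} (hf : Primrec f)
    (hg : Primrec g) (hh : Primrec fun p : α × ℕ × β => h p.1 p.2.1 p.2.2) :
    Primrec fun a => Nat.rec (motive := fun _ => β) (g a) (h a) (f a) :=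
  Primrec.nat_rec' (h := fun a p => h a p.1 p.2) hf hg hh

end Primrec

namespace PrimrecPred

variable {α β : Type*} [Primcodable α] [Primcodable β]

@[fun_prop] theorem const_fun (p : Prop) : PrimrecPred fun _ : α => p := by
  classical
  exact ⟨fun _ => Classical.dec p, Primrec.const _⟩

@[fun_prop] theorem eq_fun {f g : α → β} (hf : Primrec f) (hg : Primrec g) :
    PrimrecPred fun a => f a = g a := Primrec.eq.comp hf hg

@[fun_prop] theorem natLt {f g : α → ℕ} (hf : Primrec f) (hg : Primrec g) :
    PrimrecPred fun a => f a < g a := Primrec.nat_lt.comp hf hg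

@[fun_prop] theorem natLe {f g : α → ℕ} (hf : Primrec f) (hg : Primrec g) :
    PrimrecPred fun a => f a ≤ g a := Primrec.nat_le.comp hf hg

@[fun_prop] theorem not_fun {p : α → Prop} (hp : PrimrecPred p) : PrimrecPred fun a => ¬ p a :=
  hp.not

@[fun_prop] theorem and_fun {p q : α → Prop} (hp : PrimrecPred p) (hq : PrimrecPred q) :
    PrimrecPred fun a => p a ∧ q a := hp.and hq

@[fun_prop] theorem or_fun {p q : α → Prop} (hp : PrimrecPred p) (hq : PrimrecPred q) :
    PrimrecPred fun a => p a ∨ q a := hp.or hq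

@[fun_prop] theorem forall_mem {f : α → List β} {p : α → β → Prop} (hf : Primrec f)
    (hp : PrimrecPred fun x : α × β => p x.1 x.2) : PrimrecPred fun a => ∀ b ∈ f a, p a b :=
  (PrimrecRel.forall_mem_list (R := fun b a => p a b)
    (hp.comp (f := fun x : β × α => (x.2, x.1)) (by fun_prop))).comp hf Primrec.id

@[fun_prop] theorem exists_mem {f : α → List β} {p : α → β → Prop} (hf : Primrec f)
    (hp : PrimrecPred fun x : α × β => p x.1 x.2) : PrimrecPred fun a => ∃ b ∈ f a, p a b :=
  (PrimrecRel.exists_mem_list (R := fun b a => p a b)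
    (hp.comp (f := fun x : β × α => (x.2, x.1)) (by fun_prop))).comp hf Primrec.id

@[fun_prop] theorem mem_list {f : α → β} {g : α → List β} (hf : Primrec f) (hg : Primrec g) :
    PrimrecPred fun a => f a ∈ g a :=
  (exists_mem (p := fun a b => f a = b) hg (by fun_prop)).of_eq fun a => by simp

end PrimrecPred

/-- Recursively enumerable predicates: projections of primitive recursive relations. -/
@[fun_prop] def Sigma1 {α : Type*} [Primcodable α] (p : α → Prop) : Prop :=
  ∃ q : α → ℕ → Prop, PrimrecRel q ∧ ∀ a, p a ↔ ∃ n, q a n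

/-! ### Closure properties of recursively enumerable predicates -/

namespace Sigma1

variable {α β : Type*} [Primcodable α] [Primcodable β]

theorem of_primrecPred {p : α → Prop} (hp : PrimrecPred p) : Sigma1 p :=
  ⟨fun a _ => p a, hp.comp Primrec.fst, fun a => by simp⟩

theorem of_iff {p q : α → Prop} (hq : Sigma1 q) (h : ∀ a, p a ↔ q a) : Sigma1 p := by
  obtain rfl : p = q := funext fun a => propext (h a)
  exact hq

@[fun_prop] theorem comp {p : β → Prop} (hp : Sigma1 p) {f : α → β} (hf : Primrec f) :
    Sigma1 fun a => p (f a) := by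
  obtain ⟨q, hq, h⟩ := hp
  exact ⟨fun a n => q (f a) n, PrimrecPred.comp hq (f := fun x : α × ℕ => (f x.1, x.2))
    (by fun_prop), fun a => h _⟩

@[fun_prop] theorem ex {p : α → β → Prop} (hp : Sigma1 fun x : α × β => p x.1 x.2) :
    Sigma1 fun a => ∃ b, p a b := by
  obtain ⟨q, hq, h⟩ := hp
  refine ⟨fun a n => ∃ b ∈ ((Encodable.decode (α := β × ℕ) n).toList), q (a, b.1) b.2, ?_,
    fun a => ?_⟩
  · refine PrimrecPred.exists_mem (f := fun x : α × ℕ => (Encodable.decode (α := β × ℕ) x.2).toList)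
      (p := fun x b => q (x.1, b.1) b.2)
      (Primrec.optionToList.comp (Primrec.decode.comp Primrec.snd))
      (PrimrecPred.comp hq (f := fun x : (α × ℕ) × β × ℕ => ((x.1.1, x.2.1), x.2.2)) (by fun_prop))
  · constructor
    · rintro ⟨b, hb⟩
      obtain ⟨n, hn⟩ := (h (a, b)).1 hb
      exact ⟨Encodable.encode (b, n), (b, n), by simp, hn⟩
    · rintro ⟨n, b, -, hb⟩
      exact ⟨b.1, (h (a, b.1)).2 ⟨b.2, hb⟩⟩

@[fun_prop] theorem and {p q : α → Prop} (hp : Sigma1 p) (hq : Sigma1 q) :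
    Sigma1 fun a => p a ∧ q a := by
  obtain ⟨p', hp', h₁⟩ := hp
  obtain ⟨q', hq', h₂⟩ := hq
  have : Sigma1 fun a => ∃ x : ℕ × ℕ, p' a x.1 ∧ q' a x.2 :=
    ex (of_primrecPred ((PrimrecPred.comp hp' (f := fun x : α × ℕ × ℕ => (x.1, x.2.1))
      (by fun_prop)).and (PrimrecPred.comp hq' (f := fun x : α × ℕ × ℕ => (x.1, x.2.2))
      (by fun_prop))))
  exact this.of_iff fun a => by simp [h₁, h₂]

@[fun_prop] theorem or {p q : α → Prop} (hp : Sigma1 p) (hq : Sigma1 q) :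
    Sigma1 fun a => p a ∨ q a := by
  obtain ⟨p', hp', h₁⟩ := hp
  obtain ⟨q', hq', h₂⟩ := hq
  exact ⟨fun a n => p' a n ∨ q' a n, PrimrecPred.or hp' hq', fun a => by
    simp only [h₁, h₂, exists_or]⟩

-- Finitely many existential witnesses have a common bound, and this bound is the single witness
-- needed.
@[fun_prop] theorem forall_mem {f : α → List β} {p : α → β → Prop} (hf : Primrec f)
    (hp : Sigma1 fun x : α × β => p x.1 x.2) : Sigma1 fun a => ∀ b ∈ f a, p a b := by
  obtain ⟨q, hq, h⟩ := hp
  refine ⟨fun a N => ∀ b ∈ f a, ∃ n ∈ List.range N, q (a, b) n, ?_, fun a => ?_⟩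
  · exact PrimrecPred.forall_mem (f := fun x : α × ℕ => f x.1)
      (p := fun x b => ∃ n ∈ List.range x.2, q (x.1, b) n) (by fun_prop)
      (PrimrecPred.exists_mem (f := fun x : (α × ℕ) × β => List.range x.1.2)
        (p := fun x n => q (x.1.1, x.2) n) (by fun_prop)
        (PrimrecPred.comp hq (f := fun x : ((α × ℕ) × β) × ℕ => ((x.1.1.1, x.1.2), x.2))
          (by fun_prop)))
  · have h' : ∀ b, p a b ↔ ∃ n, q (a, b) n := fun b => h (a, b)
    simp only [h', List.mem_range]
    constructor
    · intro hb
      generalize f a = l at hb ⊢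
      induction l with
      | nil => exact ⟨0, by simp⟩
      | cons b l ih =>
        obtain ⟨N, hN⟩ := ih fun c hc => hb c (List.mem_cons_of_mem _ hc)
        obtain ⟨n, hn⟩ := hb b List.mem_cons_self
        refine ⟨N + n + 1, fun c hc => ?_⟩
        rcases List.mem_cons.1 hc with rfl | hc
        · exact ⟨n, by omega, hn⟩
        · obtain ⟨m, hm, hq⟩ := hN c hc
          exact ⟨m, by omega, hq⟩
    · rintro ⟨N, hN⟩ b hb
      obtain ⟨n, -, hn⟩ := hN b hb
      exact ⟨n, hn⟩

@[fun_prop] theorem const_fun (p : Prop) : Sigma1 fun _ : α => p :=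
  of_primrecPred (by fun_prop)

@[fun_prop] theorem eq_fun {f g : α → β} (hf : Primrec f) (hg : Primrec g) :
    Sigma1 fun a => f a = g a := of_primrecPred (by fun_prop)

@[fun_prop] theorem mem_list {f : α → β} {g : α → List β} (hf : Primrec f) (hg : Primrec g) :
    Sigma1 fun a => f a ∈ g a := of_primrecPred (by fun_prop)

@[fun_prop] theorem natLt {f g : α → ℕ} (hf : Primrec f) (hg : Primrec g) :
    Sigma1 fun a => f a < g a := of_primrecPred (by fun_prop)

@[fun_prop] theorem not_fun {p : α → Prop} (hp : PrimrecPred p) : Sigma1 fun a => ¬ p a :=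
  of_primrecPred (by fun_prop)

/-- A total function with a recursively enumerable graph is computable. -/
theorem computable {f : α → β} (h : Sigma1 fun x : α × β => f x.1 = x.2) : Computable f := by
  classical
  obtain ⟨q, hq, h⟩ := h
  -- The search runs through coded pairs of a candidate value and a witness that it belongs to the
  -- graph.
  have hp : Primrec fun x : α × ℕ => (Encodable.decode (α := β × ℕ) x.2).bind fun y =>
      if q (x.1, y.1) y.2 then some y.1 else none :=
    Primrec.option_bind (g := fun (x : α × ℕ) (y : β × ℕ) =>
        if q (x.1, y.1) y.2 then some y.1 else none)
      (Primrec.decode.comp Primrec.snd)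
      (Primrec.ite (PrimrecPred.comp hq
        (f := fun x : (α × ℕ) × β × ℕ => ((x.1.1, x.2.1), x.2.2)) (by fun_prop))
        (by fun_prop) (by fun_prop))
  refine (Partrec.rfindOpt (Primrec₂.to_comp (f := fun (a : α) (n : ℕ) =>
    (Encodable.decode (α := β × ℕ) n).bind fun y =>
      if q (a, y.1) y.2 then some y.1 else none) hp)).of_eq fun a => ?_
  have hdom : (Nat.rfindOpt fun n => (Encodable.decode (α := β × ℕ) n).bind fun y =>
      if q (a, y.1) y.2 then some y.1 else none).Dom := by
    obtain ⟨n, hn⟩ := (h (a, f a)).1 rfl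
    exact Nat.rfindOpt_dom.2 ⟨Encodable.encode (f a, n), f a, by simp [hn]⟩
  obtain ⟨b, hb⟩ := Part.dom_iff_mem.1 hdom
  obtain ⟨n, hn⟩ := Nat.rfindOpt_spec hb
  rw [Part.eq_some_iff.2 hb]
  obtain ⟨y, -, hy⟩ := Option.bind_eq_some_iff.1 hn
  by_cases hq : q (a, y.1) y.2
  · rw [if_pos hq] at hy
    cases hy
    simp [(h (a, y.1)).2 ⟨_, hq⟩]
  · simp [hq] at hy

end Sigma1

/-- The objects that are derivable by the rules `R`, where `R b l` if `b` follows from `l`. -/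
inductive Derivable {β : Type*} (R : β → List β → Prop) : β → Prop
  | step {b : β} (l : List β) : R b l → (∀ c ∈ l, Derivable R c) → Derivable R b

/-- A derivation tree is flattened to a finite list of statements with ranks, where premises have
smaller rank than conclusions. Well-foundedness of the ranks replaces the tree, and an inductive
definition becomes an existential statement about lists. -/
theorem derivable_iff {β : Type*} {R : β → List β → Prop} {b : β} : Derivable R b ↔
    ∃ D : List (β × ℕ), (∃ d ∈ D, d.1 = b) ∧ ∀ d ∈ D, ∃ l : List β, R d.1 l ∧
      ∀ c ∈ l, ∃ e ∈ D, e.1 = c ∧ e.2 < d.2 := by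
  constructor
  · intro h
    induction h with
    | @step b l hb hl ih =>
      have : ∃ D : List (β × ℕ), (∀ c ∈ l, ∃ d ∈ D, d.1 = c) ∧ ∀ d ∈ D, ∃ l : List β, R d.1 l ∧
          ∀ c ∈ l, ∃ e ∈ D, e.1 = c ∧ e.2 < d.2 := by
        clear hb
        induction l with
        | nil => exact ⟨[], by simp⟩
        | cons c l ih' =>
          obtain ⟨D₁, h₁, h₁'⟩ := ih c List.mem_cons_self
          obtain ⟨D₂, h₂, h₂'⟩ := ih' (fun c hc => hl c (List.mem_cons_of_mem _ hc))
            fun c hc => ih c (List.mem_cons_of_mem _ hc)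
          refine ⟨D₁ ++ D₂, fun e he => ?_, fun d hd => ?_⟩
          · rcases List.mem_cons.1 he with rfl | he
            · obtain ⟨d, hd, h⟩ := h₁
              exact ⟨d, List.mem_append_left _ hd, h⟩
            · obtain ⟨d, hd, h⟩ := h₂ e he
              exact ⟨d, List.mem_append_right _ hd, h⟩
          · rcases List.mem_append.1 hd with hd | hd
            · obtain ⟨l, hl, h⟩ := h₁' d hd
              exact ⟨l, hl, fun c hc => (h c hc).imp fun e he => ⟨List.mem_append_left _ he.1, he.2⟩⟩
            · obtain ⟨l, hl, h⟩ := h₂' d hd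
              exact ⟨l, hl, fun c hc => (h c hc).imp fun e he => ⟨List.mem_append_right _ he.1, he.2⟩⟩
      obtain ⟨D, hD, hD'⟩ := this
      -- The sum of all ranks plus one is a convenient rank for the new conclusion.
      have hlt : ∀ d ∈ D, d.2 < (D.map Prod.snd).sum + 1 := fun d hd =>
        Nat.lt_succ_of_le (List.le_sum_of_mem (List.mem_map_of_mem hd))
      refine ⟨(b, (D.map Prod.snd).sum + 1) :: D, ⟨_, List.mem_cons_self, rfl⟩, fun d hd => ?_⟩
      rcases List.mem_cons.1 hd with rfl | hd
      · refine ⟨l, hb, fun c hc => ?_⟩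
        obtain ⟨d, hd, rfl⟩ := hD c hc
        exact ⟨d, List.mem_cons_of_mem _ hd, rfl, hlt d hd⟩
      · obtain ⟨l, hl, h⟩ := hD' d hd
        exact ⟨l, hl, fun c hc => (h c hc).imp fun e he => ⟨List.mem_cons_of_mem _ he.1, he.2⟩⟩
  · rintro ⟨D, ⟨d, hd, rfl⟩, h⟩
    induction hn : d.2 using Nat.strong_induction_on generalizing d with
    | _ n ih =>
      obtain ⟨l, hl, hc⟩ := h d hd
      refine .step l hl fun c hc' => ?_
      obtain ⟨e, he, rfl, hlt⟩ := hc c hc'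
      exact ih _ (hn ▸ hlt) e he rfl

theorem Sigma1.derivable {α β : Type*} [Primcodable α] [Primcodable β] {R : α → β → List β → Prop}
    (hR : Sigma1 fun x : α × β × List β => R x.1 x.2.1 x.2.2) {f : α → β} (hf : Primrec f) :
    Sigma1 fun a => Derivable (R a) (f a) := by
  simp only [derivable_iff]
  have : Sigma1 fun x : (((α × List (β × ℕ)) × β × ℕ) × List β) => R x.1.1.1 x.1.2.1 x.2 :=
    hR.comp (f := fun x : (((α × List (β × ℕ)) × β × ℕ) × List β) => (x.1.1.1, x.1.2.1, x.2))
      (by fun_prop)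
  exact .ex (.and (by fun_prop) (.forall_mem (by fun_prop) (.ex (.and this (by fun_prop)))))

/-! ### Denotations are recursively enumerable -/

section TokenFunctions

variable {α : Type*} [Primcodable α]

@[fun_prop] theorem primrec_tokPred {f : α → ℕ} (hf : Primrec f) :
    Primrec fun a => tokPred (f a) := by unfold tokPred; fun_prop

@[fun_prop] theorem primrec_tokFst {f : α → ℕ} (hf : Primrec f) :
    Primrec fun a => tokFst (f a) := by unfold tokFst; fun_prop

@[fun_prop] theorem primrec_tokSnd {f : α → ℕ} (hf : Primrec f) :
    Primrec fun a => tokSnd (f a) := by unfold tokSnd; fun_prop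

@[fun_prop] theorem primrec_tokFun {f : α → List ℕ} {g : α → ℕ} (hf : Primrec f)
    (hg : Primrec g) : Primrec fun a => tokFun (f a) (g a) := by unfold tokFun; fun_prop

@[fun_prop] theorem primrec_tokState {f : α → List AtomCode} (hf : Primrec f) :
    Primrec fun a => tokState (f a) := by unfold tokState; fun_prop

@[fun_prop] theorem primrec_tokNum {f : α → ℕ} (hf : Primrec f) :
    Primrec fun a => tokNum (f a) := by
  have : Primrec fun n : ℕ => Nat.rec (motive := fun _ => ℕ) tokZero (fun _ => tokPred) n := by
    fun_prop
  exact (this.of_eq fun n => by induction n <;> simp_all [tokNum]).comp hf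

@[fun_prop] theorem primrec_numTokens {f : α → ℕ} (hf : Primrec f) :
    Primrec fun a => numTokens (f a) := by
  have : Primrec fun n : ℕ => Nat.rec (motive := fun _ => List ℕ) [tokZero]
      (fun _ l => tokSucc :: l.map tokPred) n := by
    fun_prop
  exact (this.of_eq fun n => by induction n <;> simp_all [numTokens]).comp hf

end TokenFunctions

/-- Families of uniformly recursively enumerable sets. -/
@[fun_prop] def REFamily {γ : Type*} [Primcodable γ] (S : γ → Set ℕ) : Prop :=
  Sigma1 fun x : γ × ℕ => x.2 ∈ S x.1

@[fun_prop] theorem Sigma1.mem_set {α : Type*} [Primcodable α] {f : α → ℕ} {S : α → Set ℕ}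
    (hf : Primrec f) (hS : REFamily S) : Sigma1 fun a => f a ∈ S a :=
  Sigma1.comp hS (f := fun a => (a, f a)) (by fun_prop)

namespace REFamily

variable {γ δ : Type*} [Primcodable γ] [Primcodable δ] {S T : γ → Set ℕ}

theorem of_iff {p : γ → ℕ → Prop} (hp : Sigma1 fun x : γ × ℕ => p x.1 x.2)
    (h : ∀ g x, x ∈ S g ↔ p g x) : REFamily S :=
  Sigma1.of_iff hp fun x => h x.1 x.2

theorem congr (hS : REFamily S) (h : ∀ g, T g = S g) : REFamily T := by
  rwa [funext h]

@[fun_prop] theorem comp (hS : REFamily S) {f : δ → γ} (hf : Primrec f) :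
    REFamily fun a => S (f a) :=
  Sigma1.comp hS (f := fun x : δ × ℕ => (f x.1, x.2)) (by fun_prop)

@[fun_prop] theorem ofPred {p : γ → ℕ → Prop} (hp : Sigma1 fun x : γ × ℕ => p x.1 x.2) :
    REFamily fun g => {x | p g x} := hp

@[fun_prop] theorem listSet {f : γ → List ℕ} (hf : Primrec f) :
    REFamily fun g => LBR.listSet (f g) :=
  of_iff (p := fun g x => x ∈ f g) (by fun_prop) fun _ _ => .rfl

@[fun_prop] theorem singleton {f : γ → ℕ} (hf : Primrec f) :
    REFamily fun g => ({f g} : Set ℕ) :=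
  of_iff (p := fun g x => x = f g) (by fun_prop) fun _ _ => .rfl

@[fun_prop] theorem apSet (hS : REFamily S) (hT : REFamily T) :
    REFamily fun g => LBR.apSet (S g) (T g) := by
  unfold LBR.apSet; fun_prop

@[fun_prop] theorem succSet (hS : REFamily S) : REFamily fun g => LBR.succSet (S g) := by
  unfold LBR.succSet; fun_prop

@[fun_prop] theorem pairSet (hS : REFamily S) (hT : REFamily T) :
    REFamily fun g => LBR.pairSet (S g) (T g) := by
  unfold LBR.pairSet; fun_prop

theorem preimage (hS : REFamily S) {f : ℕ → ℕ} (hf : Primrec f) :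
    REFamily fun g => {x | f x ∈ S g} := by
  fun_prop

theorem lamSet {F : γ → List ℕ → Set ℕ} (hF : REFamily fun x : γ × List ℕ => F x.1 x.2) :
    REFamily fun g => {z | ∃ β x, z = tokFun β x ∧ x ∈ F g β} := by
  have : REFamily fun x : ((γ × ℕ) × List ℕ) × ℕ => F x.1.1.1 x.1.2 :=
    comp hF (f := fun x : ((γ × ℕ) × List ℕ) × ℕ => (x.1.1.1, x.1.2)) (by fun_prop)
  fun_prop

@[fun_prop] theorem condSet : REFamily fun _ : γ => LBR.condSet := by
  unfold LBR.condSet; fun_prop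

end REFamily

theorem fixTok_iff {β : List ℕ} {x : ℕ} :
    FixTok β x ↔ Derivable (fun y ε => tokFun ε y ∈ β) x := by
  constructor
  · intro h
    induction h with
    | step ε h _ ih => exact .step ε h ih
  · intro h
    induction h with
    | step ε h _ ih => exact .step ε h ih

/-- The lists `β` and `γ` stay fixed in a derivation, so the derived statements are the pairs of
number tokens and result token. -/
theorem precTok_iff {β γ δ : List ℕ} {x : ℕ} : PrecTok β γ δ x ↔
    Derivable (fun (c : List ℕ × ℕ) (l : List (List ℕ × ℕ)) =>
      (l = [] ∧ tokZero ∈ c.1 ∧ c.2 ∈ β) ∨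
      ∃ δ₁ ε δ₂ : List ℕ, tokSucc ∈ c.1 ∧ tokFun δ₁ (tokFun ε c.2) ∈ γ ∧
        (∀ y ∈ δ₁, tokPred y ∈ c.1) ∧ (∀ y ∈ δ₂, tokPred y ∈ c.1) ∧
        l = ε.map fun y => (δ₂, y)) (δ, x) := by
  constructor
  · intro h
    induction h with
    | zero h h' => exact .step [] (.inl ⟨rfl, h, h'⟩) (by simp)
    | succ δ₁ ε δ₂ h h₁ h₂ h₃ _ ih =>
      exact .step _ (.inr ⟨δ₁, ε, δ₂, h, h₁, h₂, h₃, rfl⟩) (by simpa using ih)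
  · intro h
    generalize hc : (δ, x) = c at h
    induction h generalizing δ x with
    | step l h _ ih =>
      subst hc
      rcases h with ⟨-, h, h'⟩ | ⟨δ₁, ε, δ₂, h, h₁, h₂, h₃, rfl⟩
      · exact .zero h h'
      · exact .succ δ₁ ε δ₂ h h₁ h₂ h₃ fun y hy => ih _ (List.mem_map_of_mem hy) rfl

namespace Sigma1

variable {α : Type*} [Primcodable α]

@[fun_prop] theorem fixTok {f : α → List ℕ} {g : α → ℕ} (hf : Primrec f) (hg : Primrec g) :
    Sigma1 fun a => FixTok (f a) (g a) := by
  simp only [fixTok_iff]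
  exact Sigma1.derivable (R := fun a y ε => tokFun ε y ∈ f a) (by fun_prop) hg

@[fun_prop] theorem precTok {b c d : α → List ℕ} {g : α → ℕ} (hb : Primrec b) (hc : Primrec c)
    (hd : Primrec d) (hg : Primrec g) : Sigma1 fun a => PrecTok (b a) (c a) (d a) (g a) := by
  simp only [precTok_iff]
  exact Sigma1.derivable (R := fun a (e : List ℕ × ℕ) (l : List (List ℕ × ℕ)) =>
      (l = [] ∧ tokZero ∈ e.1 ∧ e.2 ∈ b a) ∨
      ∃ δ₁ ε δ₂ : List ℕ, tokSucc ∈ e.1 ∧ tokFun δ₁ (tokFun ε e.2) ∈ c a ∧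
        (∀ y ∈ δ₁, tokPred y ∈ e.1) ∧ (∀ y ∈ δ₂, tokPred y ∈ e.1) ∧
        l = ε.map fun y => (δ₂, y)) (by fun_prop) (by fun_prop)

end Sigma1

/-- The environment given by a list of lists of tokens. -/
def listEnv (Γ : List (List ℕ)) (i : ℕ) : Set ℕ := listSet (Γ[i]?.getD [])

theorem listEnv_nil : listEnv [] = emptyEnv := by
  funext i
  simp [listEnv, listSet, emptyEnv]

theorem listEnv_cons (β : List ℕ) (Γ : List (List ℕ)) :
    listEnv (β :: Γ) = consEnv (listSet β) (listEnv Γ) := by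
  funext i
  cases i <;> simp [listEnv, consEnv]

/-- All finite approximations of the arguments are collected in one list, which makes the condition
uniform in the number of arguments. -/
theorem mem_sem_appNums {C : Type} {κ : C → Set ℕ} {t : Tm C} {ρ : ℕ → Set ℕ} {ns : List ℕ}
    {x : ℕ} : x ∈ sem κ (t.appNums ns) ρ ↔ ∃ w : List (ℕ × List ℕ), w.map Prod.fst = ns ∧
      (∀ e ∈ w, ∀ y ∈ e.2, y ∈ numTokens e.1) ∧
      w.foldr (fun e x => tokFun e.2 x) x ∈ sem κ t ρ := by
  induction ns generalizing t with
  | nil => simp [Tm.appNums, Tm.appList]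
  | cons n ns ih =>
    rw [Tm.appNums_cons, ih]
    constructor
    · rintro ⟨w, rfl, hw, β, h, hβ⟩
      rw [sem_num] at hβ
      refine ⟨(n, β) :: w, rfl, fun e he => ?_, h⟩
      rcases List.mem_cons.1 he with rfl | he
      · exact hβ
      · exact hw e he
    · rintro ⟨_ | ⟨⟨m, β⟩, w⟩, e, hw, h⟩
      · simp at e
      · simp only [List.map_cons, List.cons.injEq] at e
        obtain ⟨rfl, rfl⟩ := e
        refine ⟨w, rfl, fun e he => hw e (List.mem_cons_of_mem _ he), β, h, ?_⟩
        rw [sem_num]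
        exact hw (m, β) List.mem_cons_self

namespace REFamily

variable {γ δ : Type*} [Primcodable γ] [Primcodable δ]

@[fun_prop] theorem precSet : REFamily fun _ : γ => LBR.precSet := by
  unfold LBR.precSet; fun_prop

@[fun_prop] theorem fixSet : REFamily fun _ : γ => LBR.fixSet := by
  unfold LBR.fixSet; fun_prop

/-- Abstraction evaluates its body only at finite sets of tokens, so environments remain finite
objects, coded as lists of lists, throughout the induction. -/
theorem sem_listEnv {C : Type} {κ : γ → C → Set ℕ} (hκ : ∀ c, REFamily fun g => κ g c)
    (t : Tm C) : REFamily fun x : γ × List (List ℕ) => LBR.sem (κ x.1) t (listEnv x.2) := by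
  induction t with
  | lam T t ih =>
    simp only [LBR.sem, LBR.lamSet, ← listEnv_cons]
    exact lamSet (comp ih (f := fun x : ((γ × List (List ℕ)) × List ℕ) => (x.1.1, x.2 :: x.1.2))
      (by fun_prop))
  | fst t ih => exact preimage ih (by fun_prop)
  | snd t ih => exact preimage ih (by fun_prop)
  | var i => simp only [LBR.sem, listEnv]; fun_prop
  | _ => simp only [LBR.sem]; fun_prop

theorem sem {C : Type} {κ : γ → C → Set ℕ} (hκ : ∀ c, REFamily fun g => κ g c) (t : Tm C)
    {f : γ → List (List ℕ)} (hf : Primrec f) : REFamily fun g => LBR.sem (κ g) t (listEnv (f g)) :=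
  comp (sem_listEnv hκ t) (f := fun g => (g, f g)) (by fun_prop)

/-- The induction on `k` keeps the family `F` fixed and collects the arguments already read in a
list. -/
theorem natFun {k : ℕ} {F : γ → List ℕ → Set ℕ} (hF : REFamily fun x : γ × List ℕ => F x.1 x.2) :
    REFamily fun g => LBR.natFun k (F g) := by
  suffices h : ∀ k, REFamily fun x : γ × List ℕ => LBR.natFun k fun ns => F x.1 (x.2 ++ ns) by
    simpa using comp (h k) (f := fun g => (g, [])) (by fun_prop)
  intro k
  induction k with
  | zero => simpa [LBR.natFun] using hF
  | succ k ih =>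
    refine of_iff (p := fun x z => ∃ β y, z = tokFun β y ∧ ∃ n, tokNum n ∈ β ∧
      y ∈ LBR.natFun k fun ns => F x.1 ((x.2 ++ [n]) ++ ns)) ?_ fun x z => ?_
    · refine .ex (.ex (.and (by fun_prop) (.ex (.and (by fun_prop) (.mem_set (by fun_prop) ?_)))))
      exact comp ih (f := fun x : ((((γ × List ℕ) × ℕ) × List ℕ) × ℕ) × ℕ =>
        (x.1.1.1.1.1, x.1.1.1.1.2 ++ [x.2])) (by fun_prop)
    · simp [LBR.natFun]

theorem semT_appNums (t : TTm) : REFamily fun ns : List ℕ => semT (t.appNums ns) emptyEnv := by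
  have ht : REFamily fun _ : (List ℕ × ℕ) × List (ℕ × List ℕ) => semT t emptyEnv := by
    have := sem (γ := (List ℕ × ℕ) × List (ℕ × List ℕ)) (κ := fun _ (c : Empty) => c.elim)
      (fun c => c.elim) t (f := fun _ => []) (by fun_prop)
    rwa [listEnv_nil] at this
  exact of_iff (p := fun ns x => ∃ w : List (ℕ × List ℕ), w.map Prod.fst = ns ∧
    (∀ e ∈ w, ∀ y ∈ e.2, y ∈ numTokens e.1) ∧
    w.foldr (fun e x => tokFun e.2 x) x ∈ semT t emptyEnv) (by fun_prop)
    fun ns x => mem_sem_appNums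

end REFamily

/-! ### Decidability of operations on lists of atom codes -/

section Codes

variable {α : Type*} [Primcodable α]

@[fun_prop] theorem primrecPred_knowsCode {f : α → List AtomCode} {p : α → ℕ} {g : α → List ℕ}
    (hf : Primrec f) (hp : Primrec p) (hg : Primrec g) :
    PrimrecPred fun a => KnowsCode (f a) (p a) (g a) := by
  unfold KnowsCode; fun_prop

@[fun_prop] theorem sigma1_knowsCode {f : α → List AtomCode} {p : α → ℕ} {g : α → List ℕ}
    (hf : Primrec f) (hp : Primrec p) (hg : Primrec g) :
    Sigma1 fun a => KnowsCode (f a) (p a) (g a) := .of_primrecPred (by fun_prop)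

@[fun_prop] theorem primrecPred_memCunion {f g : α → List AtomCode} {c : α → AtomCode}
    (hf : Primrec f) (hg : Primrec g) (hc : Primrec c) :
    PrimrecPred fun a => MemCunion (f a) (g a) (c a) := by
  have : ∀ a, MemCunion (f a) (g a) (c a) ↔ (c a ∈ f a ∨ c a ∈ g a ∧
      ∀ b ∈ f a, ¬ b.1 = (c a).1 ∨ ¬ b.2.1 = (c a).2.1 ∨ b.2.2 = (c a).2.2) := by
    intro a
    simp only [MemCunion, ConsistentCode, ← imp_iff_not_or]
  exact PrimrecPred.of_eq (by fun_prop) fun a => (this a).symm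

/-- Quantification over all codes is reduced to the members of three lists, which makes the
condition primitive recursive. -/
theorem forall_mem_iff_memCunion {L L₁ L₂ : List AtomCode} : (∀ c, c ∈ L ↔ MemCunion L₁ L₂ c) ↔
    (∀ c ∈ L, MemCunion L₁ L₂ c) ∧ (∀ c ∈ L₁, c ∈ L) ∧
      ∀ c ∈ L₂, c ∈ L ∨ ¬ MemCunion L₁ L₂ c := by
  constructor
  · intro h
    refine ⟨fun c => (h c).1, fun c hc => (h c).2 (.inl hc), fun c _ => ?_⟩
    rw [h]
    exact em _
  · rintro ⟨h₁, h₂, h₃⟩ c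
    refine ⟨h₁ c, fun h => ?_⟩
    rcases h with h' | h'
    · exact h₂ c h'
    · exact (h₃ c h'.1).resolve_right (not_not.2 (.inr h'))

@[fun_prop] theorem sigma1_forall_mem_iff_memCunion {f g h : α → List AtomCode}
    (hf : Primrec f) (hg : Primrec g) (hh : Primrec h) :
    Sigma1 fun a => ∀ c, c ∈ f a ↔ MemCunion (g a) (h a) c := by
  simp only [forall_mem_iff_memCunion]
  exact .of_primrecPred (by fun_prop)

@[fun_prop] theorem sigma1_forall_mem_iff_eq {f : α → List AtomCode} {g : α → AtomCode}
    (hf : Primrec f) (hg : Primrec g) : Sigma1 fun a => ∀ c, c ∈ f a ↔ c = g a := by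
  have : ∀ a, (∀ c, c ∈ f a ↔ c = g a) ↔ (∀ c ∈ f a, c = g a) ∧ g a ∈ f a := fun a =>
    ⟨fun h => ⟨fun c => (h c).1, (h _).2 rfl⟩, fun h c => ⟨h.1 c, fun e => e ▸ h.2⟩⟩
  simp only [this]
  fun_prop

end Codes

/-! ### Enumerability of the constants and of the terms, uniformly in the state -/

namespace REFamily

variable {γ δ : Type*} [Primcodable γ] [Primcodable δ]

@[fun_prop] theorem cunionSet : REFamily fun _ : γ => LBR.cunionSet := by
  unfold LBR.cunionSet; fun_prop

theorem stateSet (s : State) : REFamily fun _ : γ => LBR.stateSet s := by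
  obtain ⟨L₀, hL₀⟩ := exists_rep s
  refine of_iff (p := fun _ x => ∃ L, ((∀ c ∈ L, c ∈ L₀) ∧ ∀ c ∈ L₀, c ∈ L) ∧ x = tokState L)
    (by fun_prop) fun _ x => ?_
  constructor
  · rintro ⟨L, hL, rfl⟩
    exact ⟨L, ⟨fun c => (hL.mem_congr hL₀ c).1, fun c => (hL.mem_congr hL₀ c).2⟩, rfl⟩
  · rintro ⟨L, ⟨h₁, h₂⟩, rfl⟩
    exact ⟨L, hL₀.congr fun c => ⟨h₁ c, h₂ c⟩, rfl⟩

theorem oracleSet (P : Predicate) : REFamily (LBR.oracleSet P) :=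
  natFun (F := fun L ns => {x | KnowsCode L P.code ns ∧ x = tokTrue ∨
    ¬ KnowsCode L P.code ns ∧ x = tokFalse}) (by fun_prop)

theorem skolemSet (P : Predicate) : REFamily (LBR.skolemSet P) :=
  natFun (F := fun L ns => {x | (∃ m, (P.code, ns, m) ∈ L ∧ x ∈ numTokens m) ∨
    ¬ KnowsCode L P.code ns ∧ x ∈ numTokens 0}) (by fun_prop)

theorem adderSet (P : Predicate) : REFamily (LBR.adderSet P) := by
  have hP : REFamily (predSet P) := semT_appNums P.term
  exact natFun (F := fun L l => {x | ∃ ns m, l = ns ++ [m] ∧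
    ((x = tokState [] ∧ (KnowsCode L P.code ns ∨ tokFalse ∈ predSet P l)) ∨
      ¬ KnowsCode L P.code ns ∧ tokTrue ∈ predSet P l ∧
        ∃ L', x = tokState L' ∧ ∀ c, c ∈ L' ↔ c = (P.code, ns, m))}) (by fun_prop)

theorem classSet {K : Calculus} (c : ClassConst K) :
    REFamily fun L => LBR.classSet L c := by
  cases c with
  | st s => exact stateSet s
  | cup => exact cunionSet
  | oracle P => exact oracleSet P
  | skolem P => exact skolemSet P
  | adder P => exact adderSet P
  | fix _ _ => exact fixSet

/-- The denotation of a term of the classical calculi is recursively enumerable, uniformly in the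
state. -/
theorem sem_classSet {K : Calculus} (t : ClassTm K) :
    REFamily fun L => LBR.sem (LBR.classSet L) t emptyEnv := by
  simpa only [listEnv_nil] using sem (κ := LBR.classSet) classSet t (f := fun _ => [])
    (by fun_prop)

end REFamily

/-! ### Positions and realizers are recursively enumerable -/

namespace Formula

theorem subst_subst (A : Formula) (σ τ : ℕ → TTm) :
    (A.subst σ).subst τ = A.subst (Tm.subst τ ∘ σ) := by
  induction A generalizing σ τ with
  | atom Q ts => simp [subst, Tm.subst_subst]
  | _ => simp_all [subst, ← Tm.subst_comp_up]

theorem inst_subst_up (A : Formula) (σ : ℕ → TTm) (n : ℕ) :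
    (A.subst (Tm.up σ)).inst n = A.subst (Tm.scons (Tm.num n) σ) := by
  rw [inst, subst_subst, Tm.subst_single_comp_up]

theorem subst_var (A : Formula) : A.subst Tm.var = A := by
  induction A with
  | atom Q ts => simp [subst, funext Tm.subst_var]
  | _ => simp_all [subst, Tm.up_var]

end Formula

/-- The substitution of the numerals of `ns` for the first variables. -/
def numSubst : List ℕ → ℕ → TTm
  | [] => Tm.var
  | n :: ns => Tm.scons (Tm.num n) (numSubst ns)

theorem semT_numSubst (ns : List ℕ) :
    (fun i => semT (numSubst ns i) emptyEnv) = listEnv (ns.map numTokens) := by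
  induction ns with
  | nil => exact listEnv_nil.symm
  | cons n ns ih =>
    rw [List.map_cons, listEnv_cons, ← ih]
    funext i
    cases i with
    | zero => exact sem_num n _
    | succ i => rfl

/-- The tags have the form `tokFst`, so they cannot be confused with the truth values of atoms. -/
def tokEx : ℕ := tokFst 0
def tokOr : ℕ := tokFst 1
def tokOther : ℕ := tokFst 2

/-- Tokens which describe a closed formula, and give the truth value of an atom. -/
def posSet : Option Formula → Set ℕ
  | some (.atom Q ts) => semT (Q.appList ts) emptyEnv
  | some (.ex _) => {tokEx}
  | some (.or _ _) => {tokOr}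
  | _ => {tokOther}

namespace REFamily

variable {γ δ : Type} [Primcodable γ] [Primcodable δ]

theorem list_cases {β : Type} [Primcodable β] {S : γ → List β → Set ℕ}
    (h₀ : REFamily fun g => S g [])
    (h₁ : REFamily fun x : γ × β × List β => S x.1 (x.2.1 :: x.2.2)) :
    REFamily fun x : γ × List β => S x.1 x.2 := by
  refine of_iff (p := fun x y => (x.2 = [] ∧ y ∈ S x.1 []) ∨
    ∃ b l, x.2 = b :: l ∧ y ∈ S x.1 (b :: l)) ?_ fun x y => ?_
  · refine .or (.and (by fun_prop) (.mem_set (by fun_prop) ?_))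
      (.ex (.ex (.and (by fun_prop) (.mem_set (by fun_prop) ?_))))
    · exact comp h₀ (f := fun x : (γ × List β) × ℕ => x.1.1) (by fun_prop)
    · exact comp h₁ (f := fun x : (((γ × List β) × ℕ) × β) × List β =>
        (x.1.1.1.1, x.1.2, x.2)) (by fun_prop)
  · cases x.2 with
    | nil => simp
    | cons b l => simp

theorem ite {S T : γ → Set ℕ} {p : γ → Prop} [DecidablePred p] (hp : PrimrecPred p)
    (hS : REFamily S) (hT : REFamily T) : REFamily fun g => if p g then S g else T g := by
  refine of_iff (p := fun g x => (p g ∧ x ∈ S g) ∨ ¬ p g ∧ x ∈ T g) ?_ fun g x => ?_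
  · have : PrimrecPred fun x : γ × ℕ => p x.1 := hp.comp Primrec.fst
    exact .or (.and (.of_primrecPred this) (by fun_prop))
      (.and (.not_fun this) (by fun_prop))
  · by_cases h : p g <;> simp [h]

theorem semT_listEnv (t : TTm) {f : γ → List (List ℕ)} (hf : Primrec f) :
    REFamily fun g => semT t (listEnv (f g)) :=
  sem (κ := fun _ (c : Empty) => c.elim) (fun c => c.elim) t hf

theorem semT_appList {d : γ → TTm} (hd : REFamily fun g => semT (d g) emptyEnv) (ts : List TTm)
    {f : γ → List ℕ} (hf : Primrec f) :
    REFamily fun g => semT ((d g).appList (ts.map (Tm.subst (numSubst (f g))))) emptyEnv := by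
  induction ts generalizing d with
  | nil => exact hd
  | cons t ts ih =>
    refine ih (d := fun g => .app (d g) (t.subst (numSubst (f g)))) ?_
    have : REFamily fun g => semT (t.subst (numSubst (f g))) emptyEnv := by
      have e : ∀ ns, semT (t.subst (numSubst ns)) emptyEnv = semT t (listEnv (ns.map numTokens)) :=
        fun ns => by rw [← semT_numSubst]; exact sem_subst _ _ _
      simp only [e]
      exact semT_listEnv t (by fun_prop)
    exact apSet hd this

/-- Instances of a quantified formula are not structurally smaller. The induction is therefore on
the uninstantiated formula, and the numerals chosen so far are carried along in the first list. -/
theorem posSet (A : Formula) : REFamily fun x : List ℕ × List ℕ =>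
    LBR.posSet (subAt (A.subst (numSubst x.1)) x.2) := by
  induction A with
  | atom Q ts =>
    refine list_cases (S := fun ns a => LBR.posSet (subAt ((Formula.atom Q ts).subst (numSubst ns)) a)) ?_ ?_
    · refine semT_appList (d := fun _ => Q) ?_ ts (by fun_prop)
      simpa only [listEnv_nil] using semT_listEnv Q (f := fun _ => []) (by fun_prop)
    · exact singleton (f := fun _ => tokOther) (by fun_prop)
  | imp A B =>
    refine list_cases (S := fun ns a => LBR.posSet (subAt ((Formula.imp A B).subst (numSubst ns)) a)) ?_ ?_
    · exact singleton (f := fun _ => tokOther) (by fun_prop)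
    · exact singleton (f := fun _ => tokOther) (by fun_prop)
  | and A B ihA ihB =>
    refine list_cases (S := fun ns a => LBR.posSet (subAt ((Formula.and A B).subst (numSubst ns)) a)) ?_ ?_
    · exact singleton (f := fun _ => tokOther) (by fun_prop)
    · simp only [Formula.subst, subAt, apply_ite LBR.posSet]
      exact ite (by fun_prop) (comp ihA (f := fun x : List ℕ × ℕ × List ℕ => (x.1, x.2.2))
        (by fun_prop)) (ite (by fun_prop) (comp ihB
        (f := fun x : List ℕ × ℕ × List ℕ => (x.1, x.2.2)) (by fun_prop))
        (singleton (f := fun _ => tokOther) (by fun_prop)))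
  | or A B ihA ihB =>
    refine list_cases (S := fun ns a => LBR.posSet (subAt ((Formula.or A B).subst (numSubst ns)) a)) ?_ ?_
    · exact singleton (f := fun _ => tokOr) (by fun_prop)
    · simp only [Formula.subst, subAt, apply_ite LBR.posSet]
      exact ite (by fun_prop) (comp ihA (f := fun x : List ℕ × ℕ × List ℕ => (x.1, x.2.2))
        (by fun_prop)) (ite (by fun_prop) (comp ihB
        (f := fun x : List ℕ × ℕ × List ℕ => (x.1, x.2.2)) (by fun_prop))
        (singleton (f := fun _ => tokOther) (by fun_prop)))
  | all A ih =>
    refine list_cases (S := fun ns a => LBR.posSet (subAt ((Formula.all A).subst (numSubst ns)) a)) ?_ ?_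
    · exact singleton (f := fun _ => tokOther) (by fun_prop)
    · simp only [Formula.subst, subAt, Formula.inst_subst_up]
      exact comp ih (f := fun x : List ℕ × ℕ × List ℕ => (x.2.1 :: x.1, x.2.2)) (by fun_prop)
  | ex A ih =>
    refine list_cases (S := fun ns a => LBR.posSet (subAt ((Formula.ex A).subst (numSubst ns)) a)) ?_ ?_
    · exact singleton (f := fun _ => tokEx) (by fun_prop)
    · simp only [Formula.subst, subAt, Formula.inst_subst_up]
      exact comp ih (f := fun x : List ℕ × ℕ × List ℕ => (x.2.1 :: x.1, x.2.2)) (by fun_prop)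

theorem posSet_subAt (A : Formula) : REFamily fun a => LBR.posSet (subAt A a) := by
  have := comp (posSet A) (f := fun a : List ℕ => ([], a)) (by fun_prop)
  simpa only [numSubst, Formula.subst_var] using this

end REFamily

/-- Realizers follow the logical structure only and never look at the terms inside atoms; induction
on the uninstantiated formula is thus possible. -/
theorem occRealizer_subst {K : Calculus} (A : Formula) (σ : ℕ → TTm) (t : ClassTm K)
    (a : List ℕ) : occRealizer (A.subst σ) t a = occRealizer A t a := by
  induction a generalizing A σ t with
  | nil => cases A <;> rfl
  | cons i a ih => cases A <;> simp [Formula.subst, occRealizer, Formula.inst, ih]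

theorem sem_ite {C : Type} {κ : C → Set ℕ} {ρ : ℕ → Set ℕ} (p : Prop) [Decidable p] (t t' : Tm C) :
    sem κ (if p then t else t') ρ = if p then sem κ t ρ else sem κ t' ρ := by
  split <;> rfl

namespace REFamily

section Realizers

variable {K : Calculus} {γ : Type} [Primcodable γ] {t : γ → ClassTm K} {L : γ → List AtomCode}

theorem sem_fst (h : REFamily fun g => LBR.sem (LBR.classSet (L g)) (t g) emptyEnv) :
    REFamily fun g => LBR.sem (LBR.classSet (L g)) (.fst (t g)) emptyEnv :=
  preimage h (by fun_prop)

theorem sem_snd (h : REFamily fun g => LBR.sem (LBR.classSet (L g)) (t g) emptyEnv) :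
    REFamily fun g => LBR.sem (LBR.classSet (L g)) (.snd (t g)) emptyEnv :=
  preimage h (by fun_prop)

theorem sem_app_num (h : REFamily fun g => LBR.sem (LBR.classSet (L g)) (t g) emptyEnv) :
    REFamily fun x : γ × ℕ =>
      LBR.sem (LBR.classSet (L x.1)) (.app (t x.1) (Tm.num x.2)) emptyEnv := by
  simp only [LBR.sem, sem_num]
  exact apSet (comp h (f := Prod.fst) (by fun_prop)) (listSet (by fun_prop))

/-- The parameter type is generalized, because the instance chosen at a universal quantifier enters
the realizer and becomes a further parameter. -/
theorem sem_occRealizer (A : Formula)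
    (h : REFamily fun g => LBR.sem (LBR.classSet (L g)) (t g) emptyEnv) :
    REFamily fun x : γ × List ℕ =>
      LBR.sem (LBR.classSet (L x.1)) (occRealizer A (t x.1) x.2) emptyEnv := by
  induction A generalizing γ with
  | atom Q ts =>
    exact list_cases
      (S := fun g a => LBR.sem (LBR.classSet (L g)) (occRealizer (.atom Q ts) (t g) a) emptyEnv) h
      (comp h (f := Prod.fst) (by fun_prop))
  | imp A B =>
    exact list_cases
      (S := fun g a => LBR.sem (LBR.classSet (L g)) (occRealizer (.imp A B) (t g) a) emptyEnv) h
      (comp h (f := Prod.fst) (by fun_prop))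
  | and A B ihA ihB =>
    refine list_cases
      (S := fun g a => LBR.sem (LBR.classSet (L g)) (occRealizer (.and A B) (t g) a) emptyEnv) h ?_
    simp only [occRealizer, sem_ite]
    exact ite (by fun_prop)
      (comp (ihA (sem_fst h)) (f := fun x : γ × ℕ × List ℕ => (x.1, x.2.2)) (by fun_prop))
      (comp (ihB (sem_snd h)) (f := fun x : γ × ℕ × List ℕ => (x.1, x.2.2)) (by fun_prop))
  | or A B ihA ihB =>
    refine list_cases
      (S := fun g a => LBR.sem (LBR.classSet (L g)) (occRealizer (.or A B) (t g) a) emptyEnv) h ?_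
    simp only [occRealizer, sem_ite]
    exact ite (by fun_prop)
      (comp (ihA (sem_fst (sem_snd h))) (f := fun x : γ × ℕ × List ℕ => (x.1, x.2.2))
        (by fun_prop))
      (comp (ihB (sem_snd (sem_snd h))) (f := fun x : γ × ℕ × List ℕ => (x.1, x.2.2))
        (by fun_prop))
  | all A ih =>
    refine list_cases
      (S := fun g a => LBR.sem (LBR.classSet (L g)) (occRealizer (.all A) (t g) a) emptyEnv) h ?_
    simp only [occRealizer, Formula.inst, occRealizer_subst]
    exact comp (ih (sem_app_num h)) (f := fun x : γ × ℕ × List ℕ => ((x.1, x.2.1), x.2.2))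
      (by fun_prop)
  | ex A ih =>
    refine list_cases
      (S := fun g a => LBR.sem (LBR.classSet (L g)) (occRealizer (.ex A) (t g) a) emptyEnv) h ?_
    simp only [occRealizer, Formula.inst, occRealizer_subst]
    exact comp (ih (sem_snd h)) (f := fun x : γ × ℕ × List ℕ => (x.1, x.2.2)) (by fun_prop)

/-- The tokens of the realizers associated to the positions of `A`. -/
theorem sem_occRealizer_classSet {K : Calculus} (A : Formula) (u : ClassTm K) :
    REFamily fun x : List AtomCode × List ℕ =>
      LBR.sem (LBR.classSet x.1) (occRealizer A u x.2) emptyEnv :=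
  sem_occRealizer A (L := id) (t := fun _ => u) (sem_classSet u)

end Realizers

end REFamily

/-! ### The strategy is recursive -/

section Values

variable {K : Calculus} {t : ClassTm K} {L L₁ : List AtomCode} {s : State}

/-- A stable term has a value, and the model determines that value; membership of a token is then
equivalent to provable equality. -/
theorem Stable.tokNum_mem_iff (h : Stable .nat t) (hL : Rep L s) {n : ℕ} :
    tokNum n ∈ sem (classSet L) t emptyEnv ↔ LConv (approx s t) (Tm.num n) := by
  obtain ⟨m, hm⟩ := h.exists_num s
  rw [← sem_approx hL, hm.sem_eq, sem_num]
  refine tokNum_mem_numTokens.trans ⟨fun e => e ▸ hm, fun h => ?_⟩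
  exact LConv.num_inj ((Conv.symm h).trans hm)

theorem Stable.tokTrue_mem_iff (h : Stable .bool t) (hL : Rep L s) :
    tokTrue ∈ sem (classSet L) t emptyEnv ↔ LConv (approx s t) .tt := by
  rw [← sem_approx hL]
  refine ⟨fun h' => (h.tt_or_ff s).resolve_right fun hf => ?_, fun h => ?_⟩
  · rw [hf.sem_eq] at h'
    exact tokTrue_ne_tokFalse h'
  · rw [h.sem_eq]
    rfl

theorem Stable.tokFalse_mem_iff (h : Stable .bool t) (hL : Rep L s) :
    tokFalse ∈ sem (classSet L) t emptyEnv ↔ LConv (approx s t) .ff := by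
  rw [← sem_approx hL]
  refine ⟨fun h' => (h.tt_or_ff s).resolve_left fun hf => ?_, fun h => ?_⟩
  · rw [hf.sem_eq] at h'
    exact tokTrue_ne_tokFalse h'.symm
  · rw [h.sem_eq]
    rfl

theorem Stable.tokState_mem_iff (h : Stable .state t) (hL : Rep L s) :
    tokState L₁ ∈ sem (classSet L) t emptyEnv ↔ Rep L₁ (stateValue s t) := by
  rw [← sem_approx hL, (h.conv_stateValue s).sem_eq]
  constructor
  · rintro ⟨L', h, e⟩
    obtain rfl := tokState_inj.1 e
    exact h
  · exact fun h => ⟨L₁, h, rfl⟩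

end Values

@[simp] theorem tokEx_ne_tokOr : tokEx ≠ tokOr := by simp [tokEx, tokOr]
@[simp] theorem tokEx_ne_tokOther : tokEx ≠ tokOther := by simp [tokEx, tokOther]
@[simp] theorem tokOr_ne_tokOther : tokOr ≠ tokOther := by simp [tokOr, tokOther]

theorem tokTrue_ne_tokFst (x : ℕ) : tokTrue ≠ tokFst x := by
  simp [tokTrue, tokFst, Nat.pair_eq_pair]

theorem tokFalse_ne_tokFst (x : ℕ) : tokFalse ≠ tokFst x := by
  simp [tokFalse, tokFst, Nat.pair_eq_pair]

-- A token for the truth value of the type test makes both the test and its complement enumerable;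
-- the test decides whether a backtracking move updates the state.
open Classical in
theorem REFamily.typeAt (A : Formula) (T : Ty) :
    REFamily fun a => ({if LBR.typeAt A a = T then 0 else 1} : Set ℕ) := by
  have const : ∀ {γ : Type} [Primcodable γ] (n : ℕ), REFamily fun _ : γ => ({n} : Set ℕ) :=
    fun n => singleton (by fun_prop)
  have tail : ∀ {B : Formula},
      (REFamily fun a => ({if LBR.typeAt B a = T then 0 else 1} : Set ℕ)) →
      REFamily fun x : Unit × ℕ × List ℕ =>
        ({if LBR.typeAt B x.2.2 = T then 0 else 1} : Set ℕ) := fun h =>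
    comp h (f := fun x : Unit × ℕ × List ℕ => x.2.2) (by fun_prop)
  suffices h : REFamily fun x : Unit × List ℕ =>
      ({if LBR.typeAt A x.2 = T then 0 else 1} : Set ℕ) from
    comp h (f := fun a => ((), a)) (by fun_prop)
  induction A with
  | atom Q ts =>
    exact list_cases (S := fun _ a => {if LBR.typeAt (.atom Q ts) a = T then 0 else 1})
      (const _) (const (if (Formula.atom Q ts).type = T then 0 else 1))
  | imp A B =>
    exact list_cases (S := fun _ a => {if LBR.typeAt (.imp A B) a = T then 0 else 1})
      (const _) (const (if (Formula.imp A B).type = T then 0 else 1))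
  | all A ih =>
    exact list_cases (S := fun _ a => {if LBR.typeAt (.all A) a = T then 0 else 1})
      (const _) (tail (comp ih (f := fun a => ((), a)) (by fun_prop)))
  | ex A ih =>
    exact list_cases (S := fun _ a => {if LBR.typeAt (.ex A) a = T then 0 else 1})
      (const _) (tail (comp ih (f := fun a => ((), a)) (by fun_prop)))
  | and A B ihA ihB =>
    refine list_cases (S := fun _ a => {if LBR.typeAt (.and A B) a = T then 0 else 1})
      (const _) ?_
    refine congr (ite (p := fun x : Unit × ℕ × List ℕ => x.2.1 = 0) (by fun_prop)
      (tail (comp ihA (f := fun a => ((), a)) (by fun_prop)))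
      (tail (comp ihB (f := fun a => ((), a)) (by fun_prop)))) fun x => ?_
    by_cases h : x.2.1 = 0 <;> simp [LBR.typeAt, h]
  | or A B ihA ihB =>
    refine list_cases (S := fun _ a => {if LBR.typeAt (.or A B) a = T then 0 else 1})
      (const _) ?_
    refine congr (ite (p := fun x : Unit × ℕ × List ℕ => x.2.1 = 0) (by fun_prop)
      (tail (comp ihA (f := fun a => ((), a)) (by fun_prop)))
      (tail (comp ihB (f := fun a => ((), a)) (by fun_prop)))) fun x => ?_
    by_cases h : x.2.1 = 0 <;> simp [LBR.typeAt, h]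

theorem sigma1_typeAt (A : Formula) (T : Ty) : Sigma1 fun a => typeAt A a = T :=
  .of_iff (.mem_set (f := fun _ => 0) (by fun_prop) (REFamily.typeAt A T)) fun a => by
    by_cases h : typeAt A a = T <;> simp [h]

theorem sigma1_typeAt_ne (A : Formula) (T : Ty) : Sigma1 fun a => ¬ typeAt A a = T :=
  .of_iff (.mem_set (f := fun _ => 1) (by fun_prop) (REFamily.typeAt A T)) fun a => by
    by_cases h : typeAt A a = T <;> simp [h]

@[fun_prop] theorem primrec_lastOcc {α : Type*} [Primcodable α] {f : α → List (List ℕ)}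
    (hf : Primrec f) : Primrec fun a => lastOcc (f a) := by
  unfold lastOcc; fun_prop

/-! ### The strategy in terms of enumerable relations on codes -/

section Codes

variable {K : Calculus} (A : Formula) (u : ClassTm K)

/-- Tokens which describe the position of `T_A` at a given address. -/
def occSet (a : List ℕ) : Set ℕ := posSet (subAt A a)

/-- The denotation of the realizer associated to a position, at the state listed by `L`. -/
def realSet (L : List AtomCode) (a : List ℕ) : Set ℕ :=
  sem (classSet L) (occRealizer A u a) emptyEnv

/-- In the play `p`, the `j`-th position is followed by the choice of `i`. -/
def Chosen (p : List (List ℕ)) (j : ℕ) (a : List ℕ) (i : ℕ) : Prop :=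
  1 ≤ j ∧ p[j - 1]? = some a ∧ p[j]? = some (a ++ [i])

/-- The choice of `i` at `a` is to be revised. -/
def WrongCode (L : List AtomCode) (a : List ℕ) (i : ℕ) : Prop :=
  (tokEx ∈ occSet A a ∧ ∃ n, ¬ n = i ∧ tokFst (tokNum n) ∈ realSet A u L a) ∨
  (tokOr ∈ occSet A a ∧ ((i = 0 ∧ tokFst tokFalse ∈ realSet A u L a) ∨
    (i = 1 ∧ tokFst tokTrue ∈ realSet A u L a)))

/-- The choice of `i` at `a` is not to be revised. -/
def RightCode (L : List AtomCode) (a : List ℕ) (i : ℕ) : Prop :=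
  (tokEx ∈ occSet A a ∧ tokFst (tokNum i) ∈ realSet A u L a) ∨
  (tokOr ∈ occSet A a ∧ ((¬ i = 0 ∧ ¬ i = 1) ∨ (i = 0 ∧ tokFst tokTrue ∈ realSet A u L a) ∨
    (i = 1 ∧ tokFst tokFalse ∈ realSet A u L a))) ∨
  tokTrue ∈ occSet A a ∨ tokFalse ∈ occSet A a ∨ tokOther ∈ occSet A a

def RevisedCode (L : List AtomCode) (p : List (List ℕ)) (j : ℕ) : Prop :=
  ∃ a i, Chosen p j a i ∧ WrongCode A u L a i

/-- The complement of `RevisedCode` has to be given positively. The play determines the only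
possible choice at `j`, so it is decidable whether there is one, and if there is, `RightCode` must
hold for it. -/
def UnrevisedCode (L : List AtomCode) (p : List (List ℕ)) (j : ℕ) : Prop :=
  (¬ Chosen p j (p[j - 1]?.getD []) ((p[j]?.getD []).getLast?.getD 0)) ∨
    ∃ a i, Chosen p j a i ∧ RightCode A u L a i

/-- Revised indices are smaller than the length of the play, so checking the range of that length
suffices to exclude all revisions. -/
def BackCode (L : List AtomCode) (p r : List (List ℕ)) : Prop :=
  (∃ j, RevisedCode A u L p j ∧ (∀ i ∈ List.range j, UnrevisedCode A u L p i) ∧ r = p.take j) ∨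
  ((∀ i ∈ List.range p.length, UnrevisedCode A u L p i) ∧ r = p)

def UpdateCode (L : List AtomCode) (a : List ℕ) (L' : List AtomCode) : Prop :=
  ∃ L₁, tokState L₁ ∈ realSet A u L a ∧ ∀ c, c ∈ L' ↔ MemCunion L L₁ c

def MoveCode (L : List AtomCode) (p r : List (List ℕ)) : Prop :=
  (tokEx ∈ occSet A (lastOcc p) ∧
    ∃ n, tokFst (tokNum n) ∈ realSet A u L (lastOcc p) ∧ r = p ++ [lastOcc p ++ [n]]) ∨
  (tokOr ∈ occSet A (lastOcc p) ∧
    ((tokFst tokTrue ∈ realSet A u L (lastOcc p) ∧ r = p ++ [lastOcc p ++ [0]]) ∨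
      (tokFst tokFalse ∈ realSet A u L (lastOcc p) ∧ r = p ++ [lastOcc p ++ [1]]))) ∨
  (tokFalse ∈ occSet A (lastOcc p) ∧
    ∃ L', UpdateCode A u L (lastOcc p) L' ∧ BackCode A u L' p r) ∨
  ((tokTrue ∈ occSet A (lastOcc p) ∨ tokOther ∈ occSet A (lastOcc p)) ∧ r = p)

/-- The type of the realizer is read from the address by `typeAt`, in place of a search for a typing
derivation. -/
def NextCode (L : List AtomCode) (p p' : List (List ℕ)) (L' : List AtomCode) : Prop :=
  (p' = p.take p'.length ∧ typeAt A (lastOcc p) = .state ∧ UpdateCode A u L (lastOcc p) L') ∨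
  ((¬ p' = p.take p'.length ∨ ¬ typeAt A (lastOcc p) = .state) ∧ L' = L)

/-- The steps of a computation of the state associated to a play. -/
def TraceCode (L₀ : List AtomCode) (P : List (List (List ℕ))) (L : List AtomCode) : Prop :=
  ∃ (w : List (List AtomCode × List (List ℕ) × List (List ℕ) × List AtomCode))
    (p : List (List ℕ)), P = w.map (fun e => e.2.1) ++ [p] ∧ P.tail = w.map (fun e => e.2.2.1) ∧
      w.map (fun e => e.1) ++ [L] = L₀ :: w.map (fun e => e.2.2.2) ∧
      ∀ e ∈ w, NextCode A u e.1 e.2.1 e.2.2.1 e.2.2.2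

def OmegaCode (P : List (List (List ℕ))) (r : List (List ℕ)) : Prop :=
  (P.head? = some rootPlay ∧ ∃ L, TraceCode A u [] P L ∧ MoveCode A u L (P.getLast?.getD []) r) ∨
  (¬ P.head? = some rootPlay ∧ r = P.getLast?.getD [])

section

variable {α : Type} [Primcodable α]

@[fun_prop] theorem REFamily.occSet {f : α → List ℕ} (hf : Primrec f) :
    REFamily fun x => LBR.occSet A (f x) :=
  REFamily.comp (REFamily.posSet_subAt A) hf

@[fun_prop] theorem REFamily.realSet {l : α → List AtomCode} {f : α → List ℕ} (hl : Primrec l)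
    (hf : Primrec f) : REFamily fun x => LBR.realSet A u (l x) (f x) :=
  REFamily.comp (REFamily.sem_occRealizer_classSet A u) (f := fun x => (l x, f x)) (by fun_prop)

@[fun_prop] theorem primrecPred_chosen {p : α → List (List ℕ)} {j : α → ℕ} {a : α → List ℕ}
    {i : α → ℕ} (hp : Primrec p) (hj : Primrec j) (ha : Primrec a) (hi : Primrec i) :
    PrimrecPred fun x => Chosen (p x) (j x) (a x) (i x) := by
  unfold Chosen; fun_prop

@[fun_prop] theorem sigma1_chosen {p : α → List (List ℕ)} {j : α → ℕ} {a : α → List ℕ}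
    {i : α → ℕ} (hp : Primrec p) (hj : Primrec j) (ha : Primrec a) (hi : Primrec i) :
    Sigma1 fun x => Chosen (p x) (j x) (a x) (i x) := .of_primrecPred (by fun_prop)

@[fun_prop] theorem sigma1_revisedCode {l : α → List AtomCode} {p : α → List (List ℕ)}
    {j : α → ℕ} (hl : Primrec l) (hp : Primrec p) (hj : Primrec j) :
    Sigma1 fun x => RevisedCode A u (l x) (p x) (j x) := by
  unfold RevisedCode WrongCode; fun_prop

@[fun_prop] theorem sigma1_unrevisedCode {l : α → List AtomCode} {p : α → List (List ℕ)}
    {j : α → ℕ} (hl : Primrec l) (hp : Primrec p) (hj : Primrec j) :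
    Sigma1 fun x => UnrevisedCode A u (l x) (p x) (j x) := by
  unfold UnrevisedCode RightCode; fun_prop

@[fun_prop] theorem sigma1_backCode {l : α → List AtomCode} {p r : α → List (List ℕ)}
    (hl : Primrec l) (hp : Primrec p) (hr : Primrec r) :
    Sigma1 fun x => BackCode A u (l x) (p x) (r x) := by
  unfold BackCode; fun_prop

@[fun_prop] theorem sigma1_updateCode {l : α → List AtomCode} {a : α → List ℕ}
    {l' : α → List AtomCode} (hl : Primrec l) (ha : Primrec a) (hl' : Primrec l') :
    Sigma1 fun x => UpdateCode A u (l x) (a x) (l' x) := by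
  unfold UpdateCode; fun_prop

@[fun_prop] theorem sigma1_moveCode {l : α → List AtomCode} {p r : α → List (List ℕ)}
    (hl : Primrec l) (hp : Primrec p) (hr : Primrec r) :
    Sigma1 fun x => MoveCode A u (l x) (p x) (r x) := by
  unfold MoveCode; fun_prop

@[fun_prop] theorem sigma1_nextCode {l l' : α → List AtomCode} {p p' : α → List (List ℕ)}
    (hl : Primrec l) (hp : Primrec p) (hp' : Primrec p') (hl' : Primrec l') :
    Sigma1 fun x => NextCode A u (l x) (p x) (p' x) (l' x) := by
  have h₁ : Sigma1 fun x => typeAt A (lastOcc (p x)) = .state :=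
    (sigma1_typeAt A .state).comp (f := fun x => lastOcc (p x)) (by fun_prop)
  have h₂ : Sigma1 fun x => ¬ typeAt A (lastOcc (p x)) = .state :=
    (sigma1_typeAt_ne A .state).comp (f := fun x => lastOcc (p x)) (by fun_prop)
  exact .or (.and (by fun_prop) (.and h₁ (by fun_prop)))
    (.and (.or (by fun_prop) h₂) (by fun_prop))

theorem sigma1_omegaCode : Sigma1 fun x : List (List (List ℕ)) × List (List ℕ) =>
    OmegaCode A u x.1 x.2 := by
  unfold OmegaCode TraceCode; fun_prop

end

end Codes

/-! ### Correctness of the relations on codes -/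

section Recursive

variable {K : Calculus} {A : Formula} {u : ClassTm K} {L L' : List AtomCode} {s : State}

theorem occSet_atom (hA : A.Closed) {a : List ℕ} {Q : TTm} {ts : List TTm}
    (h : subAt A a = some (.atom Q ts)) :
    (TConv (Q.appList ts) .tt ∧ occSet A a = {tokTrue}) ∨
      TConv (Q.appList ts) .ff ∧ occSet A a = {tokFalse} := by
  rw [occSet, h, posSet]
  exact (wf_subAt h hA).conv_bool.imp (fun h => ⟨h, h.semT_eq _⟩) fun h => ⟨h, h.semT_eq _⟩

/-- The choice of `i` at `a` is not the one indicated by the associated realizer at `s`. -/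
def Wrong (A : Formula) (u : ClassTm K) (s : State) (a : List ℕ) (i : ℕ) : Prop :=
  ((∃ B, subAt A a = some (.ex B)) ∧ ¬ LConv (approx s (.fst (occRealizer A u a))) (Tm.num i)) ∨
    ((∃ B C, subAt A a = some (.or B C)) ∧
      ((i = 0 ∧ LConv (approx s (.fst (occRealizer A u a))) .ff) ∨
        (i = 1 ∧ LConv (approx s (.fst (occRealizer A u a))) .tt)))

theorem revised_iff {p : List (List ℕ)} {j : ℕ} :
    Revised A u s p j ↔ ∃ a i, Chosen p j a i ∧ Wrong A u s a i := by
  have key : ∀ {a}, 1 ≤ j → p[j - 1]? = some a → rho A u (p.take j) = occRealizer A u a := by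
    intro a hj h
    obtain ⟨j, rfl⟩ : ∃ k, j = k + 1 := ⟨j - 1, by omega⟩
    exact rho_take u h
  constructor
  · rintro ⟨h₀, a, i, h₁, h₂, h₃⟩
    rw [key h₀ h₁] at h₃
    exact ⟨a, i, ⟨h₀, h₁, h₂⟩, h₃⟩
  · rintro ⟨a, i, ⟨h₀, h₁, h₂⟩, h₃⟩
    refine ⟨h₀, a, i, h₁, h₂, ?_⟩
    rwa [key h₀ h₁]

theorem Stable.fst_ex (hst : Stable A.type u) {a : List ℕ} {B : Formula}
    (h : subAt A a = some (.ex B)) : Stable .nat (.fst (occRealizer A u a)) := by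
  have := stable_occRealizer hst a
  rw [typeAt_eq h] at this
  exact this.2.1

theorem Stable.fst_or (hst : Stable A.type u) {a : List ℕ} {B C : Formula}
    (h : subAt A a = some (.or B C)) : Stable .bool (.fst (occRealizer A u a)) := by
  have := stable_occRealizer hst a
  rw [typeAt_eq h] at this
  exact this.2.1

theorem tokNum_mem_realSet (hst : Stable A.type u) (hL : Rep L s) {a : List ℕ} {B : Formula}
    (h : subAt A a = some (.ex B)) {n : ℕ} : tokFst (tokNum n) ∈ realSet A u L a ↔
      LConv (approx s (.fst (occRealizer A u a))) (Tm.num n) :=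
  (hst.fst_ex h).tokNum_mem_iff hL

theorem tokTrue_mem_realSet (hst : Stable A.type u) (hL : Rep L s) {a : List ℕ} {B C : Formula}
    (h : subAt A a = some (.or B C)) : tokFst tokTrue ∈ realSet A u L a ↔
      LConv (approx s (.fst (occRealizer A u a))) .tt :=
  (hst.fst_or h).tokTrue_mem_iff hL

theorem tokFalse_mem_realSet (hst : Stable A.type u) (hL : Rep L s) {a : List ℕ} {B C : Formula}
    (h : subAt A a = some (.or B C)) : tokFst tokFalse ∈ realSet A u L a ↔
      LConv (approx s (.fst (occRealizer A u a))) .ff :=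
  (hst.fst_or h).tokFalse_mem_iff hL

theorem Stable.ff_iff_not_tt {t : ClassTm K} (h : Stable .bool t) (s : State) :
    LConv (approx s t) .ff ↔ ¬ LConv (approx s t) .tt :=
  ⟨fun h₁ h₂ => LConv.not_tt_ff ((Conv.symm h₂).trans h₁), (h.tt_or_ff s).resolve_left⟩

/-- Since the realizer at an existential formula has exactly one value, not having the value `i` is
the same as having another value, and that is enumerable. -/
theorem wrongCode_iff (hst : Stable A.type u) (hA : A.Closed) (hL : Rep L s) {a : List ℕ} {i : ℕ} :
    WrongCode A u L a i ↔ Wrong A u s a i := by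
  rcases h : subAt A a with _ | B
  · simp [WrongCode, Wrong, occSet, h, posSet]
  cases B with
  | ex B =>
    have hn := (hst.fst_ex h).conv_numValue s
    have : ∀ n, LConv (approx s (.fst (occRealizer A u a))) (Tm.num n) ↔
      n = numValue s (.fst (occRealizer A u a)) := fun n =>
        ⟨fun h => h.numValue_eq.symm, fun h => h ▸ hn⟩
    simp [WrongCode, Wrong, tokNum_mem_realSet hst hL h, this, occSet, h, posSet, eq_comm]
  | or B C =>
    simp [WrongCode, Wrong, tokTrue_mem_realSet hst hL h, tokFalse_mem_realSet hst hL h, occSet, h,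
      posSet]
  | atom Q ts =>
    obtain ⟨-, h'⟩ | ⟨-, h'⟩ := occSet_atom hA h <;>
      simp [WrongCode, Wrong, h', h, tokEx, tokOr, (tokTrue_ne_tokFst _).symm,
        (tokFalse_ne_tokFst _).symm]
  | _ => simp [WrongCode, Wrong, occSet, h, posSet]

theorem rightCode_iff (hst : Stable A.type u) (hA : A.Closed) (hL : Rep L s) {a : List ℕ} {i : ℕ} :
    RightCode A u L a i ↔ ¬ Wrong A u s a i := by
  rcases h : subAt A a with _ | B
  · simp [RightCode, Wrong, occSet, h, posSet]
  cases B with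
  | ex B =>
    simp [RightCode, Wrong, tokNum_mem_realSet hst hL h, occSet, h, posSet, tokEx, tokOther,
      tokTrue_ne_tokFst, tokFalse_ne_tokFst, tokOr]
  | or B C =>
    have := (hst.fst_or h).ff_iff_not_tt s
    simp only [RightCode, Wrong, tokTrue_mem_realSet hst hL h, tokFalse_mem_realSet hst hL h,
      occSet, h, posSet, tokEx, tokOther, tokOr]
    rcases i with _ | _ | i <;> simp [this, tokTrue_ne_tokFst, tokFalse_ne_tokFst]
  | atom Q ts =>
    obtain ⟨-, h'⟩ | ⟨-, h'⟩ := occSet_atom hA h <;> simp [RightCode, Wrong, h', h]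
  | _ => simp [RightCode, Wrong, occSet, h, posSet]

theorem Chosen.unique {p : List (List ℕ)} {j : ℕ} {a : List ℕ} {i : ℕ} (h : Chosen p j a i) :
    a = p[j - 1]?.getD [] ∧ i = (p[j]?.getD []).getLast?.getD 0 := by
  simp [h.2.1, h.2.2]

theorem revisedCode_iff (hst : Stable A.type u) (hA : A.Closed) (hL : Rep L s)
    {p : List (List ℕ)} {j : ℕ} : RevisedCode A u L p j ↔ Revised A u s p j := by
  simp only [RevisedCode, revised_iff, wrongCode_iff hst hA hL]

theorem unrevisedCode_iff (hst : Stable A.type u) (hA : A.Closed) (hL : Rep L s)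
    {p : List (List ℕ)} {j : ℕ} : UnrevisedCode A u L p j ↔ ¬ Revised A u s p j := by
  simp only [UnrevisedCode, revised_iff, rightCode_iff hst hA hL, not_exists, not_and]
  constructor
  · rintro (h | ⟨a, i, h, hw⟩) a' i' h'
    · obtain ⟨rfl, rfl⟩ := h'.unique
      exact absurd h' h
    · obtain ⟨rfl, rfl⟩ := h'.unique
      obtain ⟨rfl, rfl⟩ := h.unique
      exact hw
  · intro h
    by_cases hc : Chosen p j (p[j - 1]?.getD []) ((p[j]?.getD []).getLast?.getD 0)
    · exact .inr ⟨_, _, hc, h _ _ hc⟩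
    · exact .inl hc

theorem backCode_iff (hst : Stable A.type u) (hA : A.Closed) (hL : Rep L s)
    {p r : List (List ℕ)} : BackCode A u L p r ↔ backtrack A u s p = r := by
  classical
  simp only [BackCode, revisedCode_iff hst hA hL, unrevisedCode_iff hst hA hL, List.mem_range]
  by_cases h : ∃ j, Revised A u s p j
  · rw [backtrack, dif_pos h]
    constructor
    · rintro (⟨j, hj, hj', rfl⟩ | ⟨hp, rfl⟩)
      · rw [(Nat.find_eq_iff h).2 ⟨hj, hj'⟩]
      · obtain ⟨j, hj⟩ := h
        exact absurd hj (hp j hj.bounds.2)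
    · rintro rfl
      exact .inl ⟨_, Nat.find_spec h, fun _ => Nat.find_min h, rfl⟩
  · rw [backtrack, dif_neg h]
    simp only [not_exists] at h
    simp [h, eq_comm]

theorem UpdateCode.rep (hL : Rep L s) {a : List ℕ} (h : Stable .state (occRealizer A u a))
    (hc : UpdateCode A u L a L') : Rep L' (update s (occRealizer A u a)) := by
  obtain ⟨L₁, h₁, h₂⟩ := hc
  exact (hL.cunion ((h.tokState_mem_iff hL).1 h₁)).2 h₂

theorem exists_updateCode (hL : Rep L s) {a : List ℕ} (h : Stable .state (occRealizer A u a)) :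
    ∃ L', UpdateCode A u L a L' := by
  obtain ⟨L₁, h₁⟩ := exists_rep (stateValue s (occRealizer A u a))
  obtain ⟨L', h'⟩ := exists_rep (update s (occRealizer A u a))
  exact ⟨L', L₁, (h.tokState_mem_iff hL).2 h₁, (hL.cunion h₁).1 h'⟩

theorem moveCode_iff (hst : Stable A.type u) (hA : A.Closed) (hL : Rep L s)
    {p r : List (List ℕ)} : MoveCode A u L p r ↔ move A u s p = r := by
  have hrho : rho A u p = occRealizer A u (lastOcc p) := rfl
  rcases h : subAt A (lastOcc p) with _ | B
  · simp [MoveCode, move, occSet, h, posSet, tokOther, tokTrue_ne_tokFst, tokFalse_ne_tokFst,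
      tokEx, tokOr, eq_comm]
  cases B with
  | ex B =>
    have hn := (hst.fst_ex h).conv_numValue s
    have : ∀ n, LConv (approx s (.fst (occRealizer A u (lastOcc p)))) (Tm.num n) ↔
      n = numValue s (.fst (occRealizer A u (lastOcc p))) := fun n =>
        ⟨fun h => h.numValue_eq.symm, fun h => h ▸ hn⟩
    simp [MoveCode, move, tokNum_mem_realSet hst hL h, this, occSet, h, posSet, hrho,
      tokTrue_ne_tokFst, tokFalse_ne_tokFst, tokEx, tokOr, tokOther, eq_comm]
  | or B C =>
    have := (hst.fst_or h).ff_iff_not_tt s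
    by_cases htt : LConv (approx s (.fst (occRealizer A u (lastOcc p)))) .tt <;>
    simp [MoveCode, move, tokTrue_mem_realSet hst hL h, tokFalse_mem_realSet hst hL h, this, occSet,
      h, posSet, hrho, tokTrue_ne_tokFst, tokFalse_ne_tokFst, tokEx, tokOr, tokOther, eq_comm, htt]
  | atom Q ts =>
    obtain ⟨ht, h'⟩ | ⟨hf, h'⟩ := occSet_atom hA h
    · have hf : ¬ TConv (Q.appList ts) .ff := fun hf => ht.not_tt_ff hf
      simp [MoveCode, move, h', h, hf, tokEx, tokOr, tokOther, (tokTrue_ne_tokFst _).symm, eq_comm,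
        tokTrue_ne_tokFalse.symm]
    · have hs := stable_occRealizer hst (lastOcc p)
      rw [typeAt_eq h] at hs
      have : (∃ L', UpdateCode A u L (lastOcc p) L' ∧ BackCode A u L' p r) ↔
          backtrack A u (update s (occRealizer A u (lastOcc p))) p = r := by
        constructor
        · rintro ⟨L', h₁, h₂⟩
          exact (backCode_iff hst hA (h₁.rep hL hs)).1 h₂
        · intro h
          obtain ⟨L', h'⟩ := exists_updateCode hL hs
          exact ⟨L', h', (backCode_iff hst hA (h'.rep hL hs)).2 h⟩
      simp [MoveCode, move, h', h, hf, tokEx, tokOr, tokOther, (tokFalse_ne_tokFst _).symm, this,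
        hrho]
  | _ =>
    simp [MoveCode, move, occSet, h, posSet, tokOther, tokTrue_ne_tokFst, tokFalse_ne_tokFst,
      tokEx, tokOr, eq_comm]

/-- Types are unique, and one type of the realizer is known from stability. -/
theorem closedOfType_rho_iff (hst : Stable A.type u) {p : List (List ℕ)} {T : Ty} :
    ClosedOfType (rho A u p) T ↔ typeAt A (lastOcc p) = T := by
  have := (stable_occRealizer hst (lastOcc p)).closed
  exact ⟨fun h => HasType.unique this h, fun h => h ▸ this⟩

theorem NextCode.rep (hst : Stable A.type u) (hL : Rep L s) {p p' : List (List ℕ)}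
    (h : NextCode A u L p p' L') : Rep L' (nextState A u s p p') := by
  have e : p' <+: p ∧ ClosedOfType (rho A u p) .state ↔
      p' = p.take p'.length ∧ typeAt A (lastOcc p) = .state :=
    and_congr List.prefix_iff_eq_take (closedOfType_rho_iff hst)
  rw [nextState]
  rcases h with ⟨h₁, h₂, h₃⟩ | ⟨h₁, rfl⟩
  · rw [if_pos (e.2 ⟨h₁, h₂⟩)]
    have := stable_occRealizer hst (lastOcc p)
    rw [h₂] at this
    exact h₃.rep hL this
  · rwa [if_neg (mt e.1 (not_and_or.2 h₁))]

theorem exists_nextCode (hst : Stable A.type u) (hL : Rep L s) (p p' : List (List ℕ)) :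
    ∃ L', NextCode A u L p p' L' := by
  by_cases h : p' = p.take p'.length ∧ typeAt A (lastOcc p) = .state
  · have := stable_occRealizer hst (lastOcc p)
    rw [h.2] at this
    obtain ⟨L', h'⟩ := exists_updateCode hL this
    exact ⟨L', .inl ⟨h.1, h.2, h'⟩⟩
  · exact ⟨L, .inr ⟨not_and_or.1 h, rfl⟩⟩

theorem TraceCode.rep (hst : Stable A.type u) (hL : Rep L s) {P : List (List (List ℕ))}
    (h : TraceCode A u L P L') : Rep L' (stateFrom A u s P) := by
  obtain ⟨w, p, h₁, h₂, h₃, h₄⟩ := h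
  induction w generalizing L s P with
  | nil =>
    simp only [List.map_nil, List.nil_append, List.cons.injEq] at h₁ h₃
    rw [h₁, h₃.1]
    exact hL
  | cons e w ih =>
    obtain ⟨L₀, q, q', L₁⟩ := e
    simp only [List.map_cons, List.cons_append, List.cons.injEq] at h₁ h₂ h₃
    obtain ⟨rfl, h₃⟩ := h₃
    rw [h₁, List.tail_cons] at h₂
    rw [h₁, h₂, stateFrom]
    refine ih ((h₄ _ List.mem_cons_self).rep hst hL) (h₂.symm) rfl h₃
      fun e he => h₄ e (List.mem_cons_of_mem _ he)

theorem exists_traceCode (hst : Stable A.type u) (hL : Rep L s) {P : List (List (List ℕ))}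
    (hP : P ≠ []) : ∃ L', TraceCode A u L P L' := by
  induction P generalizing L s with
  | nil => exact absurd rfl hP
  | cons p P ih =>
    cases P with
    | nil => exact ⟨L, [], p, by simp⟩
    | cons p' P =>
      obtain ⟨L₁, h₁⟩ := exists_nextCode hst hL p p'
      obtain ⟨L', w, q, hw₁, hw₂, hw₃, hw₄⟩ := ih (h₁.rep hst hL) (by simp)
      refine ⟨L', (L, p, p', L₁) :: w, q, by simp [hw₁], by simpa using hw₂, by simp [hw₃], ?_⟩
      rintro e he
      rcases List.mem_cons.1 he with rfl | he
      · exact h₁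
      · exact hw₄ e he

/-- Different traces may end in different lists, but all of them represent the state of the play,
and the move depends only on this state. -/
theorem omegaCode_iff (hst : Stable A.type u) (hA : A.Closed) {P : List (List (List ℕ))}
    {r : List (List ℕ)} : OmegaCode A u P r ↔ omega A u P = r := by
  have h0 : Rep [] State.empty := rep_empty.2 rfl
  by_cases h : P.head? = some rootPlay
  · have hP : P ≠ [] := by rintro rfl; simp at h
    simp only [OmegaCode, h, omega, if_true, true_and, not_true, false_and, or_false]
    constructor
    · rintro ⟨L, h₁, h₂⟩
      exact (moveCode_iff hst hA (h₁.rep hst h0)).1 h₂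
    · intro h
      obtain ⟨L, hL⟩ := exists_traceCode hst h0 hP
      exact ⟨L, hL, (moveCode_iff hst hA (hL.rep hst h0)).2 h⟩
  · simp [OmegaCode, h, omega, eq_comm]

/-- The enumerability of the graph holds on all lists, so `omega` is its own computable extension
beyond the finite plays. -/
theorem isRecursive_omega (hst : Stable A.type u) (hA : A.Closed) :
    (oneBack (tarski A)).IsRecursive (omega A u) :=
  ⟨omega A u, Sigma1.computable (Sigma1.of_iff (sigma1_omegaCode A u) fun _ =>
    (omegaCode_iff hst hA).symm), fun _ _ => rfl⟩

end Recursive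

end LBR

/-! ### The soundness theorem -/

theorem mainTheorem2 (K : Calculus) (A : Formula) (hA : A.Closed) (hA' : A.ImpFree)
    (u : ClassTm K) (hu : Realizes u A) :
    (oneBack (tarski A)).IsWinningStrategyFrom rootPlay (omega A u) ∧
    (oneBack (tarski A)).IsRecursive (omega A u) ∧
    (∀ P, (oneBack (tarski A)).IsPlay P → Game.StartsFrom rootPlay P →
      (oneBack (tarski A)).Correct (omega A u) P → P.Terminates) ∧
    (∀ P, (oneBack (tarski A)).IsComplete P → Game.StartsFrom rootPlay P →
      (oneBack (tarski A)).Correct (omega A u) P →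
      ∃ (Q : List (List (List ℕ))) (p : List (List ℕ)) (a : List ℕ),
        P = ↑(Q ++ [p ++ [a]]) ∧ IsTrueAtom A a) := by
  refine ⟨⟨isStrategy_omega, fun P hP h0 hc => mem_W_of_complete hA hA' hu hP h0 hc⟩,
    isRecursive_omega hu.1.stable hA,
    fun P hP h0 hc => terminates_of_correct hA hA' hu hP h0 hc,
    fun P hP h0 hc => exists_trueAtom_of_mem_W (mem_W_of_complete hA hA' hu hP h0 hc)⟩
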